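/- Let $\varphi=(1+\sqrt5)/2$. Nodes of a graph communicate in slots; a slot costs a correct node $S$ if it sends and $L$ if it listens, and nothing otherwise ($S,L\ge 0$ constants). **Local Broadcast** with parameter $n\ge 2$ (sender $q$, receivers $R\subseteq N(q)$, $|R|\le n$) runs in rounds $i\ge \lg(4\ln n)$, each with four phases (lengths rounded up): $2^{\varphi i}$ slots in which $q$ sends with probability $3\ln n/2^i$ and each receiver without the message listens with probability $2/2^{(\varphi-1)i}$; $2^{(\varphi-1)i+1}$ slots in which $q$ sends and each such receiver listens; $2^i$ slots in which each receiver still without the message sends a request and $q$ listens with probability $4\ln n/2^i$; $2^{(\varphi-1)i+1}$ slots in which each such receiver sends a request and $q$ listens. A receiver stops when it has the message; $q$ stops at the end of a round in which it listened to a slot without request or noise. Each execution is given its own slot in each cycle of a window of $D=\lceil 25(B_0+2^{\varphi-1}\ln^{\varphi-1}n)^{\varphi+1}\rceil$ cycles, and is cut off at the end of the window. **Adversary.** A set $F$ of Byzantine nodes, not containing the dealer $d$, is controlled by an adaptive adversary, who bases her choices on everything that has happened before the current slot. Messages are authenticated. A Byzantine node may say anything whenever it sends in an execution of which it is the sender.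 It *disrupts* a slot if it makes noise, forges a request, or, being the sender of the execution, withholds the transmission that the protocol (with its coin flip for that slot, which is not known when the decision to disrupt is taken) may prescribe; the slot is then lost at all its neighbours, which cannot distinguish disruption from a collision. For each correct node $p$, at most $\beta$ slots of executions in which $p$ is still active are disrupted by Byzantine nodes of $N(p)$, where $\beta\le B_0$ and $B_0\ge1$ is known to all nodes. *Reliable broadcast* means that, with certainty, each correct node eventually commits to the dealer's message $m$ and never commits to another value. **Theorem.** For all $S,L$ and $\varepsilon>0$ there is a constant $K$ such that (i) and (ii) hold, and (iii) holds as well. (i) *Grid.* Nodes are the points of $\mathbb Z^2$, neighbours are points at $L_\infty$-distance at most $r$, $d=(0,0)$, every closed ball of radius $r$ contains at most $t<\frac r2(2r+1)$ Byzantine nodes, and $n=(2r+1)^2-1$. Consider the Bhandari–Vaidya protocol with its messages sent by Local Broadcast along corridors of width $2r+1$ that cover the grid (two vertical ones from the dealer, then two horizontal ones from each point $(0,k(2r+1))$): nodes within distance $r$ of $d$ commit to what they receive from $d$; committed nodes send commit messages; each node relays, by heard messages, the commit messages of its sister nodes ($r$ rows before it and $r$ columns to either side); any other node commits to $v$ when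 it has received $v$ in commit or heard messages along at least $t+1$ node-disjoint paths lying in a single ball of radius $r$. This protocol achieves reliable broadcast, and if $\beta\ge K\,n\ln^{\varphi+1}n$, then each correct node has expected cost at most $\varepsilon\beta$. (ii) *General graphs, FCPA.* Let $G$ be a graph with all degrees at most $n$, $n\ge2$, let $X(p)$ be the set of neighbours of $p$ that are closer to $d$ than $p$, and suppose that $2t<|X(p)|$ for every $p\ne d$ that is not a neighbour of $d$, and that each correct node has at most $t$ Byzantine neighbours. In FCPA, which uses that the topology and the location of the dealer are known, $d$ sends $m$ in window $0$; a node $p$ at distance $s_p$ from $d$ listens only to the nodes of $X(p)$, commits to what it hears from $d$ if $s_p=1$ and otherwise to a value received from $t+1$ nodes of $X(p)$, and sends this value by Local Broadcast in window $s_p$. FCPA achieves reliable broadcast, and if $\beta\ge K\,n\ln^{\varphi+1}n$, then each correct node has expected cost at most $\varepsilon\beta$. (iii) *General graphs, CPA.* For all $n\ge 2$ and $N$ there is $\beta_0$ such that, if $G$ is any graph with $N$ nodes and all degrees at most $n$ on which the Certified Propagation Algorithm (neighbours of $d$ commit to what $d$ sends, any other node to a value announced by $t+1$ neighbours) achieves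 reliable broadcast from $d$ without jamming, against every set of Byzantine nodes with at most $t$ in the neighbourhood of each correct node, then CPA with Local Broadcast (the dealer's window, followed by $N$ windows, in each of which every node announces to its neighbours the value to which it is committed, or that it has none) achieves reliable broadcast under such faults and jamming, and if $\beta\ge\beta_0$, then each correct node has expected cost at most $\varepsilon\beta$. -/

import Mathlib

open MeasureTheory
open scoped ENNReal NNReal goldenRatio

noncomputable section

namespace JamRB

/-! ### The slot structure of one execution of Local Broadcast with parameter `n`

Round `i` consists of `2^(φ i)` slots of the probabilistic send phase, `2^((φ-1)i+1)` slots of the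
deterministic send phase, `2^i` slots of the probabilistic nack phase and `2^((φ-1)i+1)` slots of
the deterministic nack phase (lengths rounded up to integers). The first round is the least
integer `i ≥ lg (4 ln n)`. -/

/-- The first round of Local Broadcast. -/
def firstRound (n : ℕ) : ℕ := ⌈Real.logb 2 (4 * Real.log n)⌉₊

/-- Number of slots of the probabilistic send phase of round `i`. -/
def probSendLen (i : ℕ) : ℕ := ⌈(2 : ℝ) ^ (φ * i)⌉₊

/-- Number of slots of each of the two deterministic phases of round `i`. -/
def detLen (i : ℕ) : ℕ := ⌈(2 : ℝ) ^ ((φ - 1) * i + 1)⌉₊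

/-- Number of slots of round `i`. -/
def roundLen (i : ℕ) : ℕ := probSendLen i + detLen i + 2 ^ i + detLen i

/-- The round to which the `j`-th slot of an execution belongs, and its offset in that round. -/
def position (n : ℕ) : ℕ → ℕ × ℕ
  | 0 => (firstRound n, 0)
  | j + 1 =>
    if (position n j).2 + 1 < roundLen (position n j).1
    then ((position n j).1, (position n j).2 + 1)
    else ((position n j).1 + 1, 0)

/-- The four phases of a round. -/
inductive Phase
  | probSend
  | detSend
  | probNack
  | detNack

/-- The round of the `j`-th slot. -/
def roundOf (n j : ℕ) : ℕ := (position n j).1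

/-- The phase of the `j`-th slot. -/
def phaseOf (n j : ℕ) : Phase :=
  if (position n j).2 < probSendLen (roundOf n j) then Phase.probSend
  else if (position n j).2 < probSendLen (roundOf n j) + detLen (roundOf n j) then Phase.detSend
  else if (position n j).2 < probSendLen (roundOf n j) + detLen (roundOf n j) + 2 ^ roundOf n j
    then Phase.probNack
  else Phase.detNack

/-- The `j`-th slot is the last one of its round. -/
def LastSlot (n j : ℕ) : Prop := (position n j).2 + 1 = roundLen (roundOf n j)

/-- Whether an active sender transmits in slot `j`, when its random draw is `x`. -/
def SendRule (n j : ℕ) (x : unitInterval) : Prop :=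
  match phaseOf n j with
  | Phase.probSend => (x : ℝ) < 3 * Real.log n / 2 ^ roundOf n j
  | Phase.detSend => True
  | _ => False

/-- Whether an active receiver listens in slot `j`, when its random draw is `x`. -/
def ListenRule (n j : ℕ) (x : unitInterval) : Prop :=
  match phaseOf n j with
  | Phase.probSend => (x : ℝ) < 2 / (2 : ℝ) ^ ((φ - 1) * roundOf n j)
  | Phase.detSend => True
  | _ => False

/-- Whether an active receiver sends a request for retransmission in slot `j`. -/
def ReqRule (n j : ℕ) : Prop :=
  match phaseOf n j with
  | Phase.probNack => True
  | Phase.detNack => True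
  | _ => False

/-- Whether an active sender listens for requests in slot `j`, when its random draw is `x`. -/
def NackListenRule (n j : ℕ) (x : unitInterval) : Prop :=
  match phaseOf n j with
  | Phase.probNack => (x : ℝ) < 4 * Real.log n / 2 ^ roundOf n j
  | Phase.detNack => True
  | _ => False

/-- The number `D` of cycles reserved for one execution of Local Broadcast,
`25 (B₀ + 2^(φ-1) ln^(φ-1) n)^(φ+1)`, rounded up. -/
def windowLen (n B₀ : ℕ) : ℕ :=
  ⌈25 * ((B₀ : ℝ) + (2 : ℝ) ^ (φ - 1) * Real.log n ^ (φ - 1)) ^ (φ + 1)⌉₊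

/-! ### Protocols composed of executions of Local Broadcast -/

/-- A protocol all of whose communication consists of executions (indexed by `E`) of Local
Broadcast. Execution `e` occupies the cycles `window e * D, …, window e * D + D - 1`, one slot in
each of them. A node's view records, for each execution, the value that the node has received in
it so far (`none`: nothing, or a message by which the sender says it has no value). -/
structure Plan (V E M : Type*) where
  /-- the sender of the execution -/
  sender : E → V
  /-- the nodes that take part in the execution as receivers -/
  receivers : E → Set V
  /-- the time window of the execution -/
  window : E → ℕ
  /-- what a correct sender sends in the execution, as a function of its view at the start -/
  payload : E → (E → Option M) → Option M
  /-- the value to which a node is committed, as a function of its view -/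
  commit : V → (E → Option M) → Option M

/-- The random draws: one for each execution, each slot of it, and each node. -/
abbrev Draws (V E : Type*) := E × ℕ × V → unitInterval

/-- The draws are independent and uniformly distributed. -/
def drawMeasure (V E : Type*) : Measure (Draws V E) :=
  Measure.infinitePi (fun _ : E × ℕ × V => (volume : Measure unitInterval))

/-- An adaptive strategy of the adversary Carol against executions with time windows `window`, of
`D` cycles each. In each slot of each execution she picks
* `disrupt`: the Byzantine nodes that disrupt the slot, that is, that make noise, send a forged
  request, or, as the sender of the execution, withhold what the protocol would have them transmit;
* `eager`: whether a non-disrupting Byzantine sender transmits anyway or follows the coin flips of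
  the protocol;
* `content`: what the Byzantine sender says when it transmits (it may vary from slot to slot).

Her choices depend on all the draws of all nodes before the slot (draws made elsewhere in the same
cycle are available to her as well, whatever the order of the slots in a cycle is), but not on
those made in the slot itself or later. -/
structure Carol (V E M : Type*) (window : E → ℕ) (D : ℕ) where
  /-- the disrupting nodes (only the Byzantine ones among them matter) -/
  disrupt : E → ℕ → Draws V E → Set V
  /-- transmit regardless of the coin flip -/
  eager : E → ℕ → Draws V E → Prop
  /-- the contents of a Byzantine sender's message -/
  content : E → ℕ → Draws V E → Option M
  adapted : ∀ (e : E) (j : ℕ) (ω ω' : Draws V E),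
    (∀ (e' : E) (j' : ℕ) (v : V), window e' * D + j' ≤ window e * D + j → (e', j') ≠ (e, j) →
      ω (e', j', v) = ω' (e', j', v)) →
    disrupt e j ω = disrupt e j ω' ∧ (eager e j ω ↔ eager e j ω') ∧ content e j ω = content e j ω'
  measurable_disrupt : ∀ (e : E) (j : ℕ) (u : V), MeasurableSet {ω | u ∈ disrupt e j ω}
  measurable_eager : ∀ (e : E) (j : ℕ), MeasurableSet {ω | eager e j ω}

/-- The state of one execution of Local Broadcast. -/
structure LBState (V : Type*) where
  /-- the receivers that have received the message (and have terminated) -/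
  got : Set V
  /-- in the current round, the sender has listened to a slot without request or disruption -/
  clear : Prop
  /-- the sender has terminated -/
  stopped : Prop

section Dynamics

variable {V E M : Type*} (G : SimpleGraph V) (F : Set V) (n D : ℕ) (P : Plan V E M)
  (C : Carol V E M P.window D)

/-- Slot `j` of execution `e` is disrupted at the node `v`. -/
def Jammed (e : E) (j : ℕ) (ω : Draws V E) (v : V) : Prop :=
  ∃ u ∈ F, G.Adj u v ∧ u ∈ C.disrupt e j ω

open Classical in
/-- The sender of `e` transmits its message in slot `j`. -/
def Broadcasts (s : LBState V) (e : E) (j : ℕ) (ω : Draws V E) : Prop :=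
  if P.sender e ∈ F then
    P.sender e ∉ C.disrupt e j ω ∧ (C.eager e j ω ∨ SendRule n j (ω (e, j, P.sender e)))
  else ¬ s.stopped ∧ SendRule n j (ω (e, j, P.sender e))

/-- The correct receiver `v`, still without the message, listens in slot `j`. -/
def TunedIn (s : LBState V) (e : E) (j : ℕ) (ω : Draws V E) (v : V) : Prop :=
  v ∈ P.receivers e ∧ v ∉ F ∧ v ∉ s.got ∧ ListenRule n j (ω (e, j, v))

/-- The correct receiver `v` receives the message in slot `j`. -/
def Hears (s : LBState V) (e : E) (j : ℕ) (ω : Draws V E) (v : V) : Prop :=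
  TunedIn F n P s e j ω v ∧ Broadcasts F n D P C s e j ω ∧ ¬ Jammed G F D P C e j ω v

/-- The correct receiver `v`, still without the message, sends a request in slot `j`. -/
def Requests (s : LBState V) (e : E) (j : ℕ) (v : V) : Prop :=
  v ∈ P.receivers e ∧ v ∉ F ∧ v ∉ s.got ∧ ReqRule n j

/-- The correct sender of `e` listens for requests in slot `j`. -/
def Awaits (s : LBState V) (e : E) (j : ℕ) (ω : Draws V E) : Prop :=
  P.sender e ∉ F ∧ ¬ s.stopped ∧ NackListenRule n j (ω (e, j, P.sender e))

/-- The correct sender of `e` listens in slot `j` and detects neither a request nor noise. -/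
def HearsSilence (s : LBState V) (e : E) (j : ℕ) (ω : Draws V E) : Prop :=
  Awaits F n P s e j ω ∧ ¬ Jammed G F D P C e j ω (P.sender e) ∧ ∀ v, ¬ Requests F n P s e j v

/-- The state of the execution `e` just before its `j`-th slot. A receiver terminates as soon as
it has received the message; the sender terminates at the end of a round in which it has listened
to a clear slot. -/
def lbState (e : E) (ω : Draws V E) : ℕ → LBState V
  | 0 => { got := ∅, clear := False, stopped := False }
  | j + 1 =>
    { got := (lbState e ω j).got ∪ {v | Hears G F n D P C (lbState e ω j) e j ω v}
      clear := ¬ LastSlot n j ∧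
        ((lbState e ω j).clear ∨ HearsSilence G F n D P C (lbState e ω j) e j ω)
      stopped := (lbState e ω j).stopped ∨ (LastSlot n j ∧
        ((lbState e ω j).clear ∨ HearsSilence G F n D P C (lbState e ω j) e j ω)) }

open Classical in
/-- What the node `v` gets in the execution `e`, if `x` is what a correct sender sends. -/
def received (e : E) (ω : Draws V E) (v : V) (x : Option M) : Option M :=
  if h : ∃ j, j < D ∧ Hears G F n D P C (lbState G F n D P C e ω j) e j ω v then
    if P.sender e ∈ F then C.content e (Nat.find h) ω else x
  else none

/-- `knowledge w e v` is what `v` has received in `e`, after the windows `0, …, w - 1`. -/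
def knowledge (ω : Draws V E) : ℕ → E → V → Option M
  | 0 => fun _ _ => none
  | w + 1 => fun e v =>
    if P.window e = w then
      received G F n D P C e ω v (P.payload e (fun e' => knowledge ω w e' (P.sender e)))
    else knowledge ω w e v

/-- The value to which `p` is committed after the windows `0, …, w - 1`. -/
def committed (ω : Draws V E) (w : ℕ) (p : V) : Option M :=
  P.commit p (fun e => knowledge G F n D P C ω w e p)

/-- Reliable broadcast of `m`: each correct node eventually commits to `m`, for good, and never
commits to any other value. -/
def ReliableBroadcast (m : M) (ω : Draws V E) : Prop :=
  ∀ p ∉ F, (∃ w, ∀ w' ≥ w, committed G F n D P C ω w' p = some m) ∧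
    ∀ w v, committed G F n D P C ω w p = some v → v = m

/-- The correct node `p` takes part in `e` and has not terminated it yet. -/
def Engaged (s : LBState V) (e : E) (p : V) : Prop :=
  p ∉ F ∧ ((p = P.sender e ∧ ¬ s.stopped) ∨ (p ∈ P.receivers e ∧ p ∉ s.got))

open Classical in
/-- The number of slots in which Byzantine neighbours of `p` disrupt the communications of `p`. -/
def disruptedSlots (ω : Draws V E) (p : V) : ℝ≥0∞ :=
  ∑' e : E, ∑ j ∈ Finset.range D,
    if Engaged F P (lbState G F n D P C e ω j) e p ∧ Jammed G F D P C e j ω p then 1 else 0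

open Classical in
/-- The cost of a correct node `p`: `S` for each slot in which it sends and `L` for each slot in
which it listens. -/
def cost (S L : ℝ≥0) (ω : Draws V E) (p : V) : ℝ≥0∞ :=
  ∑' e : E, ∑ j ∈ Finset.range D,
    ((if (p = P.sender e ∧ Broadcasts F n D P C (lbState G F n D P C e ω j) e j ω) ∨
        Requests F n P (lbState G F n D P C e ω j) e j p then (S : ℝ≥0∞) else 0) +
     (if (p = P.sender e ∧ Awaits F n P (lbState G F n D P C e ω j) e j ω) ∨
        TunedIn F n P (lbState G F n D P C e ω j) e j ω p then (L : ℝ≥0∞) else 0))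

/-- The expected cost of a correct node `p`. -/
def expectedCost (S L : ℝ≥0) (p : V) : ℝ≥0∞ :=
  ∫⁻ ω, cost G F n D P C S L ω p ∂(drawMeasure V E)

end Dynamics

/-! ### The grid -/

/-- The `L_∞` ball of radius `r` about `c` in the grid. -/
def gridBall (r : ℕ) (c : ℤ × ℤ) : Set (ℤ × ℤ) :=
  {u | |u.1 - c.1| ≤ (r : ℤ) ∧ |u.2 - c.2| ≤ (r : ℤ)}

/-- Two grid nodes hear each other if their `L_∞` distance is at most `r`. -/
def gridGraph (r : ℕ) : SimpleGraph (ℤ × ℤ) :=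
  SimpleGraph.fromRel (fun u v => u ∈ gridBall r v)

/-- The corridors of width `2r+1`, which cover the grid: two vertical ones issuing from the dealer
at the origin, and, for each `k`, two horizontal ones issuing from the node `(0, k(2r+1))`. -/
inductive Corridor
  | up
  | down
  | right (k : ℤ)
  | left (k : ℤ)

/-- The node in row `s` (counted along the corridor) and column `w ∈ [-r, r]` of a corridor. -/
def Corridor.node (r : ℕ) (κ : Corridor) (s : ℕ) (w : ℤ) : ℤ × ℤ :=
  match κ with
  | .up => (w, (s : ℤ))
  | .down => (w, -(s : ℤ))
  | .right k => ((s : ℤ), k * (2 * r + 1) + w)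
  | .left k => (-(s : ℤ), k * (2 * r + 1) + w)

/-- The window in which the protocol in a corridor is started. -/
def Corridor.start (r : ℕ) : Corridor → ℕ
  | .up => 0
  | .down => 0
  | .right k => 2 * (k.natAbs * (2 * r + 1) + r)
  | .left k => 2 * (k.natAbs * (2 * r + 1) + r)

/-- The executions of Local Broadcast in the grid protocol: the dealer sends its message; the node
in row `s ≥ 1` and column `w` of a corridor sends its commit message; and for `s ≥ r+1` it sends a
heard message about its sister node in row `s - r` and column `w + σ r`, where `σ = ±1`. -/
inductive GridExec (r : ℕ)
  | dealer
  | commit (κ : Corridor) (s : ℕ) (w : ℤ) (h : 1 ≤ s ∧ |w| ≤ (r : ℤ))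
  | heard (κ : Corridor) (s : ℕ) (w σ : ℤ)
      (h : r + 1 ≤ s ∧ |w| < (r : ℤ) ∧ ((σ = 1 ∧ w ≤ 0) ∨ (σ = -1 ∧ 0 ≤ w)))

theorem sister_valid {r s : ℕ} {w σ : ℤ}
    (h : r + 1 ≤ s ∧ |w| < (r : ℤ) ∧ ((σ = 1 ∧ w ≤ 0) ∨ (σ = -1 ∧ 0 ≤ w))) :
    1 ≤ s - r ∧ |w + σ * r| ≤ (r : ℤ) := by
  obtain ⟨h1, h2, h3⟩ := h
  rw [abs_lt] at h2
  refine ⟨by omega, abs_le.2 ?_⟩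
  rcases h3 with ⟨rfl, h⟩ | ⟨rfl, h⟩ <;> constructor <;> linarith

/-- The sender of an execution of the grid protocol. -/
def gridSender (r : ℕ) : GridExec r → ℤ × ℤ
  | .dealer => (0, 0)
  | .commit κ s w _ => κ.node r s w
  | .heard κ s w _ _ => κ.node r s w

/-- The nodes that listen to an execution of the grid protocol. A node in row `s' ≥ r+1` and column
`w'` of a corridor listens to the commit messages of its neighbours in the rows `s'-r, …, s'-1` of
the corridor, and to the heard messages of the nodes in the rows `s', …, s'+r-1` and the columns
`w'+1, …, 0` (if `w' < 0`) or `0, …, w'-1` (if `w' > 0`), about their sister nodes in the columns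
beyond `w'+r` or `w'-r`, respectively. -/
def gridReceivers (r : ℕ) : GridExec r → Set (ℤ × ℤ)
  | .dealer => {v | v ≠ (0, 0) ∧ v ∈ gridBall r (0, 0)}
  | .commit κ s w _ => {v | ∃ (s' : ℕ) (w' : ℤ), v = κ.node r s' w' ∧ r + 1 ≤ s' ∧ |w'| ≤ (r : ℤ) ∧
      s < s' ∧ s' ≤ s + r ∧ |w - w'| ≤ (r : ℤ)}
  | .heard κ s w σ _ => {v | ∃ (s' : ℕ) (w' : ℤ), v = κ.node r s' w' ∧ r + 1 ≤ s' ∧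
      |w'| ≤ (r : ℤ) ∧ s' ≤ s ∧ s < s' + r ∧ ((σ = 1 ∧ w' < w) ∨ (σ = -1 ∧ w < w'))}

/-- The window of an execution of the grid protocol. -/
def gridWindow (r : ℕ) : GridExec r → ℕ
  | .dealer => 0
  | .commit κ s _ _ => κ.start r + 2 * s
  | .heard κ s _ _ _ => κ.start r + 2 * (s - r) + 1

/-- The nodes, other than the one who listens, on the path along which a message has come. -/
def gridPath (r : ℕ) : GridExec r → Set (ℤ × ℤ)
  | .dealer => {(0, 0)}
  | .commit κ s w _ => {κ.node r s w}
  | .heard κ s w σ _ => {κ.node r s w, κ.node r (s - r) (w + σ * r)}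

/-- `v` has been received along at least `t + 1` node-disjoint paths that all lie in a single
neighbourhood. -/
def GridCertified (r t : ℕ) {M : Type*} (view : GridExec r → Option M) (v : M) : Prop :=
  ∃ A : Finset (GridExec r), t + 1 ≤ A.card ∧ (∀ e ∈ A, view e = some v) ∧
    (A : Set (GridExec r)).PairwiseDisjoint (gridPath r) ∧
    ∃ c : ℤ × ℤ, ∀ e ∈ A, gridPath r e ⊆ gridBall r c

open Classical in
/-- The commit rule of Bhandari and Vaidya. -/
def gridCommit (r t : ℕ) {M : Type*} (m : M) (p : ℤ × ℤ) (view : GridExec r → Option M) :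
    Option M :=
  if p = (0, 0) then some m
  else if p ∈ gridBall r (0, 0) then view .dealer
  else if h : ∃ v, GridCertified r t view v then some h.choose
  else none

/-- What a correct node sends in an execution of the grid protocol. -/
def gridPayload (r t : ℕ) {M : Type*} (m : M) : GridExec r → (GridExec r → Option M) → Option M
  | .dealer, _ => some m
  | .commit κ s w _, view => gridCommit r t m (κ.node r s w) view
  | .heard κ s w σ h, view => view (.commit κ (s - r) (w + σ * r) (sister_valid h))

/-- The protocol of Bhandari and Vaidya in the grid, with Local Broadcast, where `m` is the message
of the dealer at the origin. -/
def gridPlan (r t : ℕ) {M : Type*} (m : M) : Plan (ℤ × ℤ) (GridExec r) M where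
  sender := gridSender r
  receivers := gridReceivers r
  window := gridWindow r
  payload := gridPayload r t m
  commit := gridCommit r t m

/-- The number of nodes in the broadcast range of a grid node. -/
def gridDegree (r : ℕ) : ℕ := (2 * r + 1) ^ 2 - 1

/-! ### General graphs -/

section Graphs

variable {V : Type*} (G : SimpleGraph V) (d : V) (t : ℕ)

/-- At most `t` neighbours of each correct node are faulty. -/
def LocallyBounded (F : Set V) : Prop := ∀ p ∉ F, (G.neighborSet p ∩ F).encard ≤ t

/-- The set `X(p)` of neighbours of `p` that are closer to the dealer `d` than `p`. -/
def closerNeighbors (p : V) : Set V := {q | G.Adj p q ∧ G.dist d q < G.dist d p}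

open Classical in
/-- The Certified Propagation Algorithm on a channel without jamming: the value to which `p` is
committed after `k` broadcast rounds. Correct nodes announce the value to which they are committed;
`byz i q` is what the faulty node `q` announces in round `i`. -/
def cpa {M : Type*} (F : Set V) (byz : ℕ → V → Option M) (m : M) : ℕ → V → Option M
  | 0 => fun p => if p = d then some m else none
  | k + 1 => fun p =>
    if cpa F byz m k p ≠ none then cpa F byz m k p
    else if G.Adj d p then some m
    else if h : ∃ v : M, (t + 1 : ℕ∞) ≤ {q | G.Adj p q ∧
        ((q ∉ F ∧ cpa F byz m k q = some v) ∨ (q ∈ F ∧ ∃ i ≤ k, byz i q = some v))}.encard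
      then some h.choose
    else none

/-- With at most `t` faults in each neighbourhood and no jamming, CPA achieves reliable broadcast:
each correct node commits to the message of the dealer, whoever the faulty nodes are and whatever
they announce. -/
def CPAAchievesRB (M : Type*) : Prop :=
  ∀ F : Set V, d ∉ F → LocallyBounded G t F → ∀ (byz : ℕ → V → Option M) (m : M),
    ∀ p ∉ F, ∃ k, cpa G d t F byz m k p = some m

open Classical in
/-- The commit rule of FCPA; the execution in which `q` sends is named by `q`. -/
def fcpaCommit {M : Type*} (m : M) (p : V) (view : V → Option M) : Option M :=
  if p = d then some m
  else if G.Adj d p then view d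
  else if h : ∃ v : M, (t + 1 : ℕ∞) ≤ {q | q ∈ closerNeighbors G d p ∧ view q = some v}.encard
    then some h.choose
  else none

/-- The protocol FCPA: `p` listens only to the nodes of `X(p)`, and sends its commit message in
window `s_p`, where `s_p` is the broadcast round of CPA by which `p` has heard all of `X(p)`. As
the nodes of `X(p)` are those neighbours at distance one less from the dealer, `s_p` is the distance
of `p` from the dealer. -/
def fcpaPlan {M : Type*} (m : M) : Plan V V M where
  sender := fun q => q
  receivers := fun q => {p | q ∈ closerNeighbors G d p}
  window := fun q => G.dist d q
  payload := fun q view => fcpaCommit G d t m q view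
  commit := fun p view => fcpaCommit G d t m p view

open Classical in
/-- The commit rule of CPA; `none` names the execution in which the dealer sends, `some (k, q)` the
one in which `q` makes its announcement in broadcast round `k + 1`. -/
def cpaCommit {K : ℕ} {M : Type*} (m : M) (p : V) (view : Option (Fin K × V) → Option M) :
    Option M :=
  if p = d then some m
  else if G.Adj d p then view none
  else if h : ∃ v : M, (t + 1 : ℕ∞) ≤
      {q | G.Adj p q ∧ ∃ k : Fin K, view (some (k, q)) = some v}.encard
    then some h.choose
  else none

/-- CPA itself with Local Broadcast, for `K` broadcast rounds after that of the dealer: in each of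
them each node announces to its neighbours the value to which it is committed, or that there is
none as yet. -/
def cpaPlan (K : ℕ) {M : Type*} (m : M) : Plan V (Option (Fin K × V)) M where
  sender := fun e => e.elim d (fun x => x.2)
  receivers := fun e => {p | G.Adj (e.elim d (fun x => x.2)) p}
  window := fun e => e.elim 0 (fun x => (x.1 : ℕ) + 1)
  payload := fun e view => cpaCommit G d t m (e.elim d (fun x => x.2)) view
  commit := fun p view => cpaCommit G d t m p view

end Graphs

end JamRB

end

open JamRB

noncomputable section

namespace JamRB

/-! ### Timeline of one execution of Local Broadcast -/

/-! Reliability is deterministic; randomness matters only for the cost.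

Reliability. An unserved correct receiver sends a request in every slot in which its sender may
listen for one, so a sender that hears silence has served all its correct receivers
(`mem_got_of_clear_or_stopped`). A correct sender thus outlasts its correct receivers, and such a
receiver misses a slot of a deterministic send phase only if the slot is disrupted there. The window
contains a deterministic send phase of more than `B₀ ≥ β` slots (`exists_round_within_window`), so
Local Broadcast by a correct sender always succeeds (`exists_hears`). What remains is a lossless
authenticated network. Safety: among `t + 1` disjoint testimonies from a region with at most `t`
faults, one is honest. Liveness: more than `2t` testimonies leave `t + 1` honest ones, which gives
FCPA (`fcpa_live`) and, with `r(2r+1)` disjoint paths in one ball, the grid (`grid_live_corridor`).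
For CPA, the run in which faulty nodes are silent is a lower bound for every run, and it is complete
after as many rounds as there are nodes (`cpa_silent_stable`).

Cost. Whether a slot is disrupted is decided before its coins are flipped, so `exp (q * undisrupted
slots)` on the event of survival is a supermartingale, and surviving `u` undisrupted slots has
probability at most `exp (-q u)` (`measure_survive_le`). If at most half of a phase is disrupted, a
receiver stays unserved with probability at most `n⁻³`, and a sender stays unaware that all are
served with probability at most `n⁻²`.

With `ρ = 2 ^ (φ - 1)`, round `i` costs a receiver `O(2^i)`, but blocking it takes about `2^i ρ^i /
2` disruptions. A node receives in many executions that share the budget `β`: rounds before a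
constant `I` cost `O(2^I)` per execution, and blocked later ones cost at most `2β / ρ^I` in all
(`sum_heavyJam_le`). A large `I` makes this a small fraction of `β`. A sender pays `O(ρ^i log n)` in
round `i` and cannot be blocked once `2^i ≥ 2β`, hence pays `O(log n (log n + β)^(φ-1))`
(`sum_senderSlotCost_le`), which is sublinear in `β`; each node sends in boundedly many executions.
The assumption `β ≥ K n log^(φ+1) n` absorbs all lower terms (`exists_cost_constant`). -/

/-- The slot with which the `k`-th round (counted from `0`) starts. -/
def roundStart (n k : ℕ) : ℕ := ∑ i ∈ Finset.range k, roundLen (firstRound n + i)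

theorem roundLen_pos (i : ℕ) : 0 < roundLen i := by
  have : 0 < 2 ^ i := by positivity
  unfold roundLen; omega

theorem roundStart_succ (n k : ℕ) :
    roundStart n (k + 1) = roundStart n k + roundLen (firstRound n + k) :=
  Finset.sum_range_succ _ _

theorem roundStart_strictMono (n : ℕ) : StrictMono (roundStart n) :=
  strictMono_nat_of_lt_succ fun k => by
    rw [roundStart_succ]; exact Nat.lt_add_of_pos_right (roundLen_pos _)

/-- The inner induction walks through one round; the outer one handles the carry, which happens
exactly at the last offset of the preceding round. -/
theorem position_roundStart_add (n k o : ℕ) (ho : o < roundLen (firstRound n + k)) :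
    position n (roundStart n k + o) = (firstRound n + k, o) := by
  induction k generalizing o with
  | zero =>
    induction o with
    | zero => simp [roundStart, position]
    | succ o ih =>
      have h := ih (by omega)
      rw [← Nat.add_assoc, position, h]
      have ho' : o + 1 < roundLen (firstRound n) := ho
      simp [ho']
  | succ k ihk =>
    induction o with
    | zero =>
      have hp := roundLen_pos (firstRound n + k)
      have h := ihk (roundLen (firstRound n + k) - 1) (by omega)
      have e : roundStart n (k + 1) + 0
          = (roundStart n k + (roundLen (firstRound n + k) - 1)) + 1 := by
        rw [roundStart_succ]; omega
      rw [e, position, h]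
      have : ¬ (roundLen (firstRound n + k) - 1 + 1 < roundLen (firstRound n + k)) := by omega
      simp only [this, if_false]
      rfl
    | succ o ih =>
      have h := ih (by omega)
      rw [← Nat.add_assoc, position, h]
      simp only [ho, if_true]

section Phases

variable {n k o i : ℕ} (hi : firstRound n + k = i)
include hi

theorem roundOf_roundStart_add (ho : o < roundLen i) : roundOf n (roundStart n k + o) = i := by
  subst hi
  rw [roundOf, position_roundStart_add n k o ho]

theorem lastSlot_roundStart_add (ho : o < roundLen i) :
    LastSlot n (roundStart n k + o) ↔ o + 1 = roundLen i := by
  rw [LastSlot, roundOf_roundStart_add hi ho]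
  subst hi
  rw [position_roundStart_add n k o ho]

theorem phaseOf_probSend (ho : o < probSendLen i) :
    phaseOf n (roundStart n k + o) = Phase.probSend := by
  have h : o < roundLen i := by
    have := Nat.two_pow_pos i
    unfold roundLen; omega
  rw [phaseOf, roundOf_roundStart_add hi h]
  subst hi
  rw [position_roundStart_add n k o h]
  simp [ho]

theorem phaseOf_detSend (h1 : probSendLen i ≤ o) (h2 : o < probSendLen i + detLen i) :
    phaseOf n (roundStart n k + o) = Phase.detSend := by
  have h : o < roundLen i := by
    have := Nat.two_pow_pos i
    unfold roundLen; omega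
  rw [phaseOf, roundOf_roundStart_add hi h]
  subst hi
  rw [position_roundStart_add n k o h]
  simp [h1.not_gt, h2]

theorem phaseOf_probNack (h1 : probSendLen i + detLen i ≤ o)
    (h2 : o < probSendLen i + detLen i + 2 ^ i) :
    phaseOf n (roundStart n k + o) = Phase.probNack := by
  have h : o < roundLen i := by unfold roundLen; omega
  rw [phaseOf, roundOf_roundStart_add hi h]
  subst hi
  rw [position_roundStart_add n k o h]
  have h3 : ¬ o < probSendLen (firstRound n + k) := by omega
  simp [h3, h1.not_gt, h2]

end Phases

/-! ### Numerical bounds -/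

theorem goldenRatio_gt : (8 / 5 : ℝ) < φ := by
  by_contra! h
  nlinarith [Real.goldenRatio_sq, Real.one_lt_goldenRatio]

theorem goldenRatio_lt : φ < (5 / 3 : ℝ) := by
  by_contra! h
  nlinarith [Real.goldenRatio_sq, Real.one_lt_goldenRatio]

/-- `2 ^ (φ - 1)`, the growth rate of the deterministic phases. -/
def rho : ℝ := (2 : ℝ) ^ (φ - 1)

/-- Fifth powers reduce this to `(3/2)^5 < 2^3`, and cubes reduce `rho_lt` to `2^2 < (8/5)^3`. The
lower bound makes round lengths grow by a factor above 3; the upper one makes `rho / 2 < 4/5`, the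
decay of the sender's expected cost. -/
theorem rho_gt : 3 / 2 < rho := by
  have h : (2 : ℝ) ^ (3 / 5 : ℝ) < rho :=
    Real.rpow_lt_rpow_of_exponent_lt (by norm_num) (by linarith [goldenRatio_gt])
  refine lt_trans ?_ h
  refine lt_of_pow_lt_pow_left₀ 5 (by positivity) ?_
  rw [← Real.rpow_natCast (_ ^ _), ← Real.rpow_mul (by norm_num)]
  norm_num

theorem rho_lt : rho < 8 / 5 := by
  have h : rho < (2 : ℝ) ^ (2 / 3 : ℝ) :=
    Real.rpow_lt_rpow_of_exponent_lt (by norm_num) (by linarith [goldenRatio_lt])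
  refine lt_trans h ?_
  refine lt_of_pow_lt_pow_left₀ 3 (by positivity) ?_
  rw [← Real.rpow_natCast, ← Real.rpow_mul (by norm_num)]
  norm_num

theorem rho_pos : 0 < rho := by linarith [rho_gt]

theorem two_rpow_sub_one_mul (i : ℕ) : (2 : ℝ) ^ ((φ - 1) * i) = rho ^ i := by
  rw [rho, ← Real.rpow_natCast, ← Real.rpow_mul (by norm_num)]

theorem two_rpow_mul (i : ℕ) : (2 : ℝ) ^ (φ * i) = 2 ^ i * rho ^ i := by
  rw [← two_rpow_sub_one_mul, ← Real.rpow_natCast 2 i, ← Real.rpow_add (by norm_num)]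
  ring_nf

theorem two_rpow_sub_one_mul_add_one (i : ℕ) : (2 : ℝ) ^ ((φ - 1) * i + 1) = 2 * rho ^ i := by
  rw [Real.rpow_add (by norm_num), two_rpow_sub_one_mul, Real.rpow_one, mul_comm]

theorem one_le_rho_pow (i : ℕ) : 1 ≤ rho ^ i := one_le_pow₀ (by linarith [rho_gt])

theorem rho_pow_le_two_pow (i : ℕ) : rho ^ i ≤ 2 ^ i :=
  pow_le_pow_left₀ rho_pos.le (by linarith [rho_lt]) i

theorem le_probSendLen (i : ℕ) : (2 : ℝ) ^ i * rho ^ i ≤ probSendLen i := by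
  rw [probSendLen, two_rpow_mul]; exact Nat.le_ceil _

theorem probSendLen_le (i : ℕ) : (probSendLen i : ℝ) ≤ 2 ^ i * rho ^ i + 1 := by
  rw [probSendLen, two_rpow_mul]; exact (Nat.ceil_lt_add_one (by have := rho_pos; positivity)).le

theorem le_detLen (i : ℕ) : 2 * rho ^ i ≤ (detLen i : ℝ) := by
  rw [detLen, two_rpow_sub_one_mul_add_one]; exact Nat.le_ceil _

theorem detLen_le (i : ℕ) : (detLen i : ℝ) ≤ 2 * rho ^ i + 1 := by
  rw [detLen, two_rpow_sub_one_mul_add_one]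
  exact (Nat.ceil_lt_add_one (by have := rho_pos; positivity)).le

theorem detLen_pos (i : ℕ) : 0 < detLen i := by
  have h := le_detLen i
  have h2 := one_le_rho_pow i
  have : (0 : ℝ) < detLen i := by linarith
  exact_mod_cast this

section FirstRound

variable {n : ℕ} (hn : 2 ≤ n)
include hn

theorem log_two_le_log : Real.log 2 ≤ Real.log n :=
  Real.log_le_log (by norm_num) (by exact_mod_cast hn)

theorem log_gt : 0.69 < Real.log n :=
  lt_of_lt_of_le (by linarith [Real.log_two_gt_d9]) (log_two_le_log hn)

theorem four_log_le_two_pow : 4 * Real.log n ≤ 2 ^ firstRound n := by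
  have hl := log_gt hn
  have h : Real.logb 2 (4 * Real.log n) ≤ firstRound n := Nat.le_ceil _
  rw [Real.logb_le_iff_le_rpow (by norm_num) (by linarith), Real.rpow_natCast] at h
  exact h

theorem two_le_firstRound : 2 ≤ firstRound n := by
  by_contra! h
  have h1 := four_log_le_two_pow hn
  have h2 : (2 : ℝ) ^ firstRound n ≤ 2 ^ 1 := pow_le_pow_right₀ (by norm_num) (by omega)
  have := log_gt hn
  linarith

theorem two_pow_firstRound_le : (2 : ℝ) ^ firstRound n ≤ 8 * Real.log n := by
  have hl := log_gt hn
  have h : (firstRound n : ℝ) < Real.logb 2 (4 * Real.log n) + 1 := by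
    refine Nat.ceil_lt_add_one (Real.logb_nonneg (by norm_num) (by linarith))
  have h2 : ((firstRound n : ℝ) - 1) < Real.logb 2 (4 * Real.log n) := by linarith
  rw [Real.lt_logb_iff_rpow_lt (by norm_num) (by linarith), Real.rpow_sub (by norm_num),
    Real.rpow_natCast, Real.rpow_one] at h2
  linarith

end FirstRound

theorem rho_pow_ge_two {i : ℕ} (hi : 2 ≤ i) : 9 / 4 ≤ rho ^ i := by
  have h : rho ^ 2 ≤ rho ^ i := pow_le_pow_right₀ (by linarith [rho_gt]) hi
  nlinarith [rho_gt]

theorem four_le_two_pow {i : ℕ} (hi : 2 ≤ i) : (4 : ℝ) ≤ 2 ^ i := by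
  have h : (2 : ℝ) ^ 2 ≤ 2 ^ i := pow_le_pow_right₀ (by norm_num) hi
  linarith

theorem roundLen_le {i : ℕ} (hi : 2 ≤ i) : (roundLen i : ℝ) ≤ 3 * (2 ^ i * rho ^ i) := by
  have h1 := probSendLen_le i
  have h2 := detLen_le i
  have h3 := four_le_two_pow hi
  have h4 := rho_pow_ge_two hi
  have : (roundLen i : ℝ) = probSendLen i + detLen i + 2 ^ i + detLen i := by
    simp [roundLen]
  rw [this]
  nlinarith

theorem sendPhases_le {i : ℕ} (hi : 2 ≤ i) :
    ((probSendLen i + detLen i : ℕ) : ℝ) ≤ 9 / 5 * (2 ^ i * rho ^ i) := by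
  have h1 := probSendLen_le i
  have h2 := detLen_le i
  have h3 := four_le_two_pow hi
  have h4 := rho_pow_ge_two hi
  push_cast
  nlinarith

/-- Rounds of length at most `3 * 2^i * rho^i` grow by the factor `2 * rho > 3`, so the last one
dominates: `9/2 = 3 / (1 - 1/3)`. -/
theorem roundStart_le {n : ℕ} (hn : 2 ≤ n) (k : ℕ) :
    (roundStart n (k + 1) : ℝ) ≤ 9 / 2 * (2 ^ (firstRound n + k) * rho ^ (firstRound n + k)) := by
  have h2 := two_le_firstRound hn
  induction k with
  | zero =>
    have h := roundLen_le h2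
    have h3 := four_le_two_pow h2
    have h4 := rho_pow_ge_two h2
    simp only [roundStart, zero_add, Finset.sum_range_one, add_zero]
    nlinarith
  | succ k ih =>
    have h := roundLen_le (i := firstRound n + (k + 1)) (by omega)
    rw [roundStart_succ]
    push_cast
    have e : (2 : ℝ) ^ (firstRound n + (k + 1)) * rho ^ (firstRound n + (k + 1))
        = 2 * rho * (2 ^ (firstRound n + k) * rho ^ (firstRound n + k)) := by
      ring
    rw [e] at h ⊢
    have hp : 0 < (2 : ℝ) ^ (firstRound n + k) * rho ^ (firstRound n + k) := by
      have := rho_pos; positivity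
    nlinarith [rho_gt]

/-- This is `(φ - 1)(φ + 1) = φ`: the exponent `φ + 1` of the window turns the scale of a
deterministic phase into that of a whole round. -/
theorem rpow_goldenRatio_sub_one_rpow {x : ℝ} (hx : 0 ≤ x) :
    (x ^ (φ - 1)) ^ (φ + 1) = x ^ φ := by
  rw [← Real.rpow_mul hx]
  congr 1
  nlinarith [Real.goldenRatio_sq]

theorem two_pow_mul_rho_pow (i : ℕ) : (2 : ℝ) ^ i * rho ^ i = ((2 : ℝ) ^ i) ^ φ := by
  rw [← two_rpow_mul, ← Real.rpow_natCast, ← Real.rpow_mul (by norm_num), mul_comm]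

/-- Some round has more than `B₀` slots in its deterministic send phase, which lies within the
window. -/
theorem exists_round_within_window {n : ℕ} (hn : 2 ≤ n) (B₀ : ℕ) :
    ∃ k, B₀ < detLen (firstRound n + k) ∧
      roundStart n k + (probSendLen (firstRound n + k) + detLen (firstRound n + k))
        ≤ windowLen n B₀ := by
  have h2 := two_le_firstRound hn
  have hlog := log_gt hn
  have hφ := goldenRatio_gt
  have hφ' := goldenRatio_lt
  have hex : ∃ k, (B₀ : ℝ) < 2 * rho ^ (firstRound n + k) := by
    obtain ⟨k, hk⟩ := pow_unbounded_of_one_lt (B₀ : ℝ) (show (1 : ℝ) < rho by linarith [rho_gt])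
    refine ⟨k, hk.trans_le ?_⟩
    have : rho ^ k ≤ rho ^ (firstRound n + k) :=
      pow_le_pow_right₀ (by linarith [rho_gt]) (by omega)
    linarith [one_le_rho_pow k]
  classical
  -- The least such round is taken: minimality makes `B₀` at least `2 * rho ^ i` for the preceding
  -- index `i`, and so makes the window long.
  obtain ⟨hk, hmin⟩ := (⟨Nat.find_spec hex, fun m hm => Nat.find_min hex (m := m) hm⟩ :
    (B₀ : ℝ) < 2 * rho ^ (firstRound n + Nat.find hex) ∧
      ∀ m < Nat.find hex, ¬ (B₀ : ℝ) < 2 * rho ^ (firstRound n + m))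
  generalize Nat.find hex = k at hk hmin
  refine ⟨k, ?_, ?_⟩
  · have := le_detLen (firstRound n + k)
    have h : (B₀ : ℝ) < detLen (firstRound n + k) := by linarith
    exact_mod_cast h
  have hB : (0 : ℝ) ≤ B₀ := Nat.cast_nonneg _
  have hu : (0 : ℝ) ≤ (2 : ℝ) ^ (φ - 1) * Real.log n ^ (φ - 1) := by positivity
  suffices h : ((roundStart n k + (probSendLen (firstRound n + k) + detLen (firstRound n + k)) : ℕ)
      : ℝ) ≤ 25 * ((B₀ : ℝ) + (2 : ℝ) ^ (φ - 1) * Real.log n ^ (φ - 1)) ^ (φ + 1) by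
    exact_mod_cast h.trans (Nat.le_ceil _)
  rcases k with _ | k
  -- If the first round suffices, the logarithmic term of the window pays for it: `2^i ≤ 8 log n`,
  -- and the constant is `9/5 * 4^φ ≤ 9/5 * 12 < 25`.
  · have h3 := sendPhases_le h2
    simp only [roundStart, Finset.range_zero, Finset.sum_empty, zero_add, add_zero]
    refine h3.trans ?_
    have h4 : ((2 : ℝ) ^ (φ - 1) * Real.log n ^ (φ - 1)) ^ (φ + 1) ≤
        ((B₀ : ℝ) + (2 : ℝ) ^ (φ - 1) * Real.log n ^ (φ - 1)) ^ (φ + 1) :=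
      Real.rpow_le_rpow hu (by linarith) (by linarith)
    rw [Real.mul_rpow (by positivity) (by positivity), rpow_goldenRatio_sub_one_rpow (by norm_num),
      rpow_goldenRatio_sub_one_rpow (by linarith)] at h4
    have h5 : ((2 : ℝ) ^ firstRound n) ^ φ ≤ (8 * Real.log n) ^ φ :=
      Real.rpow_le_rpow (by positivity) (two_pow_firstRound_le hn) (by linarith)
    rw [Real.mul_rpow (by norm_num) (by linarith)] at h5
    have h6 : (8 : ℝ) ^ φ = (4 : ℝ) ^ φ * (2 : ℝ) ^ φ := by
      rw [← Real.mul_rpow (by norm_num) (by norm_num)]; norm_num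
    have h7 : (4 : ℝ) ^ φ ≤ 12 := by
      refine (Real.rpow_le_rpow_of_exponent_le (by norm_num) (by linarith : φ ≤ 7 / 4)).trans ?_
      refine le_of_pow_le_pow_left₀ (n := 4) (by norm_num) (by norm_num) ?_
      rw [← Real.rpow_natCast, ← Real.rpow_mul (by norm_num)]
      norm_num
    rw [two_pow_mul_rho_pow]
    have h8 : 0 ≤ (2 : ℝ) ^ φ * Real.log n ^ φ := by positivity
    rw [h6] at h5
    nlinarith
  · have h3 := roundStart_le hn (k + 1)
    have h4 : ((roundStart n (k + 1) + (probSendLen (firstRound n + (k + 1)) +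
        detLen (firstRound n + (k + 1))) : ℕ) : ℝ) ≤ roundStart n (k + 1 + 1) := by
      rw [roundStart_succ n (k + 1)]
      unfold roundLen
      push_cast
      have : (0 : ℝ) < 2 ^ (firstRound n + (k + 1)) := by positivity
      have : (0 : ℝ) ≤ detLen (firstRound n + (k + 1)) := Nat.cast_nonneg _
      linarith
    refine h4.trans (h3.trans ?_)
    have h5 := hmin k (by omega)
    rw [not_lt] at h5
    have h6 : (2 * rho ^ (firstRound n + k)) ^ (φ + 1) ≤
        ((B₀ : ℝ) + (2 : ℝ) ^ (φ - 1) * Real.log n ^ (φ - 1)) ^ (φ + 1) :=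
      Real.rpow_le_rpow (by have := rho_pos; positivity) (by linarith) (by linarith)
    -- For `j` the preceding round, `((φ - 1) j + 1)(φ + 1) = φ (j + 1) + 1`, so this power is twice
    -- the nominal length of the next probabilistic send phase. All rounds up to that one then fit,
    -- as `9/2 ≤ 2 * 25`.
    have h7 : (2 * rho ^ (firstRound n + k)) ^ (φ + 1) =
        2 * (2 ^ (firstRound n + (k + 1)) * rho ^ (firstRound n + (k + 1))) := by
      rw [← two_rpow_sub_one_mul_add_one, ← two_rpow_mul, ← Real.rpow_mul (by norm_num)]
      nth_rewrite 2 [← Real.rpow_one 2]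
      rw [← Real.rpow_add (by norm_num)]
      congr 1
      push_cast
      linear_combination ((firstRound n : ℝ) + k) * Real.goldenRatio_sq
    rw [h7] at h6
    have h8 : 0 < (2 : ℝ) ^ (firstRound n + (k + 1)) * rho ^ (firstRound n + (k + 1)) := by
      have := rho_pos; positivity
    linarith

/-! ### Dynamics of one execution -/

section Execution

variable {V E M : Type*} {G : SimpleGraph V} {F : Set V} {n D : ℕ} {P : Plan V E M}
  {C : Carol V E M P.window D} {e : E} {ω : Draws V E}

theorem got_mono {j j' : ℕ} (h : j ≤ j') :
    (lbState G F n D P C e ω j).got ⊆ (lbState G F n D P C e ω j').got := by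
  induction h with
  | refl => exact subset_rfl
  | step _ ih => exact ih.trans Set.subset_union_left

theorem stopped_mono {j j' : ℕ} (h : j ≤ j') (hs : (lbState G F n D P C e ω j).stopped) :
    (lbState G F n D P C e ω j').stopped := by
  induction h with
  | refl => exact hs
  | step _ ih => exact Or.inl ih

theorem mem_got_iff {v : V} {j : ℕ} : v ∈ (lbState G F n D P C e ω j).got ↔
    ∃ j' < j, Hears G F n D P C (lbState G F n D P C e ω j') e j' ω v := by
  induction j with
  | zero => simp [lbState]
  | succ j ih =>
    rw [lbState, Set.mem_union, ih]
    constructor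
    · rintro (⟨j', h, h'⟩ | h)
      · exact ⟨j', by omega, h'⟩
      · exact ⟨j, by omega, h⟩
    · rintro ⟨j', h, h'⟩
      rcases Nat.lt_succ_iff_lt_or_eq.1 h with h | rfl
      · exact Or.inl ⟨j', h, h'⟩
      · exact Or.inr h'

/-- Sender and receivers agree on the phases: a sender that listens for requests does so only when
unserved correct receivers are certain to send them. -/
theorem NackListenRule.reqRule {j : ℕ} {x : unitInterval} (h : NackListenRule n j x) :
    ReqRule n j := by
  unfold NackListenRule at h
  unfold ReqRule
  cases hp : phaseOf n j <;> simp_all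

/-- A sender that has heard silence, or has even terminated, has served all correct receivers. -/
theorem mem_got_of_clear_or_stopped {j : ℕ}
    (h : (lbState G F n D P C e ω j).clear ∨ (lbState G F n D P C e ω j).stopped) {v : V}
    (hv : v ∈ P.receivers e) (hF : v ∉ F) : v ∈ (lbState G F n D P C e ω j).got := by
  induction j with
  | zero => simp [lbState] at h
  | succ j ih =>
    refine Set.mem_union_left _ ?_
    have key : HearsSilence G F n D P C (lbState G F n D P C e ω j) e j ω →
        v ∈ (lbState G F n D P C e ω j).got := by
      rintro ⟨h1, -, h3⟩
      by_contra hg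
      exact h3 v ⟨hv, hF, hg, h1.2.2.reqRule⟩
    rcases h with ⟨-, h | h⟩ | h | ⟨-, h | h⟩
    · exact ih (Or.inl h)
    · exact key h
    · exact ih (Or.inr h)
    · exact ih (Or.inl h)
    · exact key h

theorem not_stopped_of_not_mem_got {j : ℕ} {v : V} (hv : v ∈ P.receivers e) (hF : v ∉ F)
    (h : v ∉ (lbState G F n D P C e ω j).got) : ¬ (lbState G F n D P C e ω j).stopped :=
  fun hs => h (mem_got_of_clear_or_stopped (Or.inr hs) hv hF)

/-- No coin is involved in this phase: the receiver listens, and the sender, which cannot have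
stopped while this receiver is unserved, transmits. Disruption is the only possible cause of
failure. -/
theorem jammed_of_detSend {j : ℕ} {v : V} (hq : P.sender e ∉ F) (hv : v ∈ P.receivers e)
    (hF : v ∉ F) (hp : phaseOf n j = Phase.detSend)
    (h : v ∉ (lbState G F n D P C e ω (j + 1)).got) : Jammed G F D P C e j ω v := by
  by_contra hJ
  have hg : v ∉ (lbState G F n D P C e ω j).got := fun h' => h (got_mono (Nat.le_succ j) h')
  refine h (Or.inr ⟨⟨hv, hF, hg, ?_⟩, ?_, hJ⟩)
  · simp [ListenRule, hp]
  · rw [Broadcasts, if_neg hq]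
    exact ⟨not_stopped_of_not_mem_got hv hF hg, by simp [SendRule, hp]⟩

theorem card_le_disruptedSlots {p : V} {T : Finset ℕ} (hT : ∀ j ∈ T, j < D)
    (h : ∀ j ∈ T, Engaged F P (lbState G F n D P C e ω j) e p ∧ Jammed G F D P C e j ω p) :
    (T.card : ℝ≥0∞) ≤ disruptedSlots G F n D P C ω p := by
  classical
  unfold disruptedSlots
  refine le_trans ?_ (ENNReal.le_tsum e)
  have hs : T ⊆ Finset.range D := fun j hj => Finset.mem_range.2 (hT j hj)
  refine le_trans ?_ (Finset.sum_le_sum_of_subset hs)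
  rw [Finset.card_eq_sum_ones, Nat.cast_sum]
  refine Finset.sum_le_sum fun j hj => ?_
  rw [if_pos (h j hj)]
  simp

/-- Otherwise every slot of some deterministic send phase inside the window would be disrupted at
the receiver, and these are more than `B₀ ≥ β` slots. -/
theorem exists_hears {B₀ β : ℕ} {C : Carol V E M P.window (windowLen n B₀)} {v : V} (hn : 2 ≤ n)
    (hβ : β ≤ B₀) (hb : disruptedSlots G F n (windowLen n B₀) P C ω v ≤ β)
    (hq : P.sender e ∉ F) (hv : v ∈ P.receivers e) (hF : v ∉ F) :
    ∃ j < windowLen n B₀,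
      Hears G F n _ P C (lbState G F n _ P C e ω j) e j ω v := by
  obtain ⟨k, hk, hD⟩ := exists_round_within_window hn B₀
  by_contra! hno
  set T := Finset.Ico (roundStart n k + probSendLen (firstRound n + k))
    (roundStart n k + (probSendLen (firstRound n + k) + detLen (firstRound n + k))) with hT
  have hg : ∀ j ≤ windowLen n B₀, v ∉ (lbState G F n _ P C e ω j).got := by
    intro j hj h
    obtain ⟨j', h1, h2⟩ := mem_got_iff.1 h
    exact hno j' (by omega) h2
  have hc := card_le_disruptedSlots (G := G) (F := F) (n := n) (C := C) (e := e) (ω := ω) (p := v)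
    (T := T) (fun j hj => by rw [hT, Finset.mem_Ico] at hj; omega) (fun j hj => by
      rw [hT, Finset.mem_Ico] at hj
      refine ⟨⟨hF, Or.inr ⟨hv, hg j (by omega)⟩⟩, ?_⟩
      refine jammed_of_detSend hq hv hF ?_ (hg (j + 1) (by omega))
      obtain ⟨o, rfl⟩ := Nat.exists_eq_add_of_le (show roundStart n k ≤ j by omega)
      exact phaseOf_detSend rfl (by omega) (by omega))
  have h2 : (T.card : ℝ≥0∞) ≤ β := hc.trans hb
  have h3 : T.card ≤ β := by exact_mod_cast h2
  rw [hT, Nat.card_Ico] at h3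
  omega

end Execution

/-! ### What the nodes know -/

section Knowledge

variable {V E M : Type*} {G : SimpleGraph V} {F : Set V} {n D : ℕ} {P : Plan V E M}
  {C : Carol V E M P.window D} {e : E} {ω : Draws V E}

theorem knowledge_of_le {w : ℕ} (h : w ≤ P.window e) (v : V) :
    knowledge G F n D P C ω w e v = none := by
  induction w with
  | zero => rfl
  | succ w ih =>
    rw [knowledge]
    dsimp only
    rw [if_neg (by omega)]
    exact ih (by omega)

/-- An execution is confined to one window, so what was received in it never changes afterwards. -/
theorem knowledge_of_lt {w : ℕ} (h : P.window e < w) (v : V) :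
    knowledge G F n D P C ω w e v = received G F n D P C e ω v
      (P.payload e (fun e' => knowledge G F n D P C ω (P.window e) e' (P.sender e))) := by
  induction w with
  | zero => omega
  | succ w ih =>
    rw [knowledge]
    dsimp only
    split_ifs with h'
    · rw [h']
    · exact ih (by omega)

/-- What a node has got from a correct sender is what the sender wanted to send. -/
theorem payload_of_knowledge (hq : P.sender e ∉ F) {w : ℕ} {v : V} {x : M}
    (h : knowledge G F n D P C ω w e v = some x) : P.window e < w ∧
      P.payload e (fun e' => knowledge G F n D P C ω (P.window e) e' (P.sender e)) = some x := by
  rcases le_or_gt w (P.window e) with h1 | h1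
  · rw [knowledge_of_le h1] at h; cases h
  · refine ⟨h1, ?_⟩
    rw [knowledge_of_lt h1, received] at h
    split_ifs at h with h2
    exact h

end Knowledge

/-- The jamming budget of the adversary: at each correct node at most `β` slots are disrupted. -/
def JamBounded {V E M : Type*} (G : SimpleGraph V) (F : Set V) (n D : ℕ) (P : Plan V E M)
    (C : Carol V E M P.window D) (β : ℕ) : Prop :=
  ∀ ω, ∀ p ∉ F, disruptedSlots G F n D P C ω p ≤ β

/-- Local Broadcast by a correct sender reaches each correct receiver, with certainty. -/
theorem JamBounded.knowledge_eq_payload {V E M : Type*} {G : SimpleGraph V} {F : Set V}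
    {n B₀ β : ℕ} {P : Plan V E M} {C : Carol V E M P.window (windowLen n B₀)}
    (hb : JamBounded G F n _ P C β) (hn : 2 ≤ n) (hβ : β ≤ B₀) {e : E} (ω : Draws V E)
    (hq : P.sender e ∉ F) {v : V} (hv : v ∈ P.receivers e) (hF : v ∉ F) {w : ℕ}
    (hw : P.window e < w) : knowledge G F n _ P C ω w e v =
      P.payload e (fun e' => knowledge G F n _ P C ω (P.window e) e' (P.sender e)) := by
  rw [knowledge_of_lt hw, received, dif_pos (exists_hears hn hβ (hb ω v hF) hq hv hF), if_neg hq]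

/-! ### Reliability on general graphs -/

section Graphs

variable {V M : Type*} {G : SimpleGraph V} {d : V} {t : ℕ} {F : Set V} {n B₀ β : ℕ} {m : M}

/-- The safety half of certified propagation: `t + 1` neighbours cannot all lie. -/
theorem LocallyBounded.exists_not_mem (hF : LocallyBounded G t F) {p : V} (hp : p ∉ F) {A : Set V}
    (hA : A ⊆ G.neighborSet p) (ht : (t + 1 : ℕ∞) ≤ A.encard) : ∃ q ∈ A, q ∉ F := by
  by_contra! h
  have h1 := (Set.encard_le_encard (Set.subset_inter hA h)).trans (hF p hp)
  have h2 := ht.trans h1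
  have h3 : t + 1 ≤ t := by exact_mod_cast h2
  omega

/-- The liveness half: more than `2t` neighbours, minus at most `t` faulty ones, leave a
certificate. The case of infinitely many is covered. -/
theorem LocallyBounded.le_encard_diff (hF : LocallyBounded G t F) {p : V} (hp : p ∉ F) {A : Set V}
    (hA : A ⊆ G.neighborSet p) (ht : (2 * t : ℕ∞) < A.encard) : (t + 1 : ℕ∞) ≤ (A \ F).encard := by
  have h1 : (A ∩ F).encard ≤ t :=
    (Set.encard_le_encard (Set.inter_subset_inter_left F hA)).trans (hF p hp)
  rw [← Set.encard_sdiff_add_encard_inter A F] at ht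
  have h3 := ht.trans_le (add_le_add_right h1 (A \ F).encard)
  generalize (A \ F).encard = x at h3 ⊢
  induction x using ENat.recTopCoe with
  | top => exact le_top
  | coe x =>
    have : 2 * t < x + t := by exact_mod_cast h3
    have : t + 1 ≤ x := by omega
    exact_mod_cast this

/-! ### FCPA: safety by induction on time, liveness by induction on the distance from the dealer. -/

section FCPA

variable {C : Carol V V M (fcpaPlan G d t m).window (windowLen n B₀)} {ω : Draws V V}

/-- One of the `t + 1` vouching neighbours is correct, and by authentication its message is its own
commitment at the start of an earlier window. -/
theorem fcpa_safe (hd : d ∉ F) (hF : LocallyBounded G t F) (w : ℕ) {p : V} (hp : p ∉ F) {v : M}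
    (h : committed G F n _ (fcpaPlan G d t m) C ω w p = some v) : v = m := by
  induction w using Nat.strong_induction_on generalizing p v with
  | _ w ih =>
  have h' : fcpaCommit G d t m p
      (fun e => knowledge G F n _ (fcpaPlan G d t m) C ω w e p) = some v := h
  unfold fcpaCommit at h'
  split_ifs at h' with h1 h2 h3
  · exact (Option.some.inj h').symm
  · have h4 := (payload_of_knowledge (P := fcpaPlan G d t m) (e := d) hd h').2
    simp only [fcpaPlan, fcpaCommit, if_true] at h4
    exact (Option.some.inj h4).symm
  · have h4 := Option.some.inj h'
    subst h4
    obtain ⟨q, ⟨hq1, hq2⟩, hq3⟩ := hF.exists_not_mem hp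
      (fun q hq => hq.1.1) h3.choose_spec
    have h5 := payload_of_knowledge (P := fcpaPlan G d t m) (e := q) hq3 hq2
    exact ih _ h5.1 hq3 h5.2

theorem fcpa_live (hn : 2 ≤ n)
    (hX : ∀ p, p ≠ d → ¬ G.Adj d p → (2 * t : ℕ∞) < (closerNeighbors G d p).encard)
    (hd : d ∉ F) (hF : LocallyBounded G t F) (hβ : β ≤ B₀)
    (hb : JamBounded G F n _ (fcpaPlan G d t m) C β) {p : V} (hp : p ∉ F) {w : ℕ}
    (hw : G.dist d p ≤ w) : committed G F n _ (fcpaPlan G d t m) C ω w p = some m := by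
  induction hs : G.dist d p using Nat.strong_induction_on generalizing p w with
  | _ s ih =>
  subst hs
  change fcpaCommit G d t m p
      (fun e => knowledge G F n _ (fcpaPlan G d t m) C ω w e p) = some m
  unfold fcpaCommit
  split_ifs with h1 h2 h3
  · rfl
  · have h4 : G.dist d p = 1 := SimpleGraph.dist_eq_one_iff_adj.2 h2
    refine (hb.knowledge_eq_payload (e := d) hn hβ ω hd ⟨h2.symm, by simp [h4]⟩ hp
      (by change G.dist d d < w; simp; omega)).trans ?_
    simp [fcpaPlan, fcpaCommit]
  -- The commit rule picks some certified value, not necessarily `m` by construction; safety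
  -- identifies it.
  · have h5 : committed G F n _ (fcpaPlan G d t m) C ω w p = some h3.choose := by
      change fcpaCommit G d t m p
        (fun e => knowledge G F n _ (fcpaPlan G d t m) C ω w e p) = _
      unfold fcpaCommit
      rw [if_neg h1, if_neg h2, dif_pos h3]
    rw [fcpa_safe hd hF w hp h5]
  -- The value `m` is certified: the correct nodes of `X(p)` number at least `t + 1`, are closer to
  -- the dealer, and are committed when their own windows begin.
  · refine absurd ⟨m, (hF.le_encard_diff hp (fun q hq => hq.1) (hX p h1 h2)).trans
      (Set.encard_le_encard fun q hq => ⟨hq.1, ?_⟩)⟩ h3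
    exact (hb.knowledge_eq_payload (e := q) hn hβ ω hq.2 hq.1 hp (hq.1.2.trans_le hw)).trans
      (ih _ hq.1.2 hq.2 le_rfl rfl)

theorem fcpa_reliable (hn : 2 ≤ n)
    (hX : ∀ p, p ≠ d → ¬ G.Adj d p → (2 * t : ℕ∞) < (closerNeighbors G d p).encard)
    (hd : d ∉ F) (hF : LocallyBounded G t F) (hβ : β ≤ B₀)
    (hb : JamBounded G F n _ (fcpaPlan G d t m) C β) :
    ReliableBroadcast G F n _ (fcpaPlan G d t m) C m ω :=
  fun _ hp => ⟨⟨_, fun _ hw => fcpa_live hn hX hd hF hβ hb hp hw⟩,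
    fun w _ h => fcpa_safe hd hF w hp h⟩

end FCPA

/-! ### CPA: comparison with the jamming-free run in which the faulty nodes are silent. -/

section CPA

open Classical in
theorem cpa_succ (byz : ℕ → V → Option M) (k : ℕ) (p : V) : cpa G d t F byz m (k + 1) p =
    if cpa G d t F byz m k p ≠ none then cpa G d t F byz m k p
    else if G.Adj d p then some m
    else if h : ∃ v : M, (t + 1 : ℕ∞) ≤ {q | G.Adj p q ∧
        ((q ∉ F ∧ cpa G d t F byz m k q = some v) ∨ (q ∈ F ∧ ∃ i ≤ k, byz i q = some v))}.encard
      then some h.choose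
    else none := rfl

/-- Silence empties the contribution of `F`, so every certificate consists of correct nodes alone.
-/
theorem cpa_silent_succ_cases {k : ℕ} {p : V} {v : M}
    (h : cpa G d t F (fun _ _ => none) m (k + 1) p = some v) :
    cpa G d t F (fun _ _ => none) m k p = some v ∨ (G.Adj d p ∧ v = m) ∨ (¬ G.Adj d p ∧
      (t + 1 : ℕ∞) ≤ {q | G.Adj p q ∧ q ∉ F ∧
        cpa G d t F (fun _ _ => none) m k q = some v}.encard) := by
  rw [cpa_succ] at h
  by_cases h1 : cpa G d t F (fun _ _ => none) m k p ≠ none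
  · rw [if_pos h1] at h
    exact Or.inl h
  rw [if_neg h1] at h
  by_cases h2 : G.Adj d p
  · rw [if_pos h2] at h
    exact Or.inr (Or.inl ⟨h2, (Option.some.inj h).symm⟩)
  rw [if_neg h2] at h
  by_cases h3 : ∃ v : M, (t + 1 : ℕ∞) ≤ {q | G.Adj p q ∧
      ((q ∉ F ∧ cpa G d t F (fun _ _ => none) m k q = some v) ∨
        (q ∈ F ∧ ∃ i ≤ k, (none : Option M) = some v))}.encard
  · rw [dif_pos h3] at h
    refine Or.inr (Or.inr ⟨h2, ?_⟩)
    rw [← Option.some.inj h]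
    refine h3.choose_spec.trans (Set.encard_le_encard ?_)
    rintro q ⟨hq1, h4 | ⟨-, i, -, hi⟩⟩
    · exact ⟨hq1, h4⟩
    · cases hi
  · rw [dif_neg h3] at h
    cases h

/-- The certified propagation among the correct nodes, when the faulty ones are silent. -/
theorem cpa_silent_safe (k : ℕ) {p : V} {v : M}
    (h : cpa G d t F (fun _ _ => none) m k p = some v) : v = m := by
  induction k generalizing p v with
  | zero =>
    simp only [cpa] at h
    split_ifs at h
    exact (Option.some.inj h).symm
  | succ k ih =>
    rcases cpa_silent_succ_cases h with h | ⟨-, h⟩ | ⟨-, h⟩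
    · exact ih h
    · exact h
    · obtain ⟨q, hq⟩ : Set.Nonempty {q | G.Adj p q ∧ q ∉ F ∧
          cpa G d t F (fun _ _ => none) m k q = some v} := by
        rw [← Set.encard_ne_zero]
        intro h0
        have h6 := h.trans h0.le
        have : t + 1 ≤ 0 := by exact_mod_cast h6
        omega
      exact ih hq.2.2

theorem cpa_mono {byz : ℕ → V → Option M} {k : ℕ} {p : V} {v : M}
    (h : cpa G d t F byz m k p = some v) {k' : ℕ} (hk : k ≤ k') :
    cpa G d t F byz m k' p = some v := by
  induction hk with
  | refl => exact h
  | step _ ih => rw [cpa_succ, if_pos (by rw [ih]; simp), ih]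

/-- The round number enters the update only through announcements of faulty nodes. Without these the
update is autonomous, so a state that repeats once persists for ever. -/
theorem cpa_silent_succ_congr {k k' : ℕ}
    (h : ∀ q, cpa G d t F (fun _ _ => none) m k q = cpa G d t F (fun _ _ => none) m k' q) (p : V) :
    cpa G d t F (fun _ _ => none) m (k + 1) p = cpa G d t F (fun _ _ => none) m (k' + 1) p := by
  have hP : (fun v : M => (t + 1 : ℕ∞) ≤ {q | G.Adj p q ∧
      ((q ∉ F ∧ cpa G d t F (fun _ _ => none) m k q = some v) ∨
        (q ∈ F ∧ ∃ i ≤ k, (none : Option M) = some v))}.encard) =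
      fun v : M => (t + 1 : ℕ∞) ≤ {q | G.Adj p q ∧
      ((q ∉ F ∧ cpa G d t F (fun _ _ => none) m k' q = some v) ∨
        (q ∈ F ∧ ∃ i ≤ k', (none : Option M) = some v))}.encard := by
    funext v
    simp [h]
  rw [cpa_succ, cpa_succ, h p]
  split_ifs with h1 h2 h3 h4 h4
  · rfl
  · rfl
  · congr 2
    funext v
    simp [h]
  · exact absurd (hP ▸ h3) h4
  · exact absurd (hP ▸ h4) h3
  · rfl

/-- Without announcements by the faulty nodes, certified propagation is complete after as many
rounds as there are nodes. -/
theorem cpa_silent_stable [Finite V] {p : V} {k : ℕ}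
    (h : cpa G d t F (fun _ _ => none) m k p = some m) :
    cpa G d t F (fun _ _ => none) m (Nat.card V) p = some m := by
  set f := cpa G d t F (fun _ _ => none) m with hf
  set A : ℕ → Set V := fun k => {q | f k q = some m} with hA
  have hmono : ∀ k, A k ⊆ A (k + 1) := fun k q hq => cpa_mono hq (Nat.le_succ k)
  have hval : ∀ k q, f k q = none ∨ f k q = some m := by
    intro k q
    rcases hq : f k q with _ | v
    · exact Or.inl rfl
    · exact Or.inr (by rw [cpa_silent_safe k hq])
  have hext : ∀ k, A k = A (k + 1) → ∀ q, f k q = f (k + 1) q := by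
    intro k he q
    rcases hval k q with h1 | h1
    · rcases hval (k + 1) q with h2 | h2
      · rw [h1, h2]
      · have : q ∈ A k := by rw [he]; exact h2
        exact this.trans h2.symm
    · exact h1.trans (cpa_mono h1 (Nat.le_succ k)).symm
  have hstab : ∀ k, A k = A (k + 1) → ∀ k' ≥ k, ∀ q, f k' q = f k q := by
    intro k he k' hk'
    induction hk' with
    | refl => exact fun _ => rfl
    | @step l _ ih =>
      intro q
      rw [hf, cpa_silent_succ_congr (k' := k) (fun q => ih q) q, ← hf]
      exact (hext k he q).symm
  -- While the set of committed nodes grows strictly, it gains a node per round; so it must pause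
  -- within `Nat.card V` rounds, and after a pause it is constant.
  have hcard : ∀ k, (∀ j < k, A j ≠ A (j + 1)) → k ≤ (A k).ncard := by
    intro k
    induction k with
    | zero => simp
    | succ k ih =>
      intro hj
      have h1 := ih fun j h => hj j (by omega)
      have h2 := Set.ncard_lt_ncard ((hmono k).ssubset_of_ne (hj k (by omega))) (Set.toFinite _)
      omega
  obtain ⟨j, hj, he⟩ : ∃ j ≤ Nat.card V, A j = A (j + 1) := by
    by_contra! hne
    have h1 := hcard (Nat.card V + 1) fun j h => hne j (by omega)
    have h2 := Set.ncard_le_card (A (Nat.card V + 1))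
    omega
  rcases le_total k (Nat.card V) with hk | hk
  · exact cpa_mono h hk
  · rw [hstab j he _ hj, ← hstab j he k (hj.trans hk)]
    exact h

variable {K : ℕ} {C : Carol V (Option (Fin K × V)) M (cpaPlan G d t K m).window (windowLen n B₀)}
  {ω : Draws V (Option (Fin K × V))}

theorem cpa_safe (hd : d ∉ F) (hF : LocallyBounded G t F) (w : ℕ) {p : V} (hp : p ∉ F) {v : M}
    (h : committed G F n _ (cpaPlan G d t K m) C ω w p = some v) : v = m := by
  induction w using Nat.strong_induction_on generalizing p v with
  | _ w ih =>
  have h' : cpaCommit G d t m p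
      (fun e => knowledge G F n _ (cpaPlan G d t K m) C ω w e p) = some v := h
  unfold cpaCommit at h'
  split_ifs at h' with h1 h2 h3
  · exact (Option.some.inj h').symm
  · have h4 := (payload_of_knowledge (P := cpaPlan G d t K m) (e := none) hd h').2
    simp only [cpaPlan, cpaCommit, Option.elim, if_true] at h4
    exact (Option.some.inj h4).symm
  · have h4 := Option.some.inj h'
    subst h4
    obtain ⟨q, ⟨hq1, k, hq2⟩, hq3⟩ := hF.exists_not_mem hp (fun q hq => hq.1) h3.choose_spec
    have h5 := payload_of_knowledge (P := cpaPlan G d t K m) (e := some (k, q)) hq3 hq2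
    exact ih _ h5.1 hq3 h5.2

/-- The silent run is a lower bound: whoever supports `p` there has announced `m` in time here too.
Announcements by faulty nodes may create further certificates, but `cpa_safe` rules out any wrong
value. -/
theorem cpa_live (hn : 2 ≤ n) (hd : d ∉ F) (hF : LocallyBounded G t F) (hβ : β ≤ B₀)
    (hb : JamBounded G F n _ (cpaPlan G d t K m) C β) {k : ℕ} (hk : k ≤ K + 1) {p : V}
    (hp : p ∉ F) (h : cpa G d t F (fun _ _ => none) m k p = some m) {w : ℕ} (hw : k ≤ w) :
    committed G F n _ (cpaPlan G d t K m) C ω w p = some m := by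
  induction k generalizing p w with
  | zero =>
    simp only [cpa] at h
    split_ifs at h with h1
    simp [committed, cpaPlan, cpaCommit, h1]
  | succ k ih =>
  rcases cpa_silent_succ_cases h with h | ⟨h2, -⟩ | ⟨h2, hspec⟩
  · exact ih (by omega) hp h (by omega)
  · change cpaCommit G d t m p
      (fun e => knowledge G F n _ (cpaPlan G d t K m) C ω w e p) = some m
    unfold cpaCommit
    rw [if_neg h2.ne', if_pos h2]
    refine (hb.knowledge_eq_payload (e := none) hn hβ ω hd h2 hp
      (by change 0 < w; omega)).trans ?_
    simp [cpaPlan, cpaCommit]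
  · by_cases hpd : p = d
    · simp [committed, cpaPlan, cpaCommit, hpd]
    have key : (t + 1 : ℕ∞) ≤ {q | G.Adj p q ∧ ∃ k : Fin K,
        knowledge G F n _ (cpaPlan G d t K m) C ω w (some (k, q)) p = some m}.encard := by
      refine hspec.trans (Set.encard_le_encard ?_)
      rintro q ⟨hq1, hq2, hq3⟩
      refine ⟨hq1, ?_⟩
      -- At stage 0 only the dealer is committed, and it is not a neighbour of `p`. A supporter
      -- committed by stage `k + 1` announces in the execution with index `k`, whose window is `k +
      -- 1` because window 0 belongs to the dealer.
      rcases k with _ | k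
      · simp only [cpa] at hq3
        split_ifs at hq3 with h4
        exact absurd (h4 ▸ hq1.symm) h2
      · refine ⟨⟨k, by omega⟩, ?_⟩
        rw [hb.knowledge_eq_payload (e := some (⟨k, by omega⟩, q)) hn hβ ω hq2 hq1.symm hp
          (by change k + 1 < w; omega)]
        exact ih (by omega) hq2 hq3 le_rfl
    have hex : ∃ v : M, (t + 1 : ℕ∞) ≤ {q | G.Adj p q ∧ ∃ k : Fin K,
        knowledge G F n _ (cpaPlan G d t K m) C ω w (some (k, q)) p = some v}.encard := ⟨m, key⟩
    have h5 : committed G F n _ (cpaPlan G d t K m) C ω w p = some hex.choose := by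
      change cpaCommit G d t m p
        (fun e => knowledge G F n _ (cpaPlan G d t K m) C ω w e p) = _
      unfold cpaCommit
      rw [if_neg hpd, if_neg h2, dif_pos hex]
    rw [h5, cpa_safe hd hF w hp h5]

theorem cpa_reliable [Finite V] (hK : Nat.card V = K) (hn : 2 ≤ n) (hG : CPAAchievesRB G d t M)
    (hd : d ∉ F) (hF : LocallyBounded G t F) (hβ : β ≤ B₀)
    (hb : JamBounded G F n _ (cpaPlan G d t K m) C β) :
    ReliableBroadcast G F n _ (cpaPlan G d t K m) C m ω := by
  refine fun p hp => ⟨⟨K, fun w hw => ?_⟩, fun w _ h => cpa_safe hd hF w hp h⟩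
  obtain ⟨k, hk⟩ := hG F hd hF (fun _ _ => none) m p hp
  have h := cpa_silent_stable hk
  rw [hK] at h
  exact cpa_live hn hd hF hβ hb (Nat.le_succ K) hp h hw

end CPA

end Graphs

/-! ### Reliability on the grid -/

section Grid

theorem Corridor.node_inj {r : ℕ} {κ : Corridor} {s s' : ℕ} {w w' : ℤ}
    (h : κ.node r s w = κ.node r s' w') : s = s' ∧ w = w' := by
  cases κ <;> simp only [Corridor.node, Prod.mk.injEq] at h <;> omega

theorem Corridor.node_mem_gridBall {r : ℕ} {κ : Corridor} {s s' : ℕ} {w : ℤ} (h1 : s ≤ s' + r)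
    (h2 : s' ≤ s + r) (hw : |w| ≤ (r : ℤ)) : κ.node r s' w ∈ gridBall r (κ.node r s 0) := by
  rw [abs_le] at hw
  cases κ <;> simp only [Corridor.node, gridBall, Set.mem_ofPred_eq, abs_le] <;> omega

/-- Choosing a faulty node on each path that has one is injective, since the paths are disjoint.
This serves both safety (one of `t + 1` paths is clean) and liveness (of more than `2t` paths, at
least `t + 1` are clean). -/
theorem card_filter_not_disjoint_le {ι U : Type*} {I : Finset ι} {f : ι → Set U} {F B : Set U}
    {t : ℕ} (hd : (I : Set ι).PairwiseDisjoint f) (hB : ∀ i ∈ I, f i ⊆ B)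
    (hF : (F ∩ B).encard ≤ t) [DecidablePred fun i => ¬ Disjoint (f i) F] :
    (I.filter fun i => ¬ Disjoint (f i) F).card ≤ t := by
  have hx : ∀ i ∈ I.filter (fun i => ¬ Disjoint (f i) F), ∃ x, x ∈ f i ∧ x ∈ F := fun i hi =>
    Set.not_disjoint_iff.1 (Finset.mem_filter.1 hi).2
  rcases (I.filter fun i => ¬ Disjoint (f i) F).eq_empty_or_nonempty with h0 | ⟨i₀, hi₀⟩
  · simp [h0]
  obtain ⟨x₀, -⟩ := hx i₀ hi₀
  have : Nonempty U := ⟨x₀⟩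
  choose! x hx1 hx2 using hx
  have hinj : Set.InjOn x (↑(I.filter fun i => ¬ Disjoint (f i) F) : Set ι) := by
    intro i hi j hj hij
    by_contra hne
    have := hd (Finset.mem_filter.1 hi).1 (Finset.mem_filter.1 hj).1 hne
    exact Set.disjoint_left.1 this (hx1 i hi) (hij ▸ hx1 j hj)
  have hsub : x '' (↑(I.filter fun i => ¬ Disjoint (f i) F) : Set ι) ⊆ F ∩ B := by
    rintro _ ⟨i, hi, rfl⟩
    exact ⟨hx2 i hi, hB i (Finset.mem_filter.1 hi).1 (hx1 i hi)⟩
  have h := (Set.encard_le_encard hsub).trans hF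
  rw [hinj.encard_image, Set.encard_coe_eq_coe_finsetCard] at h
  exact_mod_cast h

variable {r t n B₀ β : ℕ} {M : Type*} {m : M} {F : Set (ℤ × ℤ)} {G : SimpleGraph (ℤ × ℤ)}
  {C : Carol (ℤ × ℤ) (GridExec r) M (gridPlan r t m).window (windowLen n B₀)}
  {ω : Draws (ℤ × ℤ) (GridExec r)}

theorem grid_safe (hd : (0, 0) ∉ F) (hF : ∀ c, (F ∩ gridBall r c).encard ≤ t) (w : ℕ)
    {p : ℤ × ℤ} {v : M}
    (h : committed G F n _ (gridPlan r t m) C ω w p = some v) : v = m := by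
  classical
  induction w using Nat.strong_induction_on generalizing p v with
  | _ w ih =>
  have h' : gridCommit r t m p
      (fun e => knowledge G F n _ (gridPlan r t m) C ω w e p) = some v := h
  have dealer : ∀ {u : M}, knowledge G F n _ (gridPlan r t m) C ω w GridExec.dealer p = some u →
      u = m := by
    intro u hu
    have h4 := (payload_of_knowledge (P := gridPlan r t m) (e := GridExec.dealer) hd hu).2
    exact (Option.some.inj h4).symm
  unfold gridCommit at h'
  split_ifs at h' with h1 h2 h3
  · exact (Option.some.inj h').symm
  · exact dealer h'
  · have h4 := Option.some.inj h'
    subst h4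
    obtain ⟨A, hA, hv, hdis, c, hc⟩ := h3.choose_spec
    have hbad := card_filter_not_disjoint_le hdis hc (hF c)
    obtain ⟨e, he, hgood⟩ : ∃ e ∈ A, Disjoint (gridPath r e) F := by
      by_contra! hno
      rw [Finset.filter_true_of_mem hno] at hbad
      omega
    have hk := hv e he
    cases e with
    | dealer => exact dealer hk
    | commit κ s w' hs =>
      have hq : κ.node r s w' ∉ F := Set.disjoint_left.1 hgood rfl
      have h5 := payload_of_knowledge (P := gridPlan r t m) (e := .commit κ s w' hs) hq hk
      exact ih _ h5.1 h5.2
    -- A clean relayed path is unwound twice: the correct relay repeats what it received, and the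
    -- correct origin sent its own commitment, two windows of induction earlier.
    | heard κ s w' σ hs =>
      have hq : κ.node r s w' ∉ F := Set.disjoint_left.1 hgood (Or.inl rfl)
      have hq' : κ.node r (s - r) (w' + σ * r) ∉ F := Set.disjoint_left.1 hgood (Or.inr rfl)
      have h5 := payload_of_knowledge (P := gridPlan r t m) (e := .heard κ s w' σ hs) hq hk
      have h6 := payload_of_knowledge (P := gridPlan r t m)
        (e := .commit κ (s - r) (w' + σ * r) (sister_valid hs)) hq' h5.2
      exact ih _ (h6.1.trans h5.1) h6.2

variable (hn : 2 ≤ n) (hd : (0, 0) ∉ F) (hF : ∀ c, (F ∩ gridBall r c).encard ≤ t) (hβ : β ≤ B₀)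
  (hb : JamBounded G F n _ (gridPlan r t m) C β)
include hn hd hF hβ hb

omit hF in
theorem grid_live_ball {p : ℤ × ℤ} (hp : p ∉ F) (hpb : p ∈ gridBall r (0, 0)) {W : ℕ}
    (hW : 1 ≤ W) : committed G F n _ (gridPlan r t m) C ω W p = some m := by
  change gridCommit r t m p
      (fun e => knowledge G F n _ (gridPlan r t m) C ω W e p) = some m
  unfold gridCommit
  split_ifs with h1
  · rfl
  · exact hb.knowledge_eq_payload (e := GridExec.dealer) hn hβ ω hd ⟨h1, hpb⟩ hp hW

omit hn hβ hb in
theorem grid_committed_of_certified {p : ℤ × ℤ} {W : ℕ} (hpb : p ∉ gridBall r (0, 0))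
    (h : GridCertified r t (fun e => knowledge G F n _ (gridPlan r t m) C ω W e p) m) :
    committed G F n _ (gridPlan r t m) C ω W p = some m := by
  have hex : ∃ v, GridCertified r t
    (fun e => knowledge G F n _ (gridPlan r t m) C ω W e p) v := ⟨m, h⟩
  have h0 : p ≠ (0, 0) := by
    rintro rfl
    exact hpb (by simp [gridBall])
  have h5 : committed G F n _ (gridPlan r t m) C ω W p = some hex.choose := by
    change gridCommit r t m p
      (fun e => knowledge G F n _ (gridPlan r t m) C ω W e p) = _
    unfold gridCommit
    rw [if_neg h0, if_neg hpb, dif_pos hex]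
  rw [h5, grid_safe hd hF W h5]

/-- The message proceeds along a corridor, row by row. -/
theorem grid_live_corridor (ht : 2 * t < r * (2 * r + 1)) (κ : Corridor)
    (hbase : ∀ s w, 1 ≤ s → s ≤ r → |w| ≤ (r : ℤ) → κ.node r s w ∉ F → ∀ W ≥ κ.start r + 2 * s,
      committed G F n _ (gridPlan r t m) C ω W (κ.node r s w) = some m)
    (s : ℕ) (hs : 1 ≤ s) (w : ℤ) (hw : |w| ≤ (r : ℤ)) (hp : κ.node r s w ∉ F) (W : ℕ)
    (hW : κ.start r + 2 * s ≤ W) :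
    committed G F n _ (gridPlan r t m) C ω W (κ.node r s w) = some m := by
  classical
  induction s using Nat.strong_induction_on generalizing w W with
  | _ s ih =>
  rcases le_or_gt s r with hsr | hsr
  · exact hbase s w hs hsr hw hp W hW
  have hr : 1 ≤ r := by
    rcases Nat.eq_zero_or_pos r with rfl | h
    · simp at ht
    · exact h
  -- By reflection the node may be thought of as lying in column `-a` with `a ≥ 0`; `σ` restores the
  -- orientation.
  obtain ⟨σ, a, hσ, ha0, har, rfl⟩ : ∃ σ a : ℤ, (σ = 1 ∨ σ = -1) ∧ 0 ≤ a ∧ a ≤ r ∧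
      w = -(σ * a) := by
    rw [abs_le] at hw
    rcases le_total w 0 with h | h
    · exact ⟨1, -w, Or.inl rfl, by omega, by omega, by ring⟩
    · exact ⟨-1, w, Or.inr rfl, by omega, by omega, by ring⟩
  apply grid_committed_of_certified hd hF
  · intro h
    simp only [gridBall, Set.mem_ofPred_eq, abs_le] at h
    cases κ <;> simp only [Corridor.node] at h <;> omega
  -- There is one path for each node of the `r` preceding rows, over the full width of the corridor.
  -- In reflected coordinates the columns up to `r - a` are within range; a message from farther
  -- away is relayed by the node `r` rows ahead of its origin and `r` columns back.
  set I : Finset (ℕ × ℤ) := Finset.Ico (s - r) s ×ˢ Finset.Icc (-(r : ℤ)) r with hI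
  have hIcard : I.card = r * (2 * r + 1) := by
    rw [hI, Finset.card_product, Nat.card_Ico, Int.card_Icc]
    congr 1 <;> omega
  set path : ℕ × ℤ → Set (ℤ × ℤ) := fun x => if x.2 ≤ r - a then {κ.node r x.1 (σ * x.2)}
    else {κ.node r (x.1 + r) (σ * (x.2 - r)), κ.node r x.1 (σ * x.2)} with hpath
  have horigin : ∀ x, κ.node r x.1 (σ * x.2) ∈ path x := by
    intro x
    simp only [hpath]
    split_ifs <;> simp
  have hmem : ∀ x ∈ I, s - r ≤ x.1 ∧ x.1 < s ∧ -(r : ℤ) ≤ x.2 ∧ x.2 ≤ r := by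
    intro x hx
    rw [hI, Finset.mem_product, Finset.mem_Ico, Finset.mem_Icc] at hx
    exact ⟨hx.1.1, hx.1.2, hx.2.1, hx.2.2⟩
  have hdisj : (I : Set (ℕ × ℤ)).PairwiseDisjoint path := by
    intro x hx y hy hxy
    have hx' := hmem x hx
    have hy' := hmem y hy
    refine Set.disjoint_left.2 fun u hux huy => hxy ?_
    -- Origins lie in rows before `s`, relays in rows from `s` on, and within each kind the position
    -- determines the index. Hence the paths are disjoint.
    have key : ∀ z ∈ I, u ∈ path z → ∃ i y', u = κ.node r i y' ∧
        ((i < s ∧ i = z.1 ∧ y' = σ * z.2) ∨ (s ≤ i ∧ i = z.1 + r ∧ y' = σ * (z.2 - r))) := by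
      intro z hz hu
      have hz' := hmem z hz
      simp only [hpath] at hu
      split_ifs at hu
      · exact ⟨_, _, hu, Or.inl ⟨hz'.2.1, rfl, rfl⟩⟩
      · rcases hu with hu | hu
        · exact ⟨_, _, hu, Or.inr ⟨by omega, rfl, rfl⟩⟩
        · exact ⟨_, _, hu, Or.inl ⟨hz'.2.1, rfl, rfl⟩⟩
    obtain ⟨i, c, rfl, hi⟩ := key x hx hux
    obtain ⟨j, c', h2, hj⟩ := key y hy huy
    obtain ⟨rfl, rfl⟩ := Corridor.node_inj h2
    rcases hσ with rfl | rfl <;> (ext <;> omega)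
  have hball : ∀ x ∈ I, path x ⊆ gridBall r (κ.node r s 0) := by
    intro x hx u hu
    have hx' := hmem x hx
    simp only [hpath] at hu
    split_ifs at hu with h
    · rw [Set.mem_singleton_iff.1 hu]
      refine Corridor.node_mem_gridBall (by omega) (by omega) ?_
      rw [abs_le]; rcases hσ with rfl | rfl <;> omega
    · rcases hu with rfl | rfl
      · refine Corridor.node_mem_gridBall (by omega) (by omega) ?_
        rw [abs_le]; rcases hσ with rfl | rfl <;> omega
      · refine Corridor.node_mem_gridBall (by omega) (by omega) ?_
        rw [abs_le]; rcases hσ with rfl | rfl <;> omega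
  have hexec : ∀ x ∈ I, ∃ e : GridExec r, gridPath r e = path x ∧ (Disjoint (path x) F →
      knowledge G F n _ (gridPlan r t m) C ω W e (κ.node r s (-(σ * a))) = some m) := by
    rintro ⟨i, y⟩ hx
    have hx' := hmem _ hx
    simp only at hx'
    have hvalid : 1 ≤ i ∧ |σ * y| ≤ (r : ℤ) := by
      refine ⟨by omega, ?_⟩
      rw [abs_le]; rcases hσ with rfl | rfl <;> omega
    by_cases hy : y ≤ r - a
    · refine ⟨.commit κ i (σ * y) hvalid, by simp [hpath, hy, gridPath], fun hdF => ?_⟩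
      have hq : κ.node r i (σ * y) ∉ F := Set.disjoint_left.1 hdF (horigin (i, y))
      refine (hb.knowledge_eq_payload (e := .commit κ i (σ * y) hvalid) hn hβ ω hq
        ⟨s, -(σ * a), rfl, by omega, hw, by omega, by omega, ?_⟩ hp ?_).trans ?_
      · rw [abs_le]; rcases hσ with rfl | rfl <;> omega
      · change κ.start r + 2 * i < W
        omega
      · exact ih i (by omega) hvalid.1 (σ * y) hvalid.2 hq _ le_rfl
    · have hvalid' : r + 1 ≤ i + r ∧ |σ * (y - r)| < (r : ℤ) ∧
          ((σ = 1 ∧ σ * (y - r) ≤ 0) ∨ (σ = -1 ∧ 0 ≤ σ * (y - r))) := by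
        refine ⟨by omega, ?_, ?_⟩
        · rw [abs_lt]; rcases hσ with rfl | rfl <;> omega
        · rcases hσ with rfl | rfl
          · left; omega
          · right; omega
      have hcol : σ * (y - r) + σ * r = σ * y := by ring
      refine ⟨.heard κ (i + r) (σ * (y - r)) σ hvalid', ?_, fun hdF => ?_⟩
      · simp [hpath, hy, gridPath, hcol]
      have hq : κ.node r i (σ * y) ∉ F := Set.disjoint_left.1 hdF (horigin (i, y))
      have hq' : κ.node r (i + r) (σ * (y - r)) ∉ F :=
        Set.disjoint_left.1 hdF (by simp [hpath, hy])
      refine (hb.knowledge_eq_payload (e := .heard κ (i + r) (σ * (y - r)) σ hvalid') hn hβ ω hq'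
        ⟨s, -(σ * a), rfl, by omega, hw, by omega, by omega, ?_⟩ hp ?_).trans ?_
      · rcases hσ with rfl | rfl
        · left; omega
        · right; omega
      · change κ.start r + 2 * (i + r - r) + 1 < W
        omega
      -- Commit messages of row `i` occupy the even offset `2 * i` from the start of the corridor
      -- and their relays the offset `2 * i + 1`, so the relay has the message just in time, and row
      -- `s > i` hears it before its own window.
      · change knowledge G F n _ (gridPlan r t m) C ω (κ.start r + 2 * (i + r - r) + 1)
          (.commit κ (i + r - r) (σ * (y - r) + σ * r) (sister_valid hvalid'))
          (κ.node r (i + r) (σ * (y - r))) = some m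
        have he : (GridExec.commit κ (i + r - r) (σ * (y - r) + σ * r) (sister_valid hvalid') :
            GridExec r) = .commit κ i (σ * y) hvalid := by
          congr 1
          omega
        rw [he]
        refine (hb.knowledge_eq_payload (e := .commit κ i (σ * y) hvalid) hn hβ ω hq
          ⟨i + r, σ * (y - r), rfl, by omega, hvalid'.2.1.le, by omega, le_rfl, ?_⟩
          hq' ?_).trans ?_
        · rw [abs_le]; rcases hσ with rfl | rfl <;> omega
        · change κ.start r + 2 * i < _
          omega
        · exact ih i (by omega) hvalid.1 (σ * y) hvalid.2 hq _ le_rfl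
  have : Inhabited (GridExec r) := ⟨.dealer⟩
  choose! e he1 he2 using hexec
  -- Of `r(2r+1) > 2t` disjoint paths in one ball, at most `t` meet `F`; the others form the
  -- certificate.
  have hbad := card_filter_not_disjoint_le hdisj hball (hF (κ.node r s 0))
  have hsplit := Finset.card_filter_add_card_filter_not (s := I) (fun x => Disjoint (path x) F)
  have hinj : Set.InjOn e (I.filter fun x => Disjoint (path x) F) := by
    intro x hx y hy hxy
    have hx' := (Finset.mem_filter.1 hx).1
    have hy' := (Finset.mem_filter.1 hy).1
    by_contra hne
    have h1 := hdisj hx' hy' hne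
    have h2 : path x = path y := by rw [← he1 x hx', ← he1 y hy', hxy]
    exact Set.disjoint_left.1 h1 (horigin x) (h2 ▸ horigin x)
  refine ⟨(I.filter fun x => Disjoint (path x) F).image e, ?_, ?_, ?_, κ.node r s 0, ?_⟩
  · rw [Finset.card_image_of_injOn hinj]
    omega
  · intro f hf
    obtain ⟨x, hx, rfl⟩ := Finset.mem_image.1 hf
    exact he2 x (Finset.mem_filter.1 hx).1 (Finset.mem_filter.1 hx).2
  · intro f hf g hg hfg
    obtain ⟨x, hx, rfl⟩ := Finset.mem_image.1 hf
    obtain ⟨y, hy, rfl⟩ := Finset.mem_image.1 hg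
    have hx' := (Finset.mem_filter.1 hx).1
    have hy' := (Finset.mem_filter.1 hy).1
    have := hdisj hx' hy' fun h => hfg (h ▸ rfl)
    simp only [Function.onFun, he1 x hx', he1 y hy']
    exact this
  · intro f hf
    obtain ⟨x, hx, rfl⟩ := Finset.mem_image.1 hf
    rw [he1 x (Finset.mem_filter.1 hx).1]
    exact hball x (Finset.mem_filter.1 hx).1

theorem grid_live_vertical (ht : 2 * t < r * (2 * r + 1)) {x y : ℤ} (hx : |x| ≤ (r : ℤ))
    (hp : (x, y) ∉ F) {W : ℕ} (hW : 1 ≤ W) (hW' : 2 * y.natAbs ≤ W) :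
    committed G F n _ (gridPlan r t m) C ω W (x, y) = some m := by
  rcases eq_or_ne y 0 with rfl | hy
  · refine grid_live_ball hn hd hβ hb hp ?_ hW
    simpa [gridBall] using hx
  have hx' := abs_le.1 hx
  rcases le_total 0 y with h | h
  · have he : (x, y) = Corridor.up.node r y.natAbs x := by
      simp only [Corridor.node, Prod.mk.injEq, true_and]; omega
    rw [he] at hp ⊢
    refine grid_live_corridor hn hd hF hβ hb ht .up ?_ _ (by omega) x hx hp W
      (by simp only [Corridor.start]; omega)
    intro s w h1 h2 h3 h4 W' h5
    refine grid_live_ball hn hd hβ hb h4 ?_ (by omega)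
    simp only [gridBall, Corridor.node, Set.mem_ofPred_eq, abs_le] at h3 ⊢
    omega
  · have he : (x, y) = Corridor.down.node r y.natAbs x := by
      simp only [Corridor.node, Prod.mk.injEq, true_and]; omega
    rw [he] at hp ⊢
    refine grid_live_corridor hn hd hF hβ hb ht .down ?_ _ (by omega) x hx hp W
      (by simp only [Corridor.start]; omega)
    intro s w h1 h2 h3 h4 W' h5
    refine grid_live_ball hn hd hβ hb h4 ?_ (by omega)
    simp only [gridBall, Corridor.node, Set.mem_ofPred_eq, abs_le] at h3 ⊢
    omega

/-- Off the vertical strip `|x| ≤ r`, the row `y` is rounded to the nearest multiple of `2r + 1` to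
find a horizontal corridor. Its first `r` rows lie in the strip, and its starting window, at least
`2|y|` for all its `y`, is late enough for the strip to be committed there. -/
theorem grid_live (ht : 2 * t < r * (2 * r + 1)) {p : ℤ × ℤ} (hp : p ∉ F) :
    ∃ W₀, ∀ W ≥ W₀, committed G F n _ (gridPlan r t m) C ω W p = some m := by
  obtain ⟨x, y⟩ := p
  by_cases hx : |x| ≤ (r : ℤ)
  · exact ⟨2 * y.natAbs + 1, fun W hW =>
      grid_live_vertical hn hd hF hβ hb ht hx hp (by omega) (by omega)⟩
  have hx0 : x ≠ 0 := by
    rintro rfl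
    simp at hx
  obtain ⟨k, w, hw, rfl⟩ : ∃ k w : ℤ, |w| ≤ (r : ℤ) ∧ y = k * (2 * r + 1) + w := by
    have h1 := Int.emod_add_mul_ediv (y + r) (2 * r + 1)
    have h2 := Int.emod_nonneg (y + r) (show (2 * r + 1 : ℤ) ≠ 0 by omega)
    have h3 := Int.emod_lt_of_pos (y + r) (show (0 : ℤ) < 2 * r + 1 by omega)
    refine ⟨(y + r) / (2 * r + 1), (y + r) % (2 * r + 1) - r, abs_le.2 ⟨by omega, by omega⟩, ?_⟩
    linarith [mul_comm ((y + r) / (2 * r + 1)) (2 * r + 1 : ℤ)]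
  have hrow : ∀ w : ℤ, |w| ≤ (r : ℤ) → (k * (2 * r + 1) + w).natAbs ≤
      k.natAbs * (2 * r + 1) + r := by
    intro w hw
    refine (Int.natAbs_add_le _ _).trans (add_le_add ?_ ?_)
    · rw [Int.natAbs_mul]
      exact le_of_eq (by congr 1)
    · rw [abs_le] at hw
      omega
  rcases le_total 0 x with h | h
  · have he : (x, k * (2 * r + 1) + w) = (Corridor.right k).node r x.natAbs w := by
      simp only [Corridor.node, Prod.mk.injEq, and_true]; omega
    rw [he] at hp ⊢
    refine ⟨_, fun W hW => grid_live_corridor hn hd hF hβ hb ht (.right k) ?_ _ (by omega) w hw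
      hp W hW⟩
    intro s w h1 h2 h3 h4 W' h5
    have := hrow w h3
    simp only [Corridor.start] at h5
    exact grid_live_vertical hn hd hF hβ hb ht (by simpa using h2) h4 (by omega) (by omega)
  · have he : (x, k * (2 * r + 1) + w) = (Corridor.left k).node r x.natAbs w := by
      simp only [Corridor.node, Prod.mk.injEq, and_true]; omega
    rw [he] at hp ⊢
    refine ⟨_, fun W hW => grid_live_corridor hn hd hF hβ hb ht (.left k) ?_ _ (by omega) w hw
      hp W hW⟩
    intro s w h1 h2 h3 h4 W' h5
    have := hrow w h3
    simp only [Corridor.start] at h5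
    exact grid_live_vertical hn hd hF hβ hb ht (by simpa using h2) h4 (by omega) (by omega)

theorem grid_reliable (ht : 2 * t < r * (2 * r + 1)) :
    ReliableBroadcast G F n _ (gridPlan r t m) C m ω :=
  fun _ hp => ⟨grid_live hn hd hF hβ hb ht hp, fun w _ h => grid_safe hd hF w h⟩

end Grid

/-! ### Independence of the draws of different slots -/

section Independence

variable {V E : Type*}

instance : IsProbabilityMeasure (drawMeasure V E) := by unfold drawMeasure; infer_instance

/-- `f` does not depend on the draws made in slot `j` of execution `e`. -/
def Ignores {α : Type*} (e : E) (j : ℕ) (f : Draws V E → α) : Prop :=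
  ∀ ω ω' : Draws V E, (∀ (e' : E) (j' : ℕ) (v : V), (e', j') ≠ (e, j) →
    ω (e', j', v) = ω' (e', j', v)) → f ω = f ω'

/-- `f` depends only on the draws made in slot `j` of execution `e`. -/
def DependsOnlyOn {α : Type*} (e : E) (j : ℕ) (f : Draws V E → α) : Prop :=
  ∀ ω ω' : Draws V E, (∀ v : V, ω (e, j, v) = ω' (e, j, v)) → f ω = f ω'

theorem Ignores.comp₂ {α β γ : Type*} {e : E} {j : ℕ} {f : Draws V E → α} {g : Draws V E → β}
    (hf : Ignores e j f) (hg : Ignores e j g) (h : α → β → γ) :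
    Ignores e j (fun ω => h (f ω) (g ω)) := fun ω ω' hω => by
  change h (f ω) (g ω) = h (f ω') (g ω')
  rw [hf ω ω' hω, hg ω ω' hω]

theorem Ignores.comp {α β : Type*} {e : E} {j : ℕ} {f : Draws V E → α}
    (hf : Ignores e j f) (h : α → β) : Ignores e j (fun ω => h (f ω)) := fun ω ω' hω => by
  change h (f ω) = h (f ω')
  rw [hf ω ω' hω]

/-- A measurable function that depends only on some of the draws is measurable with respect to the
sigma-algebra that they generate. -/
theorem measurable_of_depends {I : Type*} {α : Type*} [MeasurableSpace α]
    {f : (I → unitInterval) → α} (hf : Measurable f) (A : Set I)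
    (h : ∀ ω ω' : I → unitInterval, (∀ i ∈ A, ω i = ω' i) → f ω = f ω') :
    Measurable[⨆ i ∈ A, MeasurableSpace.comap (fun ω : I → unitInterval => ω i) inferInstance] f
    := by
  classical
  -- Overwriting the draws outside `A` by a constant does not change `f`, and exhibits it as a
  -- function of the coordinates in `A`.
  set ext : (I → unitInterval) → (I → unitInterval) := fun ω i => if i ∈ A then ω i else 0 with he
  have hfe : f = f ∘ ext := by
    funext ω
    exact h _ _ fun i hi => by simp [he, hi]
  rw [hfe]
  refine hf.comp ?_
  rw [@measurable_pi_iff]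
  intro i
  by_cases hi : i ∈ A
  · simp only [he, hi, if_true]
    refine Measurable.mono (comap_measurable _) ?_ le_rfl
    exact le_iSup₂_of_le i hi le_rfl
  · simp only [he, hi, if_false]
    exact measurable_const

/-- The draws of one slot and all the other draws generate independent sigma-algebras. Through this
factorization the adversary's ignorance of the current coin flips becomes a bound on probabilities.
-/
theorem lintegral_mul_of_ignores {e : E} {j : ℕ} {f g : Draws V E → ℝ≥0∞} (hf : Measurable f)
    (hg : Measurable g) (hfi : Ignores e j f) (hgd : DependsOnlyOn e j g) :
    ∫⁻ ω, f ω * g ω ∂(drawMeasure V E) =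
      (∫⁻ ω, f ω ∂(drawMeasure V E)) * ∫⁻ ω, g ω ∂(drawMeasure V E) := by
  have hind : ProbabilityTheory.iIndepFun (fun (i : E × ℕ × V) (ω : Draws V E) => ω i)
      (drawMeasure V E) :=
    ProbabilityTheory.iIndepFun_infinitePi (X := fun _ x => x) fun _ => measurable_id
  set A : Set (E × ℕ × V) := {i | (i.1, i.2.1) ≠ (e, j)} with hA
  have hle : ∀ i : E × ℕ × V, MeasurableSpace.comap (fun ω : Draws V E => ω i) inferInstance ≤
      (inferInstance : MeasurableSpace (Draws V E)) := fun i => (measurable_pi_apply i).comap_le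
  have h := ProbabilityTheory.indep_iSup_of_disjoint (S := A) (T := Aᶜ) hle
    ((ProbabilityTheory.iIndepFun_iff_iIndep _ _ _).1 hind) disjoint_compl_right
  refine ProbabilityTheory.lintegral_mul_eq_lintegral_mul_lintegral_of_independent_measurableSpace
    (iSup₂_le fun i _ => hle i) (iSup₂_le fun i _ => hle i) h ?_ ?_
  · exact measurable_of_depends hf A fun ω ω' hω => hfi ω ω' fun e' j' v hne => hω _ hne
  · refine measurable_of_depends hg Aᶜ fun ω ω' hω => hgd ω ω' fun v => hω _ ?_
    simp [hA]

theorem measure_inter_of_ignores {e : E} {j : ℕ} {A B : Set (Draws V E)} (hA : MeasurableSet A)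
    (hB : MeasurableSet B) (hAi : Ignores e j (· ∈ A)) (hBd : DependsOnlyOn e j (· ∈ B)) :
    drawMeasure V E (A ∩ B) = drawMeasure V E A * drawMeasure V E B := by
  classical
  have h := lintegral_mul_of_ignores (e := e) (j := j) (f := A.indicator 1) (g := B.indicator 1)
    (measurable_one.indicator hA) (measurable_one.indicator hB)
    (fun ω ω' hω => by
      have := hAi ω ω' hω
      simp only [Set.indicator_apply]
      simp only [eq_iff_iff] at this
      simp [this])
    (fun ω ω' hω => by
      have := hBd ω ω' hω
      simp only [Set.indicator_apply]
      simp only [eq_iff_iff] at this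
      simp [this])
  rw [lintegral_indicator_one hA, lintegral_indicator_one hB] at h
  rw [← h, ← lintegral_indicator_one (hA.inter hB)]
  refine lintegral_congr fun ω => ?_
  rw [Set.inter_indicator_one]
  rfl

theorem volume_lt {a : ℝ} (h0 : 0 ≤ a) (h1 : a ≤ 1) :
    volume {x : unitInterval | (x : ℝ) < a} = ENNReal.ofReal a :=
  unitInterval.volume_Iio (⟨a, h0, h1⟩ : unitInterval)

theorem measurableSet_lt_coe (a : ℝ) : MeasurableSet {x : unitInterval | (x : ℝ) < a} :=
  measurableSet_lt measurable_subtype_coe measurable_const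

theorem measurableSet_draw_lt (i : E × ℕ × V) (a : ℝ) :
    MeasurableSet {ω : Draws V E | (ω i : ℝ) < a} :=
  (measurableSet_lt_coe a).preimage (measurable_pi_apply i)

theorem drawMeasure_lt (i : E × ℕ × V) {a : ℝ} (h0 : 0 ≤ a) (h1 : a ≤ 1) :
    drawMeasure V E {ω | (ω i : ℝ) < a} = ENNReal.ofReal a := by
  rw [← volume_lt h0 h1, drawMeasure,
    ← (measurePreserving_eval_infinitePi (fun _ : E × ℕ × V =>
      (volume : Measure unitInterval)) i).measure_preimage (measurableSet_lt_coe a).nullMeasurableSet]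
  rfl

theorem drawMeasure_lt_and_lt {i i' : E × ℕ × V} (hne : i ≠ i') {a b : ℝ} (ha0 : 0 ≤ a)
    (ha1 : a ≤ 1) (hb0 : 0 ≤ b) (hb1 : b ≤ 1) :
    drawMeasure V E {ω | (ω i : ℝ) < a ∧ (ω i' : ℝ) < b} = ENNReal.ofReal (a * b) := by
  classical
  have h := Measure.infinitePi_pi (fun _ : E × ℕ × V => (volume : Measure unitInterval))
    (s := {i, i'}) (t := fun k => if k = i then {x | (x : ℝ) < a} else {x | (x : ℝ) < b})
    (fun k _ => by split_ifs <;> exact measurableSet_lt_coe _)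
  rw [Finset.prod_pair hne, if_pos rfl, if_neg hne.symm, volume_lt ha0 ha1, volume_lt hb0 hb1,
    ← ENNReal.ofReal_mul ha0] at h
  rw [← h, drawMeasure]
  congr 1
  ext ω
  simp [hne.symm]

theorem one_sub_ofReal_le_exp {a : ℝ} (ha : 0 ≤ a) :
    1 - ENNReal.ofReal a ≤ ENNReal.ofReal (Real.exp (-a)) := by
  rw [← ENNReal.ofReal_one, ← ENNReal.ofReal_sub _ ha]
  exact ENNReal.ofReal_le_ofReal (by linarith [Real.add_one_le_exp (-a)])

theorem drawMeasure_not_lt_le (i : E × ℕ × V) {a : ℝ} (h0 : 0 ≤ a) (h1 : a ≤ 1) :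
    drawMeasure V E {ω | ¬ (ω i : ℝ) < a} ≤ ENNReal.ofReal (Real.exp (-a)) := by
  have h : {ω : Draws V E | ¬ (ω i : ℝ) < a} = {ω | (ω i : ℝ) < a}ᶜ := rfl
  rw [h, prob_compl_eq_one_sub (measurableSet_draw_lt i a), drawMeasure_lt i h0 h1]
  exact one_sub_ofReal_le_exp h0

theorem drawMeasure_not_lt_and_lt_le {i i' : E × ℕ × V} (hne : i ≠ i') {a b : ℝ} (ha0 : 0 ≤ a)
    (ha1 : a ≤ 1) (hb0 : 0 ≤ b) (hb1 : b ≤ 1) :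
    drawMeasure V E {ω | ¬ ((ω i : ℝ) < a ∧ (ω i' : ℝ) < b)} ≤
      ENNReal.ofReal (Real.exp (-(a * b))) := by
  have h : {ω : Draws V E | ¬ ((ω i : ℝ) < a ∧ (ω i' : ℝ) < b)} =
    {ω | (ω i : ℝ) < a ∧ (ω i' : ℝ) < b}ᶜ := rfl
  have hm : MeasurableSet {ω : Draws V E | (ω i : ℝ) < a ∧ (ω i' : ℝ) < b} :=
    (measurableSet_draw_lt i a).inter (measurableSet_draw_lt i' b)
  rw [h, prob_compl_eq_one_sub hm, drawMeasure_lt_and_lt hne ha0 ha1 hb0 hb1]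
  exact one_sub_ofReal_le_exp (mul_nonneg ha0 hb0)

end Independence

/-! ### Surviving many slots that are not disrupted is unlikely -/

section Luck

variable {V E : Type*} {e : E} {s N : ℕ} {A J B : ℕ → Set (Draws V E)} {q : ℝ}

open Classical in
/-- The number of the first `k` slots in which the event `J` occurs. -/
def countTo (J : ℕ → Set (Draws V E)) (k : ℕ) (ω : Draws V E) : ℕ :=
  ((Finset.range k).filter fun i => ω ∈ J i).card

theorem countTo_succ_of_mem {k : ℕ} {ω : Draws V E} (h : ω ∈ J k) :
    countTo J (k + 1) ω = countTo J k ω + 1 := by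
  classical
  rw [countTo, Finset.range_add_one, Finset.filter_insert, if_pos h,
    Finset.card_insert_of_notMem (by simp)]
  rfl

theorem countTo_succ_of_not_mem {k : ℕ} {ω : Draws V E} (h : ω ∉ J k) :
    countTo J (k + 1) ω = countTo J k ω := by
  classical
  rw [countTo, Finset.range_add_one, Finset.filter_insert, if_neg h]
  rfl

theorem measurable_countTo (hJ : ∀ k, MeasurableSet (J k)) (k : ℕ) : Measurable (countTo J k) := by
  classical
  induction k with
  | zero =>
    have : countTo J 0 = fun _ => 0 := by funext ω; simp [countTo]
    rw [this]; exact measurable_const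
  | succ k ih =>
    have : countTo J (k + 1) = fun ω => countTo J k ω + (J k).indicator 1 ω := by
      funext ω
      by_cases h : ω ∈ J k
      · rw [countTo_succ_of_mem h, Set.indicator_of_mem h]; rfl
      · rw [countTo_succ_of_not_mem h, Set.indicator_of_notMem h]; rfl
    rw [this]
    exact ih.add (measurable_one.indicator (hJ k))

theorem ignores_countTo {j k : ℕ} (h : ∀ k' < k, Ignores e j (· ∈ J k')) :
    Ignores e j (countTo J k) := by
  classical
  intro ω ω' hω
  unfold countTo
  congr 1
  refine Finset.filter_congr fun i hi => ?_
  exact (h i (Finset.mem_range.1 hi) ω ω' hω).to_iff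

/-- The weight of the exponential supermartingale: `q` to the number of undisrupted slots. -/
def luckWeight (q : ℝ) (J : ℕ → Set (Draws V E)) (k : ℕ) (ω : Draws V E) : ℝ≥0∞ :=
  ENNReal.ofReal (Real.exp (q * (k - countTo J k ω)))

theorem measurable_luckWeight (hJ : ∀ k, MeasurableSet (J k)) (k : ℕ) :
    Measurable (luckWeight q J k) := by
  have h : Measurable fun ω => ((countTo J k ω : ℕ) : ℝ) :=
    measurable_from_top.comp (measurable_countTo hJ k)
  unfold luckWeight
  fun_prop

theorem luckWeight_succ_of_mem {k : ℕ} {ω : Draws V E} (h : ω ∈ J k) :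
    luckWeight q J (k + 1) ω = luckWeight q J k ω := by
  unfold luckWeight
  rw [countTo_succ_of_mem h]
  push_cast
  congr 3
  ring

theorem luckWeight_succ_of_not_mem {k : ℕ} {ω : Draws V E} (h : ω ∉ J k) :
    luckWeight q J (k + 1) ω = luckWeight q J k ω * ENNReal.ofReal (Real.exp q) := by
  unfold luckWeight
  rw [countTo_succ_of_not_mem h, ← ENNReal.ofReal_mul (Real.exp_pos _).le, ← Real.exp_add]
  push_cast
  congr 2
  ring

/-- The integral does not increase with `k`. A disrupted slot leaves the weight alone; an
undisrupted one multiplies it by `exp q`, but is survived only on `B k`, whose probability is at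
most `exp (-q)`. -/
theorem lintegral_luckWeight_le (hA : ∀ k, MeasurableSet (A k)) (hJ : ∀ k, MeasurableSet (J k))
    (hB : ∀ k, MeasurableSet (B k)) (hAi : ∀ k, Ignores e (s + k) (· ∈ A k))
    (hJi : ∀ k, ∀ k' ≤ k, Ignores e (s + k) (· ∈ J k'))
    (hBd : ∀ k, DependsOnlyOn e (s + k) (· ∈ B k))
    (hAs : ∀ k < N, A (k + 1) ⊆ A k) (hstep : ∀ k < N, ∀ ω ∈ A (k + 1), ω ∉ J k → ω ∈ B k)
    (hBq : ∀ k < N, drawMeasure V E (B k) ≤ ENNReal.ofReal (Real.exp (-q))) {k : ℕ} (hk : k ≤ N) :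
    ∫⁻ ω in A k, luckWeight q J k ω ∂(drawMeasure V E) ≤ drawMeasure V E (A 0) := by
  classical
  induction k with
  | zero => simp [luckWeight, countTo]
  | succ k ih =>
    refine le_trans ?_ (ih (by omega))
    have hW := measurable_luckWeight (q := q) hJ
    have hbound : ∀ ω, (A (k + 1)).indicator (luckWeight q J (k + 1)) ω ≤
        (A k ∩ J k).indicator (luckWeight q J k) ω +
        (A k \ J k).indicator (luckWeight q J k) ω *
          (ENNReal.ofReal (Real.exp q) * (B k).indicator 1 ω) := by
      intro ω
      by_cases h1 : ω ∈ A (k + 1)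
      · have h2 := hAs k (by omega) h1
        rw [Set.indicator_of_mem h1]
        by_cases h3 : ω ∈ J k
        · rw [luckWeight_succ_of_mem h3, Set.indicator_of_mem (Set.mem_inter h2 h3)]
          exact le_self_add
        · rw [luckWeight_succ_of_not_mem h3,
            Set.indicator_of_mem (show ω ∈ A k \ J k from ⟨h2, h3⟩),
            Set.indicator_of_mem (hstep k (by omega) ω h1 h3)]
          simp
      · rw [Set.indicator_of_notMem h1]
        exact zero_le
    rw [← lintegral_indicator (hA (k + 1)), ← lintegral_indicator (hA k)]
    refine (lintegral_mono hbound).trans ?_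
    have hm1 : Measurable ((A k ∩ J k).indicator (luckWeight q J k)) :=
      (hW k).indicator ((hA k).inter (hJ k))
    have hm2 : Measurable ((A k \ J k).indicator (luckWeight q J k)) :=
      (hW k).indicator ((hA k).diff (hJ k))
    have hm3 : Measurable fun ω => ENNReal.ofReal (Real.exp q) * (B k).indicator 1 ω :=
      (measurable_one.indicator (hB k)).const_mul _
    -- Survival so far, the weight, and the decision to disrupt slot `s + k` all precede its draws,
    -- while `B k` depends on these draws only; so the integral of the product factorizes.
    rw [lintegral_add_left hm1, lintegral_mul_of_ignores (e := e) (j := s + k) hm2 hm3]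
    · rw [lintegral_const_mul _ (measurable_one.indicator (hB k)), lintegral_indicator_one (hB k)]
      have hq : ENNReal.ofReal (Real.exp q) * drawMeasure V E (B k) ≤ 1 := by
        refine (mul_le_mul_right (hBq k (by omega)) _).trans ?_
        rw [← ENNReal.ofReal_mul (Real.exp_pos _).le, ← Real.exp_add]
        simp
      refine (add_le_add le_rfl (mul_le_of_le_one_right' hq)).trans ?_
      rw [← lintegral_add_left hm1]
      refine lintegral_mono fun ω => ?_
      by_cases h2 : ω ∈ A k
      · by_cases h3 : ω ∈ J k <;> simp [h2, h3]
      · simp [h2]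
    · intro ω ω' hω
      have h1 := (hAi k ω ω' hω).to_iff
      have h2 := (hJi k k le_rfl ω ω' hω).to_iff
      have h3 : luckWeight q J k ω = luckWeight q J k ω' := by
        unfold luckWeight
        rw [ignores_countTo (fun k' hk' => hJi k k' hk'.le) ω ω' hω]
      simp only [Set.indicator_apply, Set.mem_sdiff, h1, h2, h3]
    · intro ω ω' hω
      have h1 := (hBd k ω ω' hω).to_iff
      simp only [Set.indicator_apply, h1]
      simp

/-- If in each undisrupted slot one survives with probability at most `exp (-q)`, then with
probability at most `exp (-q u)` one survives at least `u` of them. -/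
theorem measure_survive_le (hA : ∀ k, MeasurableSet (A k)) (hJ : ∀ k, MeasurableSet (J k))
    (hB : ∀ k, MeasurableSet (B k)) (hAi : ∀ k, Ignores e (s + k) (· ∈ A k))
    (hJi : ∀ k, ∀ k' ≤ k, Ignores e (s + k) (· ∈ J k'))
    (hBd : ∀ k, DependsOnlyOn e (s + k) (· ∈ B k))
    (hAs : ∀ k < N, A (k + 1) ⊆ A k) (hstep : ∀ k < N, ∀ ω ∈ A (k + 1), ω ∉ J k → ω ∈ B k)
    (hBq : ∀ k < N, drawMeasure V E (B k) ≤ ENNReal.ofReal (Real.exp (-q))) (hq : 0 ≤ q) (u : ℝ) :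
    drawMeasure V E {ω | ω ∈ A N ∧ u ≤ N - countTo J N ω} ≤
      ENNReal.ofReal (Real.exp (-(q * u))) * drawMeasure V E (A 0) := by
  have h := lintegral_luckWeight_le hA hJ hB hAi hJi hBd hAs hstep hBq le_rfl
  have hms : MeasurableSet {ω : Draws V E | ω ∈ A N ∧ u ≤ N - countTo J N ω} := by
    refine (hA N).inter ?_
    have h : Measurable fun ω => ((countTo J N ω : ℕ) : ℝ) :=
      measurable_from_top.comp (measurable_countTo hJ N)
    exact measurableSet_le measurable_const (measurable_const.sub h)
  -- Markov's inequality: on this event the weight is at least `exp (q * u)`.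
  have h2 : ENNReal.ofReal (Real.exp (q * u)) *
      drawMeasure V E {ω | ω ∈ A N ∧ u ≤ N - countTo J N ω} ≤ drawMeasure V E (A 0) := by
    refine le_trans ?_ h
    rw [← setLIntegral_const]
    refine (setLIntegral_mono' hms fun ω hω => ?_).trans
      (lintegral_mono_set (fun ω hω => hω.1))
    exact ENNReal.ofReal_le_ofReal (Real.exp_le_exp.2 (mul_le_mul_of_nonneg_left hω.2 hq))
  calc drawMeasure V E {ω | ω ∈ A N ∧ u ≤ N - countTo J N ω}
      = ENNReal.ofReal (Real.exp (-(q * u))) * (ENNReal.ofReal (Real.exp (q * u)) *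
        drawMeasure V E {ω | ω ∈ A N ∧ u ≤ N - countTo J N ω}) := by
        rw [← mul_assoc, ← ENNReal.ofReal_mul (Real.exp_pos _).le, ← Real.exp_add]
        simp
    _ ≤ _ := mul_le_mul_right h2 _

end Luck

/-- The receivers of each execution are neighbours of its sender, and the degrees are at most
`n`. -/
structure LocalPlan {V E M : Type*} (G : SimpleGraph V) (n : ℕ) (P : Plan V E M) : Prop where
  receivers_subset : ∀ e, P.receivers e ⊆ G.neighborSet (P.sender e)
  degree_le : ∀ p, (G.neighborSet p).encard ≤ n

/-! ### Non-anticipation, measurability, and the chance of progress within one round. -/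

section Events

variable {V E M : Type*} {G : SimpleGraph V} {F : Set V} {n D : ℕ} {P : Plan V E M}
  {C : Carol V E M P.window D} {e : E}

theorem LocalPlan.finite_neighborSet (hP : LocalPlan G n P) (p : V) : (G.neighborSet p).Finite :=
  Set.finite_of_encard_le_coe (hP.degree_le p)

theorem LocalPlan.finite_receivers (hP : LocalPlan G n P) (e : E) : (P.receivers e).Finite :=
  (hP.finite_neighborSet _).subset (hP.receivers_subset e)

/-! #### The adversary and the state do not anticipate the draws -/

/-- The draws of slot `j` are excluded from what she sees when `j' = j`, and come later than her
decision when `j' < j`. -/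
theorem Carol.ignores (C : Carol V E M P.window D) {j j' : ℕ} (h : j' ≤ j) {ω ω' : Draws V E}
    (hω : ∀ (e' : E) (i : ℕ) (v : V), (e', i) ≠ (e, j) → ω (e', i, v) = ω' (e', i, v)) :
    C.disrupt e j' ω = C.disrupt e j' ω' ∧ (C.eager e j' ω ↔ C.eager e j' ω') := by
  have h' := C.adapted e j' ω ω' fun e'' i v hle hne => hω e'' i v fun heq => by
    simp only [Prod.mk.injEq] at heq
    obtain ⟨rfl, rfl⟩ := heq
    exact hne (by rw [Prod.mk.injEq]; exact ⟨rfl, by omega⟩)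
  exact ⟨h'.1, h'.2.1⟩

theorem ignores_jammed {j j' : ℕ} (h : j' ≤ j) (v : V) :
    Ignores e j (fun ω => Jammed G F D P C e j' ω v) := fun ω ω' hω => by
  simp only [Jammed, (C.ignores h hω).1]

theorem ignores_lbState {j j' : ℕ} (h : j' ≤ j) :
    Ignores e j (fun ω => lbState G F n D P C e ω j') := fun ω ω' hω => by
  dsimp only
  induction j' with
  | zero => rfl
  | succ j' ih =>
    have hs := ih (by omega)
    have hd := (C.ignores (show j' ≤ j by omega) hω).1
    have he := (C.ignores (show j' ≤ j by omega) hω).2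
    have hx : ∀ v, ω (e, j', v) = ω' (e, j', v) := fun v => hω e j' v (by simp; omega)
    simp only [lbState, Hears, TunedIn, Broadcasts, HearsSilence, Awaits, Jammed, hs, hd, he, hx]

/-! #### Measurability -/

theorem measurable_rule (f : unitInterval → Prop) (c : ℝ) (i : E × ℕ × V)
    (hf : (∀ x, f x ↔ True) ∨ (∀ x, f x ↔ False) ∨ ∀ x, f x ↔ (x : ℝ) < c) :
    Measurable fun ω : Draws V E => f (ω i) := by
  rcases hf with h | h | h
  · simp only [h]; exact measurable_const
  · simp only [h]; exact measurable_const
  · simp only [h]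
    exact measurableSet_setOfPred.1 (measurableSet_draw_lt i c)

theorem measurable_sendRule (n j : ℕ) (i : E × ℕ × V) :
    Measurable fun ω : Draws V E => SendRule n j (ω i) := by
  refine measurable_rule _ (3 * Real.log n / 2 ^ roundOf n j) i ?_
  unfold SendRule
  cases phaseOf n j <;> simp

theorem measurable_listenRule (n j : ℕ) (i : E × ℕ × V) :
    Measurable fun ω : Draws V E => ListenRule n j (ω i) := by
  refine measurable_rule _ (2 / (2 : ℝ) ^ ((φ - 1) * roundOf n j)) i ?_
  unfold ListenRule
  cases phaseOf n j <;> simp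

theorem measurable_nackListenRule (n j : ℕ) (i : E × ℕ × V) :
    Measurable fun ω : Draws V E => NackListenRule n j (ω i) := by
  refine measurable_rule _ (4 * Real.log n / 2 ^ roundOf n j) i ?_
  unfold NackListenRule
  cases phaseOf n j <;> simp

theorem measurable_jammed (hP : LocalPlan G n P) (j : ℕ) (v : V) :
    Measurable fun ω => Jammed G F D P C e j ω v := by
  have h : ∀ ω, Jammed G F D P C e j ω v ↔ ω ∈ ⋃ u ∈ G.neighborSet v ∩ F,
      {ω | u ∈ C.disrupt e j ω} := by
    intro ω
    simp only [Jammed, Set.mem_iUnion, Set.mem_inter_iff, SimpleGraph.mem_neighborSet]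
    constructor
    · rintro ⟨u, h1, h2, h3⟩
      exact ⟨u, ⟨h2.symm, h1⟩, h3⟩
    · rintro ⟨u, ⟨h2, h1⟩, h3⟩
      exact ⟨u, h1, h2.symm, h3⟩
  simp only [h]
  exact measurableSet_setOfPred.1 (MeasurableSet.biUnion
    ((hP.finite_neighborSet v).subset Set.inter_subset_left).countable
    fun u _ => C.measurable_disrupt e j u)

/-- The events that describe the state of `e` before slot `j` are measurable. -/
def MeasurableState (G : SimpleGraph V) (F : Set V) (n : ℕ) (C : Carol V E M P.window D) (e : E)
    (j : ℕ) : Prop :=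
  (∀ v, Measurable fun ω => v ∈ (lbState G F n D P C e ω j).got) ∧
  (Measurable fun ω => (lbState G F n D P C e ω j).clear) ∧
  Measurable fun ω => (lbState G F n D P C e ω j).stopped

theorem MeasurableState.broadcasts {j : ℕ} (h : MeasurableState G F n C e j) :
    Measurable fun ω => Broadcasts F n D P C (lbState G F n D P C e ω j) e j ω := by
  by_cases hq : P.sender e ∈ F
  · simp only [Broadcasts, hq, if_true]
    exact ((measurableSet_setOfPred.1 (C.measurable_disrupt e j _)).not).and
      ((measurableSet_setOfPred.1 (C.measurable_eager e j)).or (measurable_sendRule n j _))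
  · simp only [Broadcasts, hq, if_false]
    exact h.2.2.not.and (measurable_sendRule n j _)

theorem MeasurableState.tunedIn {j : ℕ} (h : MeasurableState G F n C e j) (v : V) :
    Measurable fun ω => TunedIn F n P (lbState G F n D P C e ω j) e j ω v :=
  measurable_const.and (measurable_const.and ((h.1 v).not.and (measurable_listenRule n j _)))

theorem MeasurableState.requests {j : ℕ} (h : MeasurableState G F n C e j) (v : V) :
    Measurable fun ω => Requests F n P (lbState G F n D P C e ω j) e j v :=
  measurable_const.and (measurable_const.and ((h.1 v).not.and measurable_const))

theorem MeasurableState.awaits {j : ℕ} (h : MeasurableState G F n C e j) :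
    Measurable fun ω => Awaits F n P (lbState G F n D P C e ω j) e j ω :=
  measurable_const.and (h.2.2.not.and (measurable_nackListenRule n j _))

theorem MeasurableState.engaged {j : ℕ} (h : MeasurableState G F n C e j) (v : V) :
    Measurable fun ω => Engaged F P (lbState G F n D P C e ω j) e v :=
  measurable_const.and ((measurable_const.and h.2.2.not).or (measurable_const.and (h.1 v).not))

theorem MeasurableState.hearsSilence {j : ℕ} (hP : LocalPlan G n P)
    (h : MeasurableState G F n C e j) :
    Measurable fun ω => HearsSilence G F n D P C (lbState G F n D P C e ω j) e j ω := by
  have hr : ∀ ω, (∀ v, ¬ Requests F n P (lbState G F n D P C e ω j) e j v) ↔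
      ω ∈ ⋂ v ∈ P.receivers e, {ω | ¬ Requests F n P (lbState G F n D P C e ω j) e j v} := by
    intro ω
    simp only [Set.mem_iInter]
    exact ⟨fun h v _ => h v, fun h v hv => h v hv.1 hv⟩
  simp only [HearsSilence, hr]
  exact h.awaits.and ((measurable_jammed hP j _).not.and (measurableSet_setOfPred.1
    (MeasurableSet.biInter (hP.finite_receivers e).countable
      fun v _ => measurableSet_setOfPred.2 (h.requests v).not)))

theorem measurableState (hP : LocalPlan G n P) (j : ℕ) : MeasurableState G F n C e j := by
  induction j with
  | zero => exact ⟨fun v => measurable_const, measurable_const, measurable_const⟩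
  | succ j ih =>
    have hs := ih.hearsSilence hP
    refine ⟨fun v => ?_, ?_, ?_⟩
    · exact (ih.1 v).or ((ih.tunedIn v).and (ih.broadcasts.and (measurable_jammed hP j v).not))
    · exact measurable_const.and (ih.2.1.or hs)
    · exact ih.2.2.or (measurable_const.and (ih.2.1.or hs))

/-! #### Events -/

/-- The correct receiver `v` is still without the message before slot `j`. -/
def Waiting (G : SimpleGraph V) (F : Set V) (n : ℕ) (C : Carol V E M P.window D) (e : E) (v : V)
    (j : ℕ) : Set (Draws V E) :=
  {ω | v ∈ P.receivers e ∧ v ∉ F ∧ v ∉ (lbState G F n D P C e ω j).got}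

/-- The correct sender of `e` has not terminated before slot `j`. -/
def Serving (G : SimpleGraph V) (F : Set V) (n : ℕ) (C : Carol V E M P.window D) (e : E)
    (j : ℕ) : Set (Draws V E) :=
  {ω | P.sender e ∉ F ∧ ¬ (lbState G F n D P C e ω j).stopped}

/-- Slot `j` of `e` is disrupted at `p`, which has not yet terminated `e`. -/
def JamAt (G : SimpleGraph V) (F : Set V) (n : ℕ) (C : Carol V E M P.window D) (e : E) (p : V)
    (j : ℕ) : Set (Draws V E) :=
  {ω | Engaged F P (lbState G F n D P C e ω j) e p ∧ Jammed G F D P C e j ω p}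

/-- All correct receivers have been served before slot `j`, but the sender has not found out. -/
def Unaware (G : SimpleGraph V) (F : Set V) (n : ℕ) (C : Carol V E M P.window D) (e : E)
    (j : ℕ) : Set (Draws V E) :=
  {ω | P.sender e ∉ F ∧ ¬ (lbState G F n D P C e ω j).stopped ∧
    ¬ (lbState G F n D P C e ω j).clear ∧
    ∀ v ∈ P.receivers e, v ∉ F → v ∈ (lbState G F n D P C e ω j).got}

theorem measurableSet_waiting (hP : LocalPlan G n P) (v : V) (j : ℕ) :
    MeasurableSet (Waiting G F n C e v j) :=
  measurableSet_setOfPred.2 (measurable_const.and (measurable_const.and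
    (((measurableState hP j).1 v).not)))

theorem measurableSet_serving (hP : LocalPlan G n P) (j : ℕ) :
    MeasurableSet (Serving G F n C e j) :=
  measurableSet_setOfPred.2 (measurable_const.and (measurableState hP j).2.2.not)

theorem measurableSet_jamAt (hP : LocalPlan G n P) (v : V) (j : ℕ) :
    MeasurableSet (JamAt G F n C e v j) :=
  measurableSet_setOfPred.2 (((measurableState hP j).engaged v).and (measurable_jammed hP j v))

theorem measurableSet_unaware (hP : LocalPlan G n P) (j : ℕ) :
    MeasurableSet (Unaware G F n C e j) := by
  have hm := measurableState (G := G) (F := F) (n := n) (C := C) (e := e) hP j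
  have h : Unaware G F n C e j = {ω | P.sender e ∉ F ∧ ¬ (lbState G F n D P C e ω j).stopped ∧
    ¬ (lbState G F n D P C e ω j).clear ∧
    ω ∈ ⋂ v ∈ P.receivers e, {ω | v ∉ F → v ∈ (lbState G F n D P C e ω j).got}} := by
    ext ω
    simp [Unaware]
  rw [h]
  refine measurableSet_setOfPred.2 (measurable_const.and (hm.2.2.not.and (hm.2.1.not.and
    (measurableSet_setOfPred.1 (MeasurableSet.biInter (hP.finite_receivers e).countable
      fun v _ => measurableSet_setOfPred.2 (measurable_const.imp (hm.1 v)))))))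

theorem ignores_waiting {j j' : ℕ} (h : j' ≤ j) (v : V) :
    Ignores e j (· ∈ Waiting G F n C e v j') :=
  (ignores_lbState h).comp fun s => v ∈ P.receivers e ∧ v ∉ F ∧ v ∉ s.got

theorem ignores_serving {j j' : ℕ} (h : j' ≤ j) : Ignores e j (· ∈ Serving G F n C e j') :=
  (ignores_lbState h).comp fun s => P.sender e ∉ F ∧ ¬ s.stopped

theorem ignores_unaware {j j' : ℕ} (h : j' ≤ j) : Ignores e j (· ∈ Unaware G F n C e j') :=
  (ignores_lbState h).comp fun s => P.sender e ∉ F ∧ ¬ s.stopped ∧ ¬ s.clear ∧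
    ∀ v ∈ P.receivers e, v ∉ F → v ∈ s.got

theorem ignores_jamAt {j j' : ℕ} (h : j' ≤ j) (v : V) :
    Ignores e j (· ∈ JamAt G F n C e v j') :=
  (ignores_lbState h).comp₂ (ignores_jammed h v) fun s J => Engaged F P s e v ∧ J

theorem waiting_anti {v : V} {j j' : ℕ} (h : j ≤ j') :
    Waiting G F n C e v j' ⊆ Waiting G F n C e v j :=
  fun _ hω => ⟨hω.1, hω.2.1, fun hg => hω.2.2 (got_mono h hg)⟩

theorem serving_anti {j j' : ℕ} (h : j ≤ j') : Serving G F n C e j' ⊆ Serving G F n C e j :=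
  fun _ hω => ⟨hω.1, fun hg => hω.2 (stopped_mono h hg)⟩

theorem waiting_subset_serving {v : V} {j : ℕ} (hq : P.sender e ∉ F) :
    Waiting G F n C e v j ⊆ Serving G F n C e j :=
  fun _ hω => ⟨hq, not_stopped_of_not_mem_got hω.1 hω.2.1 hω.2.2⟩

theorem unaware_subset_serving {j : ℕ} : Unaware G F n C e j ⊆ Serving G F n C e j :=
  fun _ hω => ⟨hω.1, hω.2.1⟩

theorem mem_jamAt_of_waiting {ω : Draws V E} {v : V} {j : ℕ} (hω : ω ∈ Waiting G F n C e v j)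
    (hJ : Jammed G F D P C e j ω v) : ω ∈ JamAt G F n C e v j :=
  ⟨⟨hω.2.1, Or.inr ⟨hω.1, hω.2.2⟩⟩, hJ⟩

theorem countTo_le_of_jamBounded {β : ℕ} (hb : JamBounded G F n D P C β) {p : V} (hp : p ∉ F)
    {s N : ℕ} (hD : s + N ≤ D) (ω : Draws V E) :
    countTo (fun o => JamAt G F n C e p (s + o)) N ω ≤ β := by
  classical
  unfold countTo
  have h := card_le_disruptedSlots (G := G) (F := F) (n := n) (C := C) (e := e) (ω := ω) (p := p)
    (T := ((Finset.range N).filter fun i => ω ∈ JamAt G F n C e p (s + i)).image (s + ·))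
    (fun j hj => by
      obtain ⟨i, hi, rfl⟩ := Finset.mem_image.1 hj
      have := Finset.mem_range.1 (Finset.mem_filter.1 hi).1
      omega)
    (fun j hj => by
      obtain ⟨i, hi, rfl⟩ := Finset.mem_image.1 hj
      exact (Finset.mem_filter.1 hi).2)
  rw [Finset.card_image_of_injective _ (add_right_injective s)] at h
  have h2 := h.trans (hb ω p hp)
  exact_mod_cast h2

theorem exp_neg_mul_log (n k : ℕ) (hn : 2 ≤ n) :
    Real.exp (-(k * Real.log n)) = 1 / (n : ℝ) ^ k := by
  have : (0 : ℝ) < n := by positivity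
  rw [Real.exp_neg, mul_comm, Real.exp_mul, Real.exp_log this, Real.rpow_natCast, one_div]

/-- If at most half of the probabilistic send phase of a round is disrupted at a receiver, then it
gets the message in this phase with probability at least `1 - 1 / n ^ 3`. -/
theorem receiver_survives_le (hP : LocalPlan G n P) (hn : 2 ≤ n) (v : V) (k : ℕ) :
    (drawMeasure V E).real {ω | ω ∈ Waiting G F n C e v
        (roundStart n k + probSendLen (firstRound n + k)) ∧
      (countTo (fun o => JamAt G F n C e v (roundStart n k + o))
        (probSendLen (firstRound n + k)) ω : ℝ) ≤
          2 ^ (firstRound n + k) * rho ^ (firstRound n + k) / 2} ≤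
      1 / n ^ 3 * (drawMeasure V E).real (Waiting G F n C e v (roundStart n k)) := by
  by_cases hv : v ∈ P.receivers e
  swap
  · rw [Set.eq_empty_of_forall_notMem (s := {ω | ω ∈ Waiting G F n C e v
        (roundStart n k + probSendLen (firstRound n + k)) ∧ _}) fun ω hω => hv hω.1.1]
    simp only [measureReal_empty]
    positivity
  have hadj : G.Adj (P.sender e) v := hP.receivers_subset e hv
  have hlog := log_gt hn
  set i := firstRound n + k with hi
  have hi2 : 2 ≤ i := by have := two_le_firstRound hn; omega
  have hpow : (2 : ℝ) ^ firstRound n ≤ 2 ^ i := pow_le_pow_right₀ (by norm_num) (by omega)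
  have h4 := four_log_le_two_pow hn
  have hρ := rho_pow_ge_two hi2
  have h2i : (0 : ℝ) < 2 ^ i := by positivity
  set a : ℝ := 3 * Real.log n / 2 ^ i with ha
  set b : ℝ := 2 / rho ^ i with hb
  have ha0 : 0 ≤ a := by positivity
  have ha1 : a ≤ 1 := by rw [ha, div_le_one h2i]; linarith
  have hb0 : 0 ≤ b := by positivity
  have hb1 : b ≤ 1 := by rw [hb, div_le_one (by linarith)]; linarith
  have hlen : ∀ o < probSendLen i, o < roundLen i := fun o ho => by
    have := Nat.two_pow_pos i
    unfold roundLen; omega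
  -- An undisrupted slot leaves the receiver unserved only if the draws of sender and receiver are
  -- not both favourable. They belong to distinct nodes, so both are favourable with probability `a
  -- * b`.
  have key := measure_survive_le (e := e) (s := roundStart n k) (N := probSendLen i)
    (A := fun o => Waiting G F n C e v (roundStart n k + o))
    (J := fun o => JamAt G F n C e v (roundStart n k + o))
    (B := fun o => {ω | ¬ ((ω (e, roundStart n k + o, P.sender e) : ℝ) < a ∧
      (ω (e, roundStart n k + o, v) : ℝ) < b)})
    (q := a * b)
    (fun o => measurableSet_waiting hP v _) (fun o => measurableSet_jamAt hP v _)
    (fun o => ((measurableSet_draw_lt (e, roundStart n k + o, P.sender e) a).inter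
      (measurableSet_draw_lt (e, roundStart n k + o, v) b)).compl)
    (fun o => ignores_waiting le_rfl v) (fun o o' ho => ignores_jamAt (by omega) v)
    (fun o ω ω' hω => by
      change (¬ ((ω _ : ℝ) < a ∧ (ω _ : ℝ) < b)) = (¬ ((ω' _ : ℝ) < a ∧ (ω' _ : ℝ) < b))
      rw [hω, hω])
    (fun o _ => waiting_anti (by omega))
    (fun o ho ω hω hJ hlt => by
      have hw : ω ∈ Waiting G F n C e v (roundStart n k + o) := waiting_anti (by omega) hω
      have hnj : ¬ Jammed G F D P C e (roundStart n k + o) ω v :=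
        fun h => hJ (mem_jamAt_of_waiting hw h)
      have hph := phaseOf_probSend hi.symm ho
      have hro := roundOf_roundStart_add hi.symm (hlen o ho)
      have hlisten : ListenRule n (roundStart n k + o) (ω (e, roundStart n k + o, v)) := by
        simp only [ListenRule, hph, hro, two_rpow_sub_one_mul]
        exact hlt.2
      refine hω.2.2 (Or.inr ⟨⟨hw.1, hw.2.1, hw.2.2, hlisten⟩, ?_, hnj⟩)
      · have hsend : SendRule n (roundStart n k + o)
            (ω (e, roundStart n k + o, P.sender e)) := by
          simp only [SendRule, hph, hro]
          exact hlt.1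
        unfold Broadcasts
        split_ifs with hq
        -- A Byzantine sender that withholds disrupts the slot at its neighbour `v`; otherwise it
        -- transmits at least when the coin flip says so.
        · exact ⟨fun hd => hnj ⟨_, hq, hadj, hd⟩, Or.inr hsend⟩
        · exact ⟨not_stopped_of_not_mem_got hw.1 hw.2.1 hw.2.2, hsend⟩)
    (fun o _ => drawMeasure_not_lt_and_lt_le (by simp [hadj.ne]) ha0 ha1 hb0 hb1)
    (mul_nonneg ha0 hb0) (2 ^ i * rho ^ i / 2)
  -- The exponent is `(3 log n / 2^i) * (2 / rho^i)` times half of `2^i * rho^i`, that is, `3 log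
  -- n`.
  have hexp : Real.exp (-(a * b * (2 ^ i * rho ^ i / 2))) = 1 / (n : ℝ) ^ 3 := by
    rw [← exp_neg_mul_log n 3 hn]
    congr 2
    rw [ha, hb]
    field_simp
    norm_num
  rw [hexp] at key
  have h5 := ENNReal.toReal_mono (by finiteness) key
  rw [ENNReal.toReal_mul, ENNReal.toReal_ofReal (by positivity)] at h5
  refine le_trans (measureReal_mono (fun ω hω => show ω ∈ _ ∧ _ from ⟨hω.1, ?_⟩)) h5
  have h6 := le_probSendLen i
  have h7 := hω.2
  linarith

theorem not_listenRule_probNack {j : ℕ} (h : phaseOf n j = Phase.probNack) (x : unitInterval) :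
    ¬ ListenRule n j x := by
  simp [ListenRule, h]

/-- Nobody receives during the request phase, so the set of served receivers is frozen, and `clear`
is not reset before the end of the round. -/
theorem unaware_anti {j : ℕ} (hph : phaseOf n j = Phase.probNack) (hl : ¬ LastSlot n j) :
    Unaware G F n C e (j + 1) ⊆ Unaware G F n C e j := by
  intro ω hω
  refine ⟨hω.1, fun h => hω.2.1 (Or.inl h), fun h => hω.2.2.1 ⟨hl, Or.inl h⟩, fun v hv hF => ?_⟩
  rcases hω.2.2.2 v hv hF with h | h
  · exact h
  · exact absurd h.1.2.2.2 (not_listenRule_probNack hph _)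

/-- If at most half of the probabilistic request phase of a round is disrupted at the sender, and
all receivers have been served, then it finds out in this phase with probability at least
`1 - 1 / n ^ 2`. -/
theorem sender_survives_le (hP : LocalPlan G n P) (hn : 2 ≤ n) (k : ℕ) :
    (drawMeasure V E).real {ω | ω ∈ Unaware G F n C e
        (roundStart n k + (probSendLen (firstRound n + k) + detLen (firstRound n + k)) +
          2 ^ (firstRound n + k)) ∧
      (countTo (fun o => JamAt G F n C e (P.sender e)
        (roundStart n k + (probSendLen (firstRound n + k) + detLen (firstRound n + k)) + o))
        (2 ^ (firstRound n + k)) ω : ℝ) ≤ 2 ^ (firstRound n + k) / 2} ≤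
      1 / n ^ 2 * (drawMeasure V E).real (Serving G F n C e (roundStart n k)) := by
  have hlog := log_gt hn
  set i := firstRound n + k with hi
  have hpow : (2 : ℝ) ^ firstRound n ≤ 2 ^ i := pow_le_pow_right₀ (by norm_num) (by omega)
  have h4 := four_log_le_two_pow hn
  have h2i : (0 : ℝ) < 2 ^ i := by positivity
  set c : ℝ := 4 * Real.log n / 2 ^ i with hc
  have hc0 : 0 ≤ c := by positivity
  have hc1 : c ≤ 1 := by rw [hc, div_le_one h2i]; linarith
  set s := roundStart n k + (probSendLen i + detLen i) with hs
  have hdet := detLen_pos i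
  have hlen : ∀ o < 2 ^ i, probSendLen i + detLen i + o < roundLen i := fun o ho => by
    unfold roundLen; omega
  have hph : ∀ o < 2 ^ i, phaseOf n (s + o) = Phase.probNack := fun o ho => by
    rw [hs, add_assoc]
    exact phaseOf_probNack hi.symm (by omega) (by omega)
  have hro : ∀ o < 2 ^ i, roundOf n (s + o) = i := fun o ho => by
    rw [hs, add_assoc]
    exact roundOf_roundStart_add hi.symm (hlen o ho)
  have hls : ∀ o < 2 ^ i, ¬ LastSlot n (s + o) := fun o ho => by
    rw [hs, add_assoc, lastSlot_roundStart_add hi.symm (hlen o ho)]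
    have : roundLen i = probSendLen i + detLen i + 2 ^ i + detLen i := rfl
    omega
  have key := measure_survive_le (e := e) (s := s) (N := 2 ^ i)
    (A := fun o => Unaware G F n C e (s + o))
    (J := fun o => JamAt G F n C e (P.sender e) (s + o))
    (B := fun o => {ω | ¬ (ω (e, s + o, P.sender e) : ℝ) < c})
    (q := c)
    (fun o => measurableSet_unaware hP _) (fun o => measurableSet_jamAt hP _ _)
    (fun o => (measurableSet_draw_lt (e, s + o, P.sender e) c).compl)
    (fun o => ignores_unaware le_rfl) (fun o o' ho => ignores_jamAt (by omega) _)
    (fun o ω ω' hω => by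
      change (¬ ((ω _ : ℝ) < c)) = (¬ ((ω' _ : ℝ) < c))
      rw [hω])
    (fun o ho => unaware_anti (hph o ho) (hls o ho))
    (fun o ho ω hω hJ hlt => by
      have hw : ω ∈ Unaware G F n C e (s + o) := unaware_anti (hph o ho) (hls o ho) hω
      have hlisten : NackListenRule n (s + o) (ω (e, s + o, P.sender e)) := by
        simp only [NackListenRule, hph o ho, hro o ho]
        exact hlt
      refine hω.2.2.1 ⟨hls o ho, Or.inr ⟨⟨hw.1, hw.2.1, hlisten⟩, ?_, ?_⟩⟩
      · exact fun h => hJ ⟨⟨hw.1, Or.inl ⟨rfl, hw.2.1⟩⟩, h⟩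
      · rintro v ⟨h1, h2, h3, -⟩
        exact h3 (hw.2.2.2 v h1 h2))
    (fun o _ => drawMeasure_not_lt_le _ hc0 hc1) hc0 (2 ^ i / 2)
  -- Half of the `2^i` slots, at listening probability `4 log n / 2^i`, give the exponent `2 log n`.
  have hexp : Real.exp (-(c * (2 ^ i / 2))) = 1 / (n : ℝ) ^ 2 := by
    rw [← exp_neg_mul_log n 2 hn]
    congr 2
    rw [hc]
    field_simp
    norm_num
  rw [hexp] at key
  have h5 := ENNReal.toReal_mono (by finiteness) key
  rw [ENNReal.toReal_mul, ENNReal.toReal_ofReal (by positivity)] at h5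
  refine le_trans (measureReal_mono (fun ω hω => show ω ∈ _ ∧ _ from ⟨hω.1, ?_⟩)) (h5.trans ?_)
  · have h7 := hω.2
    push_cast
    linarith
  · refine mul_le_mul_of_nonneg_left ?_ (by positivity)
    exact measureReal_mono (unaware_subset_serving.trans (serving_anti (by omega)))

theorem clear_mono_of_le {ω : Draws V E} {k o o' : ℕ} (h : o ≤ o')
    (ho' : o' < roundLen (firstRound n + k))
    (hc : (lbState G F n D P C e ω (roundStart n k + o)).clear) :
    (lbState G F n D P C e ω (roundStart n k + o')).clear := by
  induction h with
  | refl => exact hc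
  | @step o' _ ih =>
    have hl : ¬ LastSlot n (roundStart n k + o') := by
      rw [lastSlot_roundStart_add rfl (by omega)]
      omega
    exact ⟨hl, Or.inl (ih (by omega))⟩

/-- A sender still active after a round has not served all receivers in the send phases, or has
not found out that it has. -/
theorem serving_subset (k : ℕ) : Serving G F n C e (roundStart n (k + 1)) ⊆
    (⋃ v ∈ P.receivers e,
      Waiting G F n C e v (roundStart n k + probSendLen (firstRound n + k))) ∪
    Unaware G F n C e (roundStart n k +
      (probSendLen (firstRound n + k) + detLen (firstRound n + k)) + 2 ^ (firstRound n + k)) := by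
  intro ω hω
  set i := firstRound n + k with hi
  have hdet := detLen_pos i
  have h2 := Nat.two_pow_pos i
  have hR : roundLen i = probSendLen i + detLen i + 2 ^ i + detLen i := rfl
  have hsucc : roundStart n (k + 1) = roundStart n k + roundLen i := roundStart_succ n k
  by_cases hw : ω ∈ ⋃ v ∈ P.receivers e, Waiting G F n C e v (roundStart n k + probSendLen i)
  · exact Or.inl hw
  refine Or.inr ⟨hω.1, (serving_anti (by omega) hω).2, fun hc => ?_, fun v hv hF => ?_⟩
  -- Silence heard in the round is remembered up to its last slot, where it would have made the
  -- sender stop.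
  · rw [add_assoc] at hc
    have hlt : roundLen i - 1 < roundLen i := by omega
    have h1 := clear_mono_of_le (o' := roundLen i - 1) (by omega) hlt hc
    refine hω.2 ?_
    have h2 : roundStart n (k + 1) = (roundStart n k + (roundLen i - 1)) + 1 := by omega
    rw [h2]
    refine Or.inr ⟨(lastSlot_roundStart_add hi.symm hlt).2 (by omega), Or.inl h1⟩
  · have h1 : v ∈ (lbState G F n D P C e ω (roundStart n k + probSendLen i)).got := by
      by_contra hg
      exact hw (Set.mem_biUnion hv ⟨hv, hF, hg⟩)
    exact got_mono (by omega) h1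

end Events

/-! ### Sums over slots and rounds -/

theorem sum_range_roundStart {α : Type*} [AddCommMonoid α] (n K : ℕ) (f : ℕ → α) :
    ∑ j ∈ Finset.range (roundStart n K), f j =
      ∑ k ∈ Finset.range K, ∑ o ∈ Finset.range (roundLen (firstRound n + k)),
        f (roundStart n k + o) := by
  induction K with
  | zero => simp [roundStart]
  | succ K ih => rw [roundStart_succ, Finset.sum_range_add, Finset.sum_range_succ, ih]

/-- The rounds `0, …, K - 1` are those that start within the first `D` slots. -/
theorem exists_rounds_cover (n D : ℕ) : ∃ K, D ≤ roundStart n K ∧ ∀ k < K, roundStart n k < D := by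
  classical
  have hex : ∃ K, D ≤ roundStart n K := ⟨D, (roundStart_strictMono n).id_le D⟩
  exact ⟨Nat.find hex, Nat.find_spec hex, fun k hk => not_le.1 (Nat.find_min hex hk)⟩

theorem probSendLen_le_roundLen (i : ℕ) : probSendLen i ≤ roundLen i := by
  have := Nat.two_pow_pos i
  unfold roundLen
  omega

/-- The weights double while the recursion divides by 8, so the sum `s` satisfies `s ≤ x 0 + 2 b + s
/ 4`, with `b` the weighted sum of the perturbations. -/
theorem sum_two_pow_mul_le {x b : ℕ → ℝ} (hx0 : ∀ k, 0 ≤ x k) (hb0 : ∀ k, 0 ≤ b k)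
    (hx : x 0 ≤ 1) {K : ℕ} (hstep : ∀ k, k + 1 < K → x (k + 1) ≤ b k + x k / 8) :
    ∑ k ∈ Finset.range K, 2 ^ k * x k ≤ 2 + 4 * ∑ k ∈ Finset.range (K - 1), 2 ^ k * b k := by
  rcases K with _ | K
  · simp
  have h1 : ∑ k ∈ Finset.range K, (2 : ℝ) ^ k * x k ≤
      ∑ k ∈ Finset.range (K + 1), (2 : ℝ) ^ k * x k := by
    rw [Finset.sum_range_succ]
    have := hx0 K
    have : (0 : ℝ) ≤ 2 ^ K * x K := by positivity
    linarith
  have h2 : ∑ k ∈ Finset.range (K + 1), (2 : ℝ) ^ k * x k ≤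
      x 0 + 2 * ∑ k ∈ Finset.range K, 2 ^ k * b k +
        (1 / 4) * ∑ k ∈ Finset.range K, 2 ^ k * x k := by
    rw [Finset.sum_range_succ', Finset.mul_sum, Finset.mul_sum, add_assoc,
      ← Finset.sum_add_distrib, pow_zero, one_mul, add_comm]
    refine add_le_add le_rfl (Finset.sum_le_sum fun k hk => ?_)
    have h3 := hstep k (by have := Finset.mem_range.1 hk; omega)
    have h4 : (0 : ℝ) < 2 ^ k := by positivity
    rw [pow_succ]
    nlinarith
  have h5 : 0 ≤ ∑ k ∈ Finset.range K, (2 : ℝ) ^ k * b k :=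
    Finset.sum_nonneg fun k _ => mul_nonneg (by positivity) (hb0 k)
  rw [Nat.add_sub_cancel]
  linarith

/-- Up to `k₁` the weights form a geometric sum; from then on the terms decay by the factor `rho / 2
< 4/5`. -/
theorem sum_rho_pow_mul_le {x : ℕ → ℝ} (hx0 : ∀ k, 0 ≤ x k) (hx1 : ∀ k, x k ≤ 1) {K k₁ : ℕ}
    (hstep : ∀ k, k₁ ≤ k → k + 1 < K → x (k + 1) ≤ x k / 2) :
    ∑ k ∈ Finset.range K, rho ^ k * x k ≤ 8 * rho ^ k₁ := by
  have hρ := rho_pos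
  have hρ1 := rho_gt
  have hρ2 := rho_lt
  have hhead : ∀ L ≤ k₁ + 1, ∑ k ∈ Finset.range L, rho ^ k * x k ≤ 4 * rho ^ k₁ := by
    intro L hL
    have h1 : ∑ k ∈ Finset.range L, rho ^ k * x k ≤ ∑ k ∈ Finset.range (k₁ + 1), rho ^ k :=
      (Finset.sum_le_sum fun k _ => mul_le_of_le_one_right (by positivity) (hx1 k)).trans
        (Finset.sum_le_sum_of_subset_of_nonneg (Finset.range_mono hL)
          fun k _ _ => by positivity)
    have h2 := geom_sum_mul rho (k₁ + 1)
    rw [pow_succ] at h2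
    have h3 : 0 < rho ^ k₁ := by positivity
    have h4 : 0 ≤ ∑ k ∈ Finset.range (k₁ + 1), rho ^ k :=
      Finset.sum_nonneg fun k _ => by positivity
    nlinarith
  rcases le_or_gt K (k₁ + 1) with hK | hK
  · have := hhead K hK
    have : 0 < rho ^ k₁ := by positivity
    linarith
  -- Four times the last term reserves room for the rest of a series of ratio `4/5`, since `4 =
  -- (4/5) / (1 - 4/5)`.
  have htail : ∀ d, k₁ + 1 + d ≤ K → ∑ k ∈ Finset.range (k₁ + 1 + d), rho ^ k * x k +
      4 * (rho ^ (k₁ + d) * x (k₁ + d)) ≤ 8 * rho ^ k₁ := by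
    intro d
    induction d with
    | zero =>
      intro _
      have h1 := hhead (k₁ + 1) le_rfl
      have h2 : rho ^ k₁ * x k₁ ≤ rho ^ k₁ := mul_le_of_le_one_right (by positivity) (hx1 _)
      simp only [add_zero]
      linarith
    | succ d ih =>
      intro hd
      have h1 := ih (by omega)
      have h2 := hstep (k₁ + d) (by omega) (by omega)
      have h3 : rho ^ (k₁ + d + 1) * x (k₁ + d + 1) ≤ 4 / 5 * (rho ^ (k₁ + d) * x (k₁ + d)) := by
        have h4 : 0 ≤ rho ^ (k₁ + d) := by positivity
        have h5 : rho * x (k₁ + d + 1) ≤ 4 / 5 * x (k₁ + d) := by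
          have := hx0 (k₁ + d); have := hx0 (k₁ + d + 1)
          nlinarith
        rw [pow_succ]
        nlinarith
      rw [← add_assoc, Finset.sum_range_succ, show k₁ + 1 + d = k₁ + d + 1 by omega,
        ← add_assoc k₁ d 1]
      rw [show k₁ + 1 + d = k₁ + d + 1 by omega] at h1
      linarith
  have h := htail (K - (k₁ + 1)) (by omega)
  rw [show k₁ + 1 + (K - (k₁ + 1)) = K by omega] at h
  have h2 : 0 ≤ rho ^ (k₁ + (K - (k₁ + 1))) * x (k₁ + (K - (k₁ + 1))) :=
    mul_nonneg (by positivity) (hx0 _)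
  linarith

/-- A pointwise bound on a weighted sum of indicators bounds the weighted sum of the
probabilities. -/
theorem sum_mul_measureReal_le {Ω ι : Type*} [MeasurableSpace Ω] {μ : Measure Ω}
    [IsProbabilityMeasure μ] {T : Finset ι} {c : ι → ℝ} {B : ι → Set Ω}
    (hB : ∀ x, MeasurableSet (B x)) {b : ℝ}
    (h : ∀ ω, ∑ x ∈ T, c x * (B x).indicator 1 ω ≤ b) : ∑ x ∈ T, c x * μ.real (B x) ≤ b := by
  have hint : ∀ x ∈ T, Integrable (fun ω => c x * (B x).indicator (1 : Ω → ℝ) ω) μ := fun x _ =>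
    ((integrable_const (1 : ℝ)).indicator (hB x)).const_mul _
  have h1 : ∑ x ∈ T, c x * μ.real (B x) = ∫ ω, ∑ x ∈ T, c x * (B x).indicator 1 ω ∂μ := by
    rw [integral_finsetSum _ hint]
    refine Finset.sum_congr rfl fun x _ => ?_
    rw [integral_const_mul, integral_indicator_one (hB x)]
  rw [h1]
  have h2 := integral_mono (integrable_finsetSum T hint) (integrable_const b) h
  simpa using h2

/-! ### Expected cost of receivers, amortized over the executions of one node. -/

section Cost

variable {V E M : Type*} {G : SimpleGraph V} {F : Set V} {n D : ℕ} {P : Plan V E M}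
  {C : Carol V E M P.window D} {e : E} {S L : ℝ≥0}

theorem countTo_eq_sum {J : ℕ → Set (Draws V E)} {N : ℕ} {ω : Draws V E}
    [∀ o, Decidable (ω ∈ J o)] :
    countTo J N ω = ∑ o ∈ Finset.range N, if ω ∈ J o then 1 else 0 := by
  rw [countTo, Finset.card_filter]
  exact Finset.sum_congr rfl fun o _ => by congr

/-! #### The cost of a receiver -/

open Classical in
/-- The cost of the receiver `p` in the execution `e`. -/
def receiverCost (G : SimpleGraph V) (F : Set V) (n : ℕ) (C : Carol V E M P.window D) (S L : ℝ≥0)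
    (e : E) (p : V) (ω : Draws V E) : ℝ≥0∞ :=
  ∑ j ∈ Finset.range D,
    ((if Requests F n P (lbState G F n D P C e ω j) e j p then (S : ℝ≥0∞) else 0) +
     (if TunedIn F n P (lbState G F n D P C e ω j) e j ω p then (L : ℝ≥0∞) else 0))

theorem measurableSet_requests (hP : LocalPlan G n P) (j : ℕ) (p : V) :
    MeasurableSet {ω | Requests F n P (lbState G F n D P C e ω j) e j p} :=
  measurableSet_setOfPred.2 ((measurableState hP j).requests p)

theorem measurableSet_tunedIn (hP : LocalPlan G n P) (j : ℕ) (p : V) :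
    MeasurableSet {ω | TunedIn F n P (lbState G F n D P C e ω j) e j ω p} :=
  measurableSet_setOfPred.2 ((measurableState hP j).tunedIn p)

theorem measurableSet_broadcasts (hP : LocalPlan G n P) (j : ℕ) :
    MeasurableSet {ω | Broadcasts F n D P C (lbState G F n D P C e ω j) e j ω} :=
  measurableSet_setOfPred.2 (measurableState hP j).broadcasts

theorem measurableSet_awaits (hP : LocalPlan G n P) (j : ℕ) :
    MeasurableSet {ω | Awaits F n P (lbState G F n D P C e ω j) e j ω} :=
  measurableSet_setOfPred.2 (measurableState hP j).awaits

open Classical in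
theorem lintegral_ite_const {A : Set (Draws V E)} (hA : MeasurableSet A) (c : ℝ≥0) :
    ∫⁻ ω, (if ω ∈ A then (c : ℝ≥0∞) else 0) ∂(drawMeasure V E) =
      ENNReal.ofReal (c * (drawMeasure V E).real A) := by
  have h : (fun ω => if ω ∈ A then (c : ℝ≥0∞) else 0) = A.indicator fun _ => (c : ℝ≥0∞) := by
    funext ω
    rw [Set.indicator_apply]
  rw [h, lintegral_indicator_const hA, ENNReal.ofReal_mul c.coe_nonneg, ofReal_measureReal,
    ENNReal.ofReal_coe_nnreal]

open Classical in
theorem measurable_ite_const {A : Set (Draws V E)} (hA : MeasurableSet A) (c : ℝ≥0) :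
    Measurable fun ω => if ω ∈ A then (c : ℝ≥0∞) else 0 :=
  Measurable.ite hA measurable_const measurable_const

open Classical in
theorem lintegral_sum_ite {A B : ℕ → Set (Draws V E)} (hA : ∀ j, MeasurableSet (A j))
    (hB : ∀ j, MeasurableSet (B j)) (D : ℕ) (a b : ℝ≥0) :
    ∫⁻ ω, ∑ j ∈ Finset.range D, ((if ω ∈ A j then (a : ℝ≥0∞) else 0) +
      (if ω ∈ B j then (b : ℝ≥0∞) else 0)) ∂(drawMeasure V E) =
    ENNReal.ofReal (∑ j ∈ Finset.range D,
      (a * (drawMeasure V E).real (A j) + b * (drawMeasure V E).real (B j))) := by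
  have hm : ∀ j, Measurable fun ω => (if ω ∈ A j then (a : ℝ≥0∞) else 0) +
      (if ω ∈ B j then (b : ℝ≥0∞) else 0) := fun j =>
    (measurable_ite_const (hA j) a).add (measurable_ite_const (hB j) b)
  rw [lintegral_finsetSum _ fun j _ => hm j,
    ENNReal.ofReal_sum_of_nonneg fun j _ => by positivity]
  refine Finset.sum_congr rfl fun j _ => ?_
  rw [lintegral_add_left (measurable_ite_const (hA j) a), lintegral_ite_const (hA j),
    lintegral_ite_const (hB j), ENNReal.ofReal_add (by positivity) (by positivity)]

theorem measurable_receiverCost (hP : LocalPlan G n P) (p : V) :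
    Measurable (receiverCost G F n C S L e p) :=
  Finset.measurable_sum _ fun j _ =>
    (measurable_ite_const (measurableSet_requests hP j p) S).add
      (measurable_ite_const (measurableSet_tunedIn hP j p) L)

theorem measureReal_waiting_inter_lt (hP : LocalPlan G n P) {p : V} {j : ℕ} {b : ℝ} (h0 : 0 ≤ b)
    (h1 : b ≤ 1) : (drawMeasure V E).real (Waiting G F n C e p j ∩ {ω | (ω (e, j, p) : ℝ) < b}) =
      (drawMeasure V E).real (Waiting G F n C e p j) * b := by
  rw [Measure.real, measure_inter_of_ignores (e := e) (j := j) (measurableSet_waiting hP p j)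
    (measurableSet_draw_lt (e, j, p) b) (ignores_waiting le_rfl p)
    (fun ω ω' hω => by
      change ((ω _ : ℝ) < b) = ((ω' _ : ℝ) < b)
      rw [hω]), drawMeasure_lt _ h0 h1, ENNReal.toReal_mul, ENNReal.toReal_ofReal h0]
  rfl

theorem measureReal_serving_inter_lt (hP : LocalPlan G n P) {j : ℕ} {b : ℝ} (h0 : 0 ≤ b)
    (h1 : b ≤ 1) :
    (drawMeasure V E).real (Serving G F n C e j ∩ {ω | (ω (e, j, P.sender e) : ℝ) < b}) =
      (drawMeasure V E).real (Serving G F n C e j) * b := by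
  rw [Measure.real, measure_inter_of_ignores (e := e) (j := j) (measurableSet_serving hP j)
    (measurableSet_draw_lt (e, j, P.sender e) b) (ignores_serving le_rfl)
    (fun ω ω' hω => by
      change ((ω _ : ℝ) < b) = ((ω' _ : ℝ) < b)
      rw [hω]), drawMeasure_lt _ h0 h1, ENNReal.toReal_mul, ENNReal.toReal_ofReal h0]
  rfl

/-- The expected cost of a receiver in one slot. -/
def receiverSlotCost (G : SimpleGraph V) (F : Set V) (n : ℕ) (C : Carol V E M P.window D)
    (S L : ℝ≥0) (e : E) (p : V) (j : ℕ) : ℝ :=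
  S * (drawMeasure V E).real {ω | Requests F n P (lbState G F n D P C e ω j) e j p} +
    L * (drawMeasure V E).real {ω | TunedIn F n P (lbState G F n D P C e ω j) e j ω p}

theorem receiverSlotCost_nonneg {p : V} {j : ℕ} : 0 ≤ receiverSlotCost G F n C S L e p j := by
  unfold receiverSlotCost; positivity

theorem lintegral_receiverCost (hP : LocalPlan G n P) (p : V) :
    ∫⁻ ω, receiverCost G F n C S L e p ω ∂(drawMeasure V E) =
      ENNReal.ofReal (∑ j ∈ Finset.range D, receiverSlotCost G F n C S L e p j) :=
  lintegral_sum_ite (fun j => measurableSet_requests hP j p)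
    (fun j => measurableSet_tunedIn hP j p) D S L

theorem receiverSlotCost_le_probSend (hP : LocalPlan G n P) (hn : 2 ≤ n) {p : V} {k o : ℕ}
    (ho : o < probSendLen (firstRound n + k)) :
    receiverSlotCost G F n C S L e p (roundStart n k + o) ≤
      (S + L) * (drawMeasure V E).real (Waiting G F n C e p (roundStart n k)) *
        (2 / rho ^ (firstRound n + k)) := by
  have hlen : o < roundLen (firstRound n + k) := by
    have := Nat.two_pow_pos (firstRound n + k)
    unfold roundLen; omega
  have hph := phaseOf_probSend (n := n) rfl ho
  have hro := roundOf_roundStart_add (n := n) rfl hlen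
  have hρ := rho_pow_ge_two (i := firstRound n + k) (by have := two_le_firstRound hn; omega)
  have h1 : {ω | Requests F n P (lbState G F n D P C e ω (roundStart n k + o)) e
      (roundStart n k + o) p} = ∅ := by
    refine Set.eq_empty_of_forall_notMem fun ω hω => ?_
    have h := hω.2.2.2
    unfold ReqRule at h
    rw [hph] at h
    exact h
  have h2 : {ω | TunedIn F n P (lbState G F n D P C e ω (roundStart n k + o)) e
      (roundStart n k + o) ω p} ⊆ Waiting G F n C e p (roundStart n k + o) ∩
        {ω | (ω (e, roundStart n k + o, p) : ℝ) < 2 / rho ^ (firstRound n + k)} := by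
    rintro ω ⟨h1, h2, h3, h4⟩
    refine ⟨⟨h1, h2, h3⟩, ?_⟩
    simp only [ListenRule, hph, hro, two_rpow_sub_one_mul] at h4
    exact h4
  have h3 := measureReal_mono (μ := drawMeasure V E) h2
  rw [measureReal_waiting_inter_lt hP (by positivity)
    (by rw [div_le_one (by linarith)]; linarith)] at h3
  have h4 := measureReal_mono (μ := drawMeasure V E) (waiting_anti (G := G) (F := F) (n := n)
    (C := C) (e := e) (v := p) (show roundStart n k ≤ roundStart n k + o by omega))
  unfold receiverSlotCost
  rw [h1, measureReal_empty, mul_zero, zero_add, mul_assoc]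
  refine mul_le_mul (by simp) (h3.trans (mul_le_mul_of_nonneg_right h4 (by positivity)))
    measureReal_nonneg (by positivity)

theorem receiverSlotCost_le {p : V} {j s : ℕ} (h : s ≤ j) :
    receiverSlotCost G F n C S L e p j ≤
      (S + L) * (drawMeasure V E).real (Waiting G F n C e p s) := by
  have h1 : {ω | Requests F n P (lbState G F n D P C e ω j) e j p} ⊆ Waiting G F n C e p s :=
    fun ω hω => waiting_anti h ⟨hω.1, hω.2.1, hω.2.2.1⟩
  have h2 : {ω | TunedIn F n P (lbState G F n D P C e ω j) e j ω p} ⊆ Waiting G F n C e p s :=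
    fun ω hω => waiting_anti h ⟨hω.1, hω.2.1, hω.2.2.1⟩
  unfold receiverSlotCost
  rw [add_mul]
  exact add_le_add (mul_le_mul_of_nonneg_left (measureReal_mono h1) S.2)
    (mul_le_mul_of_nonneg_left (measureReal_mono h2) L.2)

/-- In the long phase about `2^i * rho^i` slots are listened to with probability `2 / rho^i`, which
gives `O(2^i)`; the other phases have only `O(2^i)` slots altogether. -/
theorem sum_receiverSlotCost_round_le (hP : LocalPlan G n P) (hn : 2 ≤ n) {p : V} (k : ℕ) :
    ∑ o ∈ Finset.range (roundLen (firstRound n + k)),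
      receiverSlotCost G F n C S L e p (roundStart n k + o) ≤
    9 * (S + L) * (2 ^ (firstRound n + k) *
      (drawMeasure V E).real (Waiting G F n C e p (roundStart n k))) := by
  set w := (drawMeasure V E).real (Waiting G F n C e p (roundStart n k)) with hw
  have hR : roundLen (firstRound n + k) = probSendLen (firstRound n + k) +
    (detLen (firstRound n + k) + 2 ^ (firstRound n + k) + detLen (firstRound n + k)) := by
    unfold roundLen; omega
  have hw0 : 0 ≤ w := measureReal_nonneg
  rw [hR, Finset.sum_range_add]
  have h1 := Finset.sum_le_card_nsmul (Finset.range (probSendLen (firstRound n + k)))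
    (fun o => receiverSlotCost G F n C S L e p (roundStart n k + o)) _
    fun o ho => receiverSlotCost_le_probSend hP hn (Finset.mem_range.1 ho)
  have h2 := Finset.sum_le_card_nsmul (Finset.range (detLen (firstRound n + k) +
      2 ^ (firstRound n + k) + detLen (firstRound n + k)))
    (fun o => receiverSlotCost G F n C S L e p
      (roundStart n k + (probSendLen (firstRound n + k) + o))) _
    fun o _ => receiverSlotCost_le (s := roundStart n k) (by omega)
  rw [Finset.card_range, nsmul_eq_mul] at h1 h2
  refine (add_le_add h1 h2).trans ?_
  have hi : 2 ≤ firstRound n + k := by have := two_le_firstRound hn; omega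
  generalize firstRound n + k = i at hi
  have h3 := probSendLen_le i
  have h4 := detLen_le i
  have h5 := rho_pow_le_two_pow i
  have h6 := rho_pow_ge_two hi
  have h7 := four_le_two_pow hi
  have h8 : (probSendLen i : ℝ) * (2 / rho ^ i) ≤ 3 * 2 ^ i := by
    rw [mul_div_assoc', div_le_iff₀ (by linarith)]
    nlinarith
  have h9 : (0 : ℝ) ≤ (S + L) * w := by positivity
  push_cast
  have h10 : (detLen i : ℝ) + 2 ^ i + detLen i ≤ 6 * 2 ^ i := by linarith
  calc (probSendLen i : ℝ) * ((S + L) * w * (2 / rho ^ i)) +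
        ((detLen i : ℝ) + 2 ^ i + detLen i) * ((S + L) * w)
      = (probSendLen i * (2 / rho ^ i) + ((detLen i : ℝ) + 2 ^ i + detLen i)) * ((S + L) * w) := by
        ring
    _ ≤ (9 * 2 ^ i) * ((S + L) * w) := mul_le_mul_of_nonneg_right (by linarith) h9
    _ = _ := by ring

/-- Heavy jamming: more than half of the probabilistic send phase of round `k` is disrupted at the
receiver `p`, which remains without the message. -/
def HeavyJam (G : SimpleGraph V) (F : Set V) (n : ℕ) (C : Carol V E M P.window D) (e : E) (p : V)
    (k : ℕ) : Set (Draws V E) :=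
  {ω | ω ∈ Waiting G F n C e p (roundStart n k + probSendLen (firstRound n + k)) ∧
    2 ^ (firstRound n + k) * rho ^ (firstRound n + k) / 2 <
      (countTo (fun o => JamAt G F n C e p (roundStart n k + o))
        (probSendLen (firstRound n + k)) ω : ℝ)}

theorem measurableSet_heavyJam (hP : LocalPlan G n P) (p : V) (k : ℕ) :
    MeasurableSet (HeavyJam G F n C e p k) := by
  refine (measurableSet_waiting hP p _).inter ?_
  have h : Measurable fun ω => ((countTo (fun o => JamAt G F n C e p (roundStart n k + o))
      (probSendLen (firstRound n + k)) ω : ℕ) : ℝ) :=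
    measurable_from_top.comp (measurable_countTo (fun o => measurableSet_jamAt hP p _) _)
  exact measurableSet_lt measurable_const h

/-- A receiver still waiting was either jammed heavily or unlucky, the latter with conditional
weight `n⁻³ ≤ 1/8`. -/
theorem measureReal_waiting_succ_le (hP : LocalPlan G n P) (hn : 2 ≤ n) (p : V) (k : ℕ) :
    (drawMeasure V E).real (Waiting G F n C e p (roundStart n (k + 1))) ≤
      (drawMeasure V E).real (HeavyJam G F n C e p k) +
        (drawMeasure V E).real (Waiting G F n C e p (roundStart n k)) / 8 := by
  have h1 := receiver_survives_le (G := G) (F := F) (C := C) (e := e) hP hn p k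
  have h2 : (1 : ℝ) / n ^ 3 ≤ 1 / 8 := by
    refine one_div_le_one_div_of_le (by norm_num) ?_
    have h3 : (2 : ℝ) ≤ n := by exact_mod_cast hn
    have h4 := pow_le_pow_left₀ (by norm_num) h3 3
    linarith
  have h3 : 0 ≤ (drawMeasure V E).real (Waiting G F n C e p (roundStart n k)) :=
    measureReal_nonneg
  refine le_trans (measureReal_mono (fun ω hω => ?_)) ((measureReal_union_le
    (HeavyJam G F n C e p k) {ω | ω ∈ Waiting G F n C e p
        (roundStart n k + probSendLen (firstRound n + k)) ∧
      (countTo (fun o => JamAt G F n C e p (roundStart n k + o))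
        (probSendLen (firstRound n + k)) ω : ℝ) ≤
          2 ^ (firstRound n + k) * rho ^ (firstRound n + k) / 2}).trans (add_le_add le_rfl ?_))
  · have hw : ω ∈ Waiting G F n C e p (roundStart n k + probSendLen (firstRound n + k)) := by
      refine waiting_anti ?_ hω
      rw [roundStart_succ]
      exact Nat.add_le_add_left (probSendLen_le_roundLen _) _
    rcases lt_or_ge (2 ^ (firstRound n + k) * rho ^ (firstRound n + k) / 2)
      (countTo (fun o => JamAt G F n C e p (roundStart n k + o))
        (probSendLen (firstRound n + k)) ω : ℝ) with h | h
    · exact Or.inl ⟨hw, h⟩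
    · exact Or.inr ⟨hw, h⟩
  · exact h1.trans (by nlinarith)

theorem sum_receiverSlotCost_le (hP : LocalPlan G n P) (hn : 2 ≤ n) (p : V) {K : ℕ}
    (hK : D ≤ roundStart n K) :
    ∑ j ∈ Finset.range D, receiverSlotCost G F n C S L e p j ≤
      9 * (S + L) * (16 * Real.log n + 4 * ∑ k ∈ Finset.range (K - 1),
        2 ^ (firstRound n + k) * (drawMeasure V E).real (HeavyJam G F n C e p k)) := by
  have h1 : ∑ j ∈ Finset.range D, receiverSlotCost G F n C S L e p j ≤
      ∑ j ∈ Finset.range (roundStart n K), receiverSlotCost G F n C S L e p j :=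
    Finset.sum_le_sum_of_subset_of_nonneg (Finset.range_mono hK)
      fun _ _ _ => receiverSlotCost_nonneg
  refine h1.trans ?_
  rw [sum_range_roundStart]
  refine (Finset.sum_le_sum fun k _ => sum_receiverSlotCost_round_le hP hn k).trans ?_
  rw [← Finset.mul_sum]
  refine mul_le_mul_of_nonneg_left ?_ (by positivity)
  have h2 := sum_two_pow_mul_le
    (x := fun k => (drawMeasure V E).real (Waiting G F n C e p (roundStart n k)))
    (b := fun k => (drawMeasure V E).real (HeavyJam G F n C e p k))
    (fun _ => measureReal_nonneg) (fun _ => measureReal_nonneg) measureReal_le_one (K := K)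
    (fun k _ => measureReal_waiting_succ_le hP hn p k)
  have h3 := two_pow_firstRound_le hn
  have h4 : (0 : ℝ) < 2 ^ firstRound n := by positivity
  simp only [pow_add, mul_assoc]
  rw [← Finset.mul_sum, ← Finset.mul_sum]
  have h5 := mul_le_mul_of_nonneg_left h2 h4.le
  linarith

/-- A receiver can be jammed heavily for long in few executions only. -/
theorem sum_heavyJam_le {β : ℕ} (hP : LocalPlan G n P) (hb : JamBounded G F n D P C β) {p : V}
    (hp : p ∉ F) (A : Finset E) {K : ℕ} (hK : roundStart n (K - 1) ≤ D) (I : ℕ) :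
    ∑ e ∈ A, ∑ k ∈ Finset.range (K - 1),
      2 ^ (firstRound n + k) * (drawMeasure V E).real (HeavyJam G F n C e p k) ≤
    A.card * 2 ^ I + 2 * β / rho ^ I := by
  classical
  have hρ := rho_pos
  rw [← Finset.sum_product' A (Finset.range (K - 1)) (f := fun e k =>
    2 ^ (firstRound n + k) * (drawMeasure V E).real (HeavyJam G F n C e p k))]
  refine sum_mul_measureReal_le (B := fun x : E × ℕ => HeavyJam G F n C x.1 p x.2)
    (fun x => measurableSet_heavyJam hP p x.2) fun ω => ?_
  rw [Finset.sum_product]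
  set cnt : E → ℕ → ℕ := fun e k => countTo (fun o => JamAt G F n C e p (roundStart n k + o))
    (probSendLen (firstRound n + k)) ω with hcnt
  -- Rounds before `I` are paid for outright. In a later one heavy jamming uses more than `2^i *
  -- rho^i / 2` disruptions, so a cost of `2^i` amounts to at most `2 / rho^I` per disruption.
  have hterm : ∀ e k, (2 : ℝ) ^ (firstRound n + k) * (HeavyJam G F n C e p k).indicator 1 ω ≤
      (if firstRound n + k < I then 2 ^ (firstRound n + k) else 0) +
        2 / rho ^ I * cnt e k := by
    intro e k
    have h0 : (0 : ℝ) ≤ 2 / rho ^ I * cnt e k := by positivity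
    have h00 : (0 : ℝ) < 2 ^ (firstRound n + k) := by positivity
    by_cases hω : ω ∈ HeavyJam G F n C e p k
    · rw [Set.indicator_of_mem hω, Pi.one_apply, mul_one]
      split_ifs with hI
      · linarith
      · rw [zero_add, div_mul_eq_mul_div, le_div_iff₀ (by positivity)]
        have h1 : 2 ^ (firstRound n + k) * rho ^ (firstRound n + k) / 2 < (cnt e k : ℝ) := hω.2
        have h2 : rho ^ I ≤ rho ^ (firstRound n + k) :=
          pow_le_pow_right₀ (by linarith [rho_gt]) (by omega)
        have h3 := mul_le_mul_of_nonneg_left h2 h00.le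
        linarith
    · rw [Set.indicator_of_notMem hω, mul_zero]
      split_ifs <;> linarith
  have hgeom : ∑ k ∈ Finset.range (K - 1),
      (if firstRound n + k < I then (2 : ℝ) ^ (firstRound n + k) else 0) ≤ 2 ^ I := by
    rw [← Finset.sum_filter]
    have h1 : ∑ k ∈ (Finset.range (K - 1)).filter (fun k => firstRound n + k < I),
        (2 : ℝ) ^ (firstRound n + k) ≤ ∑ i ∈ Finset.range I, (2 : ℝ) ^ i := by
      rw [← Finset.sum_image (f := fun i => (2 : ℝ) ^ i) (g := fun k => firstRound n + k)
        (fun a _ b _ h => by simpa using h)]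
      refine Finset.sum_le_sum_of_subset_of_nonneg (fun i hi => ?_) fun _ _ _ => by positivity
      obtain ⟨k, hk, rfl⟩ := Finset.mem_image.1 hi
      exact Finset.mem_range.2 (Finset.mem_filter.1 hk).2
    have h2 := geom_sum_mul (2 : ℝ) I
    linarith
  -- Round `K - 1` may be cut off by the window, but the rounds before it lie inside, so their
  -- disruptions are charged to the budget.
  have hcount : ∀ e, ∑ k ∈ Finset.range (K - 1), cnt e k ≤
      ∑ j ∈ Finset.range D, if ω ∈ JamAt G F n C e p j then 1 else 0 := by
    intro e
    refine le_trans ?_ (Finset.sum_le_sum_of_subset (Finset.range_mono hK))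
    rw [sum_range_roundStart]
    refine Finset.sum_le_sum fun k _ => ?_
    rw [hcnt]
    dsimp only
    rw [countTo_eq_sum]
    refine Finset.sum_le_sum_of_subset (Finset.range_mono (probSendLen_le_roundLen _))
  have htotal : ∑ e ∈ A, ∑ k ∈ Finset.range (K - 1), cnt e k ≤ β := by
    refine (Finset.sum_le_sum fun e _ => hcount e).trans ?_
    have h1 : ((∑ e ∈ A, ∑ j ∈ Finset.range D,
        if ω ∈ JamAt G F n C e p j then 1 else 0 : ℕ) : ℝ≥0∞) ≤
        disruptedSlots G F n D P C ω p := by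
      unfold disruptedSlots
      refine le_trans ?_ (ENNReal.sum_le_tsum A)
      push_cast
      refine Finset.sum_le_sum fun e _ => Finset.sum_le_sum fun j _ => ?_
      exact le_of_eq (if_congr Iff.rfl rfl rfl)
    have h2 := h1.trans (hb ω p hp)
    exact_mod_cast h2
  calc ∑ e ∈ A, ∑ k ∈ Finset.range (K - 1),
        (2 : ℝ) ^ (firstRound n + k) * (HeavyJam G F n C e p k).indicator 1 ω
      ≤ ∑ e ∈ A, ∑ k ∈ Finset.range (K - 1),
        ((if firstRound n + k < I then 2 ^ (firstRound n + k) else 0) +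
        2 / rho ^ I * cnt e k) :=
        Finset.sum_le_sum fun e _ => Finset.sum_le_sum fun k _ => hterm e k
    _ = ∑ e ∈ A, ((∑ k ∈ Finset.range (K - 1),
        (if firstRound n + k < I then (2 : ℝ) ^ (firstRound n + k) else 0)) +
          2 / rho ^ I * ((∑ k ∈ Finset.range (K - 1), cnt e k : ℕ) : ℝ)) := by
        refine Finset.sum_congr rfl fun e _ => ?_
        rw [Finset.sum_add_distrib, ← Finset.mul_sum]
        push_cast
        rfl
    _ ≤ ∑ e ∈ A, (2 ^ I + 2 / rho ^ I * ((∑ k ∈ Finset.range (K - 1), cnt e k : ℕ) : ℝ)) :=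
        Finset.sum_le_sum fun e _ => add_le_add hgeom le_rfl
    _ = A.card * 2 ^ I + 2 / rho ^ I *
        ((∑ e ∈ A, ∑ k ∈ Finset.range (K - 1), cnt e k : ℕ) : ℝ) := by
        rw [Finset.sum_add_distrib, Finset.sum_const, nsmul_eq_mul, ← Finset.mul_sum]
        push_cast
        rfl
    _ ≤ A.card * 2 ^ I + 2 / rho ^ I * β := by
        refine add_le_add le_rfl (mul_le_mul_of_nonneg_left ?_ (by positivity))
        exact_mod_cast htotal
    _ = _ := by ring

theorem sum_lintegral_receiverCost_le {β : ℕ} (hP : LocalPlan G n P) (hn : 2 ≤ n)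
    (hb : JamBounded G F n D P C β) {p : V} (hp : p ∉ F) (A : Finset E) (I : ℕ) :
    ∑ e ∈ A, ∫⁻ ω, receiverCost G F n C S L e p ω ∂(drawMeasure V E) ≤
      ENNReal.ofReal (9 * (S + L) *
        (A.card * (16 * Real.log n + 4 * 2 ^ I) + 8 * β / rho ^ I)) := by
  obtain ⟨K, hK, hK'⟩ := exists_rounds_cover n D
  have hK1 : roundStart n (K - 1) ≤ D := by
    rcases K with _ | K
    · simp [roundStart]
    · exact (hK' K (by omega)).le
  simp only [lintegral_receiverCost hP]
  rw [← ENNReal.ofReal_sum_of_nonneg fun e _ => Finset.sum_nonneg fun j _ =>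
    receiverSlotCost_nonneg]
  refine ENNReal.ofReal_le_ofReal ?_
  refine (Finset.sum_le_sum fun e _ => sum_receiverSlotCost_le hP hn p hK).trans ?_
  rw [← Finset.mul_sum]
  refine mul_le_mul_of_nonneg_left ?_ (by positivity)
  rw [Finset.sum_add_distrib, Finset.sum_const, nsmul_eq_mul, ← Finset.mul_sum]
  have h := sum_heavyJam_le hP hb hp A hK1 I
  have h2 : 8 * (β : ℝ) / rho ^ I = 4 * (2 * β / rho ^ I) := by ring
  rw [h2]
  linarith

end Cost

section SenderCost

variable {V E M : Type*} {G : SimpleGraph V} {F : Set V} {n D : ℕ} {P : Plan V E M}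
  {C : Carol V E M P.window D} {e : E} {S L : ℝ≥0}

/-! #### The cost of a sender -/

open Classical in
/-- The cost of the sender of the execution `e`. -/
def senderCost (G : SimpleGraph V) (F : Set V) (n : ℕ) (C : Carol V E M P.window D) (S L : ℝ≥0)
    (e : E) (ω : Draws V E) : ℝ≥0∞ :=
  ∑ j ∈ Finset.range D,
    ((if Broadcasts F n D P C (lbState G F n D P C e ω j) e j ω then (S : ℝ≥0∞) else 0) +
     (if Awaits F n P (lbState G F n D P C e ω j) e j ω then (L : ℝ≥0∞) else 0))

theorem measurable_senderCost (hP : LocalPlan G n P) : Measurable (senderCost G F n C S L e) :=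
  Finset.measurable_sum _ fun j _ =>
    (measurable_ite_const (measurableSet_broadcasts hP j) S).add
      (measurable_ite_const (measurableSet_awaits hP j) L)

/-- The expected cost of a sender in one slot. -/
def senderSlotCost (G : SimpleGraph V) (F : Set V) (n : ℕ) (C : Carol V E M P.window D)
    (S L : ℝ≥0) (e : E) (j : ℕ) : ℝ :=
  S * (drawMeasure V E).real {ω | Broadcasts F n D P C (lbState G F n D P C e ω j) e j ω} +
    L * (drawMeasure V E).real {ω | Awaits F n P (lbState G F n D P C e ω j) e j ω}

theorem senderSlotCost_nonneg {j : ℕ} : 0 ≤ senderSlotCost G F n C S L e j := by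
  unfold senderSlotCost; positivity

theorem lintegral_senderCost (hP : LocalPlan G n P) :
    ∫⁻ ω, senderCost G F n C S L e ω ∂(drawMeasure V E) =
      ENNReal.ofReal (∑ j ∈ Finset.range D, senderSlotCost G F n C S L e j) :=
  lintegral_sum_ite (fun j => measurableSet_broadcasts hP j)
    (fun j => measurableSet_awaits hP j) D S L

theorem broadcasts_subset (hq : P.sender e ∉ F) {j : ℕ} :
    {ω | Broadcasts F n D P C (lbState G F n D P C e ω j) e j ω} ⊆
      Serving G F n C e j ∩ {ω | SendRule n j (ω (e, j, P.sender e))} := by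
  intro ω hω
  change Broadcasts F n D P C (lbState G F n D P C e ω j) e j ω at hω
  rw [Broadcasts, if_neg hq] at hω
  exact ⟨⟨hq, hω.1⟩, hω.2⟩

theorem awaits_subset {j : ℕ} :
    {ω | Awaits F n P (lbState G F n D P C e ω j) e j ω} ⊆
      Serving G F n C e j ∩ {ω | NackListenRule n j (ω (e, j, P.sender e))} :=
  fun _ hω => ⟨⟨hω.1, hω.2.1⟩, hω.2.2⟩

theorem senderSlotCost_le (hq : P.sender e ∉ F) {j s : ℕ} (h : s ≤ j) :
    senderSlotCost G F n C S L e j ≤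
      (S + L) * (drawMeasure V E).real (Serving G F n C e s) := by
  unfold senderSlotCost
  rw [add_mul]
  exact add_le_add
    (mul_le_mul_of_nonneg_left (measureReal_mono ((broadcasts_subset hq).trans
      (Set.inter_subset_left.trans (serving_anti h)))) S.2)
    (mul_le_mul_of_nonneg_left (measureReal_mono (awaits_subset.trans
      (Set.inter_subset_left.trans (serving_anti h)))) L.2)

theorem senderSlotCost_le_probSend (hP : LocalPlan G n P) (hn : 2 ≤ n) (hq : P.sender e ∉ F)
    {k o : ℕ} (ho : o < probSendLen (firstRound n + k)) :
    senderSlotCost G F n C S L e (roundStart n k + o) ≤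
      (S + L) * (drawMeasure V E).real (Serving G F n C e (roundStart n k)) *
        (3 * Real.log n / 2 ^ (firstRound n + k)) := by
  have hlen : o < roundLen (firstRound n + k) := ho.trans_le (probSendLen_le_roundLen _)
  have hph := phaseOf_probSend (n := n) rfl ho
  have hro := roundOf_roundStart_add (n := n) rfl hlen
  have hlog := log_gt hn
  have hfour := four_log_le_two_pow hn
  have hpow : (2 : ℝ) ^ firstRound n ≤ 2 ^ (firstRound n + k) :=
    pow_le_pow_right₀ (by norm_num) (by omega)
  have h1 : {ω | Awaits F n P (lbState G F n D P C e ω (roundStart n k + o)) e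
      (roundStart n k + o) ω} = ∅ := by
    refine Set.eq_empty_of_forall_notMem fun ω hω => ?_
    have h := hω.2.2
    unfold NackListenRule at h
    rw [hph] at h
    exact h
  have h2 : {ω | Broadcasts F n D P C (lbState G F n D P C e ω (roundStart n k + o)) e
      (roundStart n k + o) ω} ⊆ Serving G F n C e (roundStart n k + o) ∩
        {ω | (ω (e, roundStart n k + o, P.sender e) : ℝ) <
          3 * Real.log n / 2 ^ (firstRound n + k)} := by
    intro ω hω
    obtain ⟨h1, h2⟩ := broadcasts_subset hq hω
    refine ⟨h1, ?_⟩
    have h3 : SendRule n (roundStart n k + o) (ω (e, roundStart n k + o, P.sender e)) := h2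
    simp only [SendRule, hph, hro] at h3
    exact h3
  have h3 := measureReal_mono (μ := drawMeasure V E) h2
  rw [measureReal_serving_inter_lt hP (by positivity)
    (by rw [div_le_one (by positivity)]; linarith)] at h3
  have h4 := measureReal_mono (μ := drawMeasure V E) (serving_anti (G := G) (F := F) (n := n)
    (C := C) (e := e) (show roundStart n k ≤ roundStart n k + o by omega))
  unfold senderSlotCost
  rw [h1, measureReal_empty, mul_zero, add_zero, mul_assoc]
  exact mul_le_mul (by simp) (h3.trans (mul_le_mul_of_nonneg_right h4 (by positivity)))
    measureReal_nonneg (by positivity)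

theorem senderSlotCost_le_probNack (hP : LocalPlan G n P) (hn : 2 ≤ n) {k o : ℕ}
    (hq : P.sender e ∉ F)
    (ho : o < 2 ^ (firstRound n + k)) :
    senderSlotCost G F n C S L e (roundStart n k + (probSendLen (firstRound n + k) +
      detLen (firstRound n + k) + o)) ≤
      (S + L) * (drawMeasure V E).real (Serving G F n C e (roundStart n k)) *
        (4 * Real.log n / 2 ^ (firstRound n + k)) := by
  set o' := probSendLen (firstRound n + k) + detLen (firstRound n + k) + o with ho'
  have hlen : o' < roundLen (firstRound n + k) := by
    have := detLen_pos (firstRound n + k)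
    unfold roundLen
    omega
  have hph : phaseOf n (roundStart n k + o') = Phase.probNack :=
    phaseOf_probNack rfl (by omega) (by omega)
  have hro := roundOf_roundStart_add (n := n) rfl hlen
  have hlog := log_gt hn
  have hfour := four_log_le_two_pow hn
  have hpow : (2 : ℝ) ^ firstRound n ≤ 2 ^ (firstRound n + k) :=
    pow_le_pow_right₀ (by norm_num) (by omega)
  have h1 : {ω | Broadcasts F n D P C (lbState G F n D P C e ω (roundStart n k + o')) e
      (roundStart n k + o') ω} = ∅ := by
    refine Set.eq_empty_of_forall_notMem fun ω hω => ?_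
    have h : SendRule n (roundStart n k + o') (ω (e, roundStart n k + o', P.sender e)) :=
      (broadcasts_subset hq hω).2
    unfold SendRule at h
    rw [hph] at h
    exact h
  have h2 : {ω | Awaits F n P (lbState G F n D P C e ω (roundStart n k + o')) e
      (roundStart n k + o') ω} ⊆ Serving G F n C e (roundStart n k + o') ∩
        {ω | (ω (e, roundStart n k + o', P.sender e) : ℝ) <
          4 * Real.log n / 2 ^ (firstRound n + k)} := by
    intro ω hω
    obtain ⟨h1, h2⟩ := awaits_subset hω
    refine ⟨h1, ?_⟩
    have h3 : NackListenRule n (roundStart n k + o') (ω (e, roundStart n k + o', P.sender e)) := h2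
    simp only [NackListenRule, hph, hro] at h3
    exact h3
  have h3 := measureReal_mono (μ := drawMeasure V E) h2
  rw [measureReal_serving_inter_lt hP (by positivity)
    (by rw [div_le_one (by positivity)]; linarith)] at h3
  have h4 := measureReal_mono (μ := drawMeasure V E) (serving_anti (G := G) (F := F) (n := n)
    (C := C) (e := e) (show roundStart n k ≤ roundStart n k + o' by omega))
  unfold senderSlotCost
  rw [h1, measureReal_empty, mul_zero, zero_add, mul_assoc]
  exact mul_le_mul (by simp) (h3.trans (mul_le_mul_of_nonneg_right h4 (by positivity)))
    measureReal_nonneg (by positivity)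

/-- The long phase is used at rate `3 log n / 2^i`, which leaves `O(rho^i log n)` slots; the request
phase contributes `4 log n`, and the deterministic phases `O(rho^i)`. -/
theorem sum_senderSlotCost_round_le (hP : LocalPlan G n P) (hn : 2 ≤ n) (hq : P.sender e ∉ F)
    (k : ℕ) :
    ∑ o ∈ Finset.range (roundLen (firstRound n + k)),
      senderSlotCost G F n C S L e (roundStart n k + o) ≤
    19 * (S + L) * Real.log n * (rho ^ (firstRound n + k) *
      (drawMeasure V E).real (Serving G F n C e (roundStart n k))) := by
  set w := (drawMeasure V E).real (Serving G F n C e (roundStart n k)) with hw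
  have hw0 : 0 ≤ w := measureReal_nonneg
  have hlog := log_gt hn
  unfold roundLen
  rw [Finset.sum_range_add, Finset.sum_range_add, Finset.sum_range_add]
  have h1 := Finset.sum_le_card_nsmul (Finset.range (probSendLen (firstRound n + k)))
    (fun o => senderSlotCost G F n C S L e (roundStart n k + o)) _
    fun o ho => senderSlotCost_le_probSend hP hn hq (Finset.mem_range.1 ho)
  have h2 := Finset.sum_le_card_nsmul (Finset.range (detLen (firstRound n + k)))
    (fun o => senderSlotCost G F n C S L e
      (roundStart n k + (probSendLen (firstRound n + k) + o))) _
    fun o _ => senderSlotCost_le hq (s := roundStart n k) (by omega)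
  have h3 := Finset.sum_le_card_nsmul (Finset.range (2 ^ (firstRound n + k)))
    (fun o => senderSlotCost G F n C S L e (roundStart n k +
      (probSendLen (firstRound n + k) + detLen (firstRound n + k) + o))) _
    fun o ho => senderSlotCost_le_probNack hP hn hq (Finset.mem_range.1 ho)
  have h4 := Finset.sum_le_card_nsmul (Finset.range (detLen (firstRound n + k)))
    (fun o => senderSlotCost G F n C S L e (roundStart n k +
      (probSendLen (firstRound n + k) + detLen (firstRound n + k) + 2 ^ (firstRound n + k) + o))) _
    fun o _ => senderSlotCost_le hq (s := roundStart n k) (Nat.le_add_right _ _)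
  rw [Finset.card_range, nsmul_eq_mul] at h1 h2 h3 h4
  refine (add_le_add (add_le_add (add_le_add h1 h2) h3) h4).trans ?_
  have hi : 2 ≤ firstRound n + k := by have := two_le_firstRound hn; omega
  generalize firstRound n + k = i at hi
  rw [← hw]
  have h5 := probSendLen_le i
  have h6 := detLen_le i
  have h7 := rho_pow_ge_two hi
  have h8 := four_le_two_pow hi
  have h20 : (0 : ℝ) < 2 ^ i := by positivity
  have h9 : (probSendLen i : ℝ) * (3 * Real.log n / 2 ^ i) ≤ 3 * Real.log n * (rho ^ i + 1) := by
    rw [mul_div_assoc', div_le_iff₀ h20]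
    have : 0 ≤ Real.log n * (2 ^ i - 1) := mul_nonneg (by linarith) (by linarith)
    nlinarith
  have h10 : ((2 ^ i : ℕ) : ℝ) * (4 * Real.log n / 2 ^ i) = 4 * Real.log n := by
    push_cast
    field_simp
  have h11 : (0 : ℝ) ≤ (S + L) * w := by positivity
  have h12 : (probSendLen i : ℝ) * (3 * Real.log n / 2 ^ i) + detLen i +
      ((2 ^ i : ℕ) : ℝ) * (4 * Real.log n / 2 ^ i) + detLen i ≤ 19 * Real.log n * rho ^ i := by
    rw [h10]
    nlinarith
  calc (probSendLen i : ℝ) * ((S + L) * w * (3 * Real.log n / 2 ^ i)) +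
        (detLen i : ℝ) * ((S + L) * w) +
        ((2 ^ i : ℕ) : ℝ) * ((S + L) * w * (4 * Real.log n / 2 ^ i)) +
        (detLen i : ℝ) * ((S + L) * w)
      = ((probSendLen i : ℝ) * (3 * Real.log n / 2 ^ i) + detLen i +
          ((2 ^ i : ℕ) : ℝ) * (4 * Real.log n / 2 ^ i) + detLen i) * ((S + L) * w) := by
        ring
    _ ≤ (19 * Real.log n * rho ^ i) * ((S + L) * w) := mul_le_mul_of_nonneg_right h12 h11
    _ = _ := by ring

/-- Once the rounds are too long to be jammed, the sender survives each with probability at most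
`1 / 2`. -/
theorem measureReal_serving_succ_le {β : ℕ} (hP : LocalPlan G n P) (hn : 2 ≤ n)
    (hb : JamBounded G F n D P C β) (hq : P.sender e ∉ F) {k : ℕ}
    (hβ : 2 * (β : ℝ) ≤ 2 ^ (firstRound n + k)) (hD : roundStart n (k + 1) ≤ D) :
    (drawMeasure V E).real (Serving G F n C e (roundStart n (k + 1))) ≤
      (drawMeasure V E).real (Serving G F n C e (roundStart n k)) / 2 := by
  set w := (drawMeasure V E).real (Serving G F n C e (roundStart n k)) with hw
  have hw0 : 0 ≤ w := measureReal_nonneg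
  have hn' : (2 : ℝ) ≤ n := by exact_mod_cast hn
  rw [roundStart_succ] at hD
  have hR : roundLen (firstRound n + k) = probSendLen (firstRound n + k) +
    detLen (firstRound n + k) + 2 ^ (firstRound n + k) + detLen (firstRound n + k) := rfl
  have hps := probSendLen_le_roundLen (firstRound n + k)
  have hrecv : ∀ v, (drawMeasure V E).real
      (Waiting G F n C e v (roundStart n k + probSendLen (firstRound n + k))) ≤ 1 / n ^ 3 * w := by
    intro v
    refine le_trans (measureReal_mono fun ω hω => ?_)
      ((receiver_survives_le (G := G) (F := F) (C := C) (e := e) hP hn v k).trans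
        (mul_le_mul_of_nonneg_left (measureReal_mono (waiting_subset_serving hq))
          (by positivity)))
    refine ⟨hω, ?_⟩
    have h1 := countTo_le_of_jamBounded hb (e := e) hω.2.1
      (s := roundStart n k) (N := probSendLen (firstRound n + k)) (by omega) ω
    have h2 : (countTo (fun o => JamAt G F n C e v (roundStart n k + o))
      (probSendLen (firstRound n + k)) ω : ℝ) ≤ β := by exact_mod_cast h1
    have h3 := one_le_rho_pow (firstRound n + k)
    have h4 : (0 : ℝ) < 2 ^ (firstRound n + k) := by positivity
    nlinarith
  have hsend : (drawMeasure V E).real (Unaware G F n C e (roundStart n k +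
      (probSendLen (firstRound n + k) + detLen (firstRound n + k)) + 2 ^ (firstRound n + k))) ≤
      1 / n ^ 2 * w := by
    refine le_trans (measureReal_mono fun ω hω => ?_)
      (sender_survives_le (G := G) (F := F) (C := C) (e := e) hP hn k)
    refine ⟨hω, ?_⟩
    have h1 := countTo_le_of_jamBounded hb (e := e) hq
      (s := roundStart n k + (probSendLen (firstRound n + k) + detLen (firstRound n + k)))
      (N := 2 ^ (firstRound n + k)) (by omega) ω
    have h2 : (countTo (fun o => JamAt G F n C e (P.sender e) (roundStart n k +
      (probSendLen (firstRound n + k) + detLen (firstRound n + k)) + o))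
      (2 ^ (firstRound n + k)) ω : ℝ) ≤ β := by exact_mod_cast h1
    linarith
  have hfin := hP.finite_receivers e
  have hcard : (hfin.toFinset.card : ℝ) ≤ n := by
    have h1 := (Set.encard_le_encard (hP.receivers_subset e)).trans (hP.degree_le (P.sender e))
    rw [hfin.encard_eq_coe_toFinset_card] at h1
    exact_mod_cast h1
  have hunion : (drawMeasure V E).real (⋃ v ∈ P.receivers e,
      Waiting G F n C e v (roundStart n k + probSendLen (firstRound n + k))) ≤
      n * (1 / n ^ 3 * w) := by
    have h1 := measureReal_biUnion_finset_le (μ := drawMeasure V E) hfin.toFinset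
      fun v => Waiting G F n C e v (roundStart n k + probSendLen (firstRound n + k))
    simp only [Set.Finite.mem_toFinset] at h1
    refine h1.trans ((Finset.sum_le_card_nsmul _ _ _ fun v _ => hrecv v).trans ?_)
    rw [nsmul_eq_mul]
    exact mul_le_mul_of_nonneg_right hcard (by positivity)
  -- The union bound over at most `n` receivers and the sender itself gives `n * n⁻³ + n⁻² = 2 / n²
  -- ≤ 1/2`.
  refine (measureReal_mono (serving_subset k)).trans ((measureReal_union_le _ _).trans ?_)
  refine (add_le_add hunion hsend).trans ?_
  have h1 : (n : ℝ) * (1 / n ^ 3 * w) = 1 / n ^ 2 * w := by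
    field_simp
  rw [h1]
  have h2 : (1 : ℝ) / n ^ 2 ≤ 1 / 4 := by
    refine one_div_le_one_div_of_le (by norm_num) ?_
    nlinarith
  nlinarith

/-- Before `2^i` reaches `2β` survival is bounded by 1; afterwards it halves each round. So the cost
is governed by `rho^i = (2^i)^(φ-1)` at the threshold, and `152 = 19 * 8`. -/
theorem sum_senderSlotCost_le {β : ℕ} (hP : LocalPlan G n P) (hn : 2 ≤ n)
    (hb : JamBounded G F n D P C β) (hq : P.sender e ∉ F) :
    ∑ j ∈ Finset.range D, senderSlotCost G F n C S L e j ≤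
      152 * (S + L) * Real.log n * (8 * Real.log n + 4 * β) ^ (φ - 1) := by
  obtain ⟨K, hK, hK'⟩ := exists_rounds_cover n D
  have hlog := log_gt hn
  have hρ := rho_pos
  have hφ := goldenRatio_gt
  have h1 : ∑ j ∈ Finset.range D, senderSlotCost G F n C S L e j ≤
      ∑ j ∈ Finset.range (roundStart n K), senderSlotCost G F n C S L e j :=
    Finset.sum_le_sum_of_subset_of_nonneg (Finset.range_mono hK)
      fun _ _ _ => senderSlotCost_nonneg
  refine h1.trans ?_
  rw [sum_range_roundStart]
  refine (Finset.sum_le_sum fun k _ => sum_senderSlotCost_round_le hP hn hq k).trans ?_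
  rw [← Finset.mul_sum]
  -- For the least such round, `2^i` is either that of the first round, at most `8 log n`, or less
  -- than twice `2β`.
  obtain ⟨k₁, hk₁, hk₁'⟩ : ∃ k₁, 2 * (β : ℝ) ≤ 2 ^ (firstRound n + k₁) ∧
      (2 : ℝ) ^ (firstRound n + k₁) ≤ 8 * Real.log n + 4 * β := by
    classical
    have hex : ∃ k : ℕ, 2 * (β : ℝ) ≤ 2 ^ (firstRound n + k) := by
      obtain ⟨k, hk⟩ := pow_unbounded_of_one_lt (2 * (β : ℝ)) (show (1 : ℝ) < 2 by norm_num)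
      exact ⟨k, hk.le.trans (pow_le_pow_right₀ (by norm_num) (by omega))⟩
    obtain ⟨hs, hm⟩ := (⟨Nat.find_spec hex, fun m hm => Nat.find_min hex (m := m) hm⟩ :
      2 * (β : ℝ) ≤ 2 ^ (firstRound n + Nat.find hex) ∧
        ∀ m < Nat.find hex, ¬ 2 * (β : ℝ) ≤ 2 ^ (firstRound n + m))
    generalize Nat.find hex = k at hs hm
    refine ⟨k, hs, ?_⟩
    rcases k with _ | k
    · have := two_pow_firstRound_le hn
      have : (0 : ℝ) ≤ β := Nat.cast_nonneg _
      rw [add_zero]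
      linarith
    · have h2 := hm k (by omega)
      rw [not_le] at h2
      rw [← add_assoc, pow_succ]
      linarith
  have h2 := sum_rho_pow_mul_le
    (x := fun k => (drawMeasure V E).real (Serving G F n C e (roundStart n k)))
    (fun _ => measureReal_nonneg) (fun _ => measureReal_le_one) (K := K) (k₁ := k₁)
    (fun k hk hkK => measureReal_serving_succ_le hP hn hb hq
      (hk₁.trans (pow_le_pow_right₀ (by norm_num) (by omega))) (hK' _ hkK).le)
  have h3 : rho ^ (firstRound n + k₁) ≤ (8 * Real.log n + 4 * β) ^ (φ - 1) := by
    rw [← two_rpow_sub_one_mul, mul_comm, Real.rpow_mul (by norm_num), Real.rpow_natCast]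
    exact Real.rpow_le_rpow (by positivity) hk₁' (by linarith)
  have h4 : ∑ k ∈ Finset.range K, rho ^ (firstRound n + k) *
      (drawMeasure V E).real (Serving G F n C e (roundStart n k)) ≤
      8 * (8 * Real.log n + 4 * β) ^ (φ - 1) := by
    simp only [pow_add, mul_assoc]
    rw [← Finset.mul_sum]
    rw [pow_add] at h3
    have h5 := mul_le_mul_of_nonneg_left h2 (pow_nonneg hρ.le (firstRound n))
    linarith
  have h5 : (0 : ℝ) ≤ 19 * (S + L) * Real.log n := by positivity
  refine (mul_le_mul_of_nonneg_left h4 h5).trans (le_of_eq (by ring))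

/-! #### The cost of a node -/

theorem cost_le {p : V} {A B : Finset E} (hA : ∀ e, p ∈ P.receivers e → e ∈ A)
    (hB : ∀ e, P.sender e = p → e ∈ B) (ω : Draws V E) :
    cost G F n D P C S L ω p ≤
      ∑ e ∈ A, receiverCost G F n C S L e p ω + ∑ e ∈ B, senderCost G F n C S L e ω := by
  classical
  unfold cost
  have h : ∀ e, (∑ j ∈ Finset.range D,
      ((if (p = P.sender e ∧ Broadcasts F n D P C (lbState G F n D P C e ω j) e j ω) ∨
        Requests F n P (lbState G F n D P C e ω j) e j p then (S : ℝ≥0∞) else 0) +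
      (if (p = P.sender e ∧ Awaits F n P (lbState G F n D P C e ω j) e j ω) ∨
        TunedIn F n P (lbState G F n D P C e ω j) e j ω p then (L : ℝ≥0∞) else 0))) ≤
      (if e ∈ A then receiverCost G F n C S L e p ω else 0) +
        (if e ∈ B then senderCost G F n C S L e ω else 0) := by
    intro e
    have hrecv : (if e ∈ A then receiverCost G F n C S L e p ω else 0) =
        receiverCost G F n C S L e p ω := by
      split_ifs with h
      · rfl
      · symm
        unfold receiverCost
        refine Finset.sum_eq_zero fun j _ => ?_
        rw [if_neg fun h' => h (hA e h'.1), if_neg fun h' => h (hA e h'.1), add_zero]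
    by_cases hs : P.sender e = p
    · rw [hrecv, if_pos (hB e hs), receiverCost, senderCost, ← Finset.sum_add_distrib]
      refine Finset.sum_le_sum fun j _ => ?_
      rw [add_add_add_comm]
      refine add_le_add ?_ ?_
      · split_ifs <;> simp_all
      · split_ifs <;> simp_all
    · rw [hrecv]
      refine le_trans (le_of_eq ?_) le_self_add
      rw [receiverCost]
      refine Finset.sum_congr rfl fun j _ => ?_
      simp only [Ne.symm hs, false_and, false_or]
  refine (ENNReal.tsum_le_tsum h).trans ?_
  rw [ENNReal.tsum_add, tsum_eq_sum (s := A) (fun e he => if_neg he),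
    tsum_eq_sum (s := B) (fun e he => if_neg he)]
  refine add_le_add (Finset.sum_le_sum fun e he => ?_) (Finset.sum_le_sum fun e he => ?_)
  · rw [if_pos he]
  · rw [if_pos he]

/-- The expected cost of a correct node that listens in the executions in `A` and sends in the
executions in `B`. -/
theorem expectedCost_le {β : ℕ} (hP : LocalPlan G n P) (hn : 2 ≤ n)
    (hb : JamBounded G F n D P C β) {p : V} (hp : p ∉ F) {A B : Finset E}
    (hA : ∀ e, p ∈ P.receivers e → e ∈ A) (hB : ∀ e, P.sender e = p ↔ e ∈ B) (I : ℕ) :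
    expectedCost G F n D P C S L p ≤ ENNReal.ofReal ((S + L) * (9 *
      (A.card * (16 * Real.log n + 4 * 2 ^ I) + 8 * β / rho ^ I) +
      152 * B.card * Real.log n * (8 * Real.log n + 4 * β) ^ (φ - 1))) := by
  have hlog := log_gt hn
  have hρ := rho_pos
  unfold expectedCost
  refine (lintegral_mono (cost_le hA fun e => (hB e).1)).trans ?_
  rw [lintegral_add_left (Finset.measurable_sum _ fun e _ => measurable_receiverCost hP p),
    lintegral_finsetSum _ fun e _ => measurable_receiverCost hP p,
    lintegral_finsetSum _ fun e _ => measurable_senderCost hP]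
  have h1 : ∑ e ∈ B, ∫⁻ ω, senderCost G F n C S L e ω ∂(drawMeasure V E) ≤
      ENNReal.ofReal (B.card *
        (152 * (S + L) * Real.log n * (8 * Real.log n + 4 * β) ^ (φ - 1))) := by
    rw [ENNReal.ofReal_mul (Nat.cast_nonneg _), ENNReal.ofReal_natCast, ← nsmul_eq_mul]
    refine Finset.sum_le_card_nsmul _ _ _ fun e he => ?_
    rw [lintegral_senderCost hP]
    refine ENNReal.ofReal_le_ofReal (sum_senderSlotCost_le hP hn hb ?_)
    rw [(hB e).2 he]
    exact hp
  refine (add_le_add (sum_lintegral_receiverCost_le hP hn hb hp A I) h1).trans ?_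
  rw [← ENNReal.ofReal_add (by positivity) (by positivity)]
  exact ENNReal.ofReal_le_ofReal (le_of_eq (by ring))

end SenderCost

/-! ### The cost is a small fraction of the budget -/

/-- The claim is `X * ℓ ≤ β^(2-φ)`. It follows from the lower bound on `β` because `(φ + 1)(2 - φ) =
1`, which is where the exponent of the logarithm comes from; the cube of `X` suffices as `3(2 - φ) ≥
1`. -/
theorem log_mul_rpow_le {ℓ β X K : ℝ} (hℓ : 0 < ℓ) (hX : 1 ≤ X) (hK : X ^ 3 ≤ K)
    (h : K * ℓ ^ (φ + 1) ≤ β) : ℓ * β ^ (φ - 1) ≤ β / X := by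
  have hφ := goldenRatio_gt
  have hφ' := goldenRatio_lt
  have hX3 : 0 < X ^ 3 := by positivity
  have hℓp : 0 < ℓ ^ (φ + 1) := Real.rpow_pos_of_pos hℓ _
  have h1 : X ^ 3 * ℓ ^ (φ + 1) ≤ β := (mul_le_mul_of_nonneg_right hK hℓp.le).trans h
  have hβ : 0 < β := lt_of_lt_of_le (by positivity) h1
  have h2 : (X ^ 3 * ℓ ^ (φ + 1)) ^ (2 - φ) ≤ β ^ (2 - φ) :=
    Real.rpow_le_rpow (by positivity) h1 (by linarith)
  rw [Real.mul_rpow hX3.le hℓp.le, ← Real.rpow_mul hℓ.le,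
    show (φ + 1) * (2 - φ) = 1 by nlinarith [Real.goldenRatio_sq], Real.rpow_one] at h2
  have h3 : X ≤ (X ^ 3) ^ (2 - φ) := by
    rw [← Real.rpow_natCast, ← Real.rpow_mul (by linarith)]
    refine Real.self_le_rpow_of_one_le hX ?_
    push_cast
    linarith
  have h4 : X * ℓ ≤ β ^ (2 - φ) := (mul_le_mul_of_nonneg_right h3 hℓ.le).trans h2
  rw [le_div_iff₀ (by linarith)]
  calc ℓ * β ^ (φ - 1) * X = X * ℓ * β ^ (φ - 1) := by ring
    _ ≤ β ^ (2 - φ) * β ^ (φ - 1) := mul_le_mul_of_nonneg_right h4 (by positivity)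
    _ = β := by
      rw [← Real.rpow_add hβ]
      ring_nf
      exact Real.rpow_one β

set_option maxHeartbeats 800000 in
theorem exists_cost_constant {c ε a b : ℝ} (hc : 0 ≤ c) (hε : 0 < ε) (ha : 0 ≤ a) (hb : 0 ≤ b) :
    ∃ (K : ℝ) (I : ℕ), ∀ n β mA mB : ℕ, 2 ≤ n → K * (n * Real.log n ^ (φ + 1)) ≤ β →
      (mA : ℝ) ≤ a * n → (mB : ℝ) ≤ b →
      c * (9 * (mA * (16 * Real.log n + 4 * 2 ^ I) + 8 * β / rho ^ I) +
        152 * mB * Real.log n * (8 * Real.log n + 4 * β) ^ (φ - 1)) ≤ ε * β := by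
  have hφ := goldenRatio_gt
  have hφ' := goldenRatio_lt
  -- This choice makes the amortized jamming term `72 c β / rho^I` at most half of `ε β`.
  obtain ⟨I, hI⟩ := pow_unbounded_of_one_lt (144 * c / ε) (show (1 : ℝ) < rho by linarith [rho_gt])
  rw [div_lt_iff₀ hε] at hI
  -- `Y` collects the coefficients of the terms that are at most `β / X`, and `X` is chosen so that
  -- they fill at most the other half. Here `48 = 16 * 3` and `20 = 4 * 5` come from `n ℓ ≤ 3 y` and
  -- `n ≤ 5 y`, and `4256 = 152 * 28` from `8 ℓ + 4 β ≤ 28 β`.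
  set Y := c * (9 * (a * (48 + 20 * 2 ^ I)) + 4256 * b) with hY
  have hY0 : 0 ≤ Y := by positivity
  set X := 1 + 2 * Y / ε with hX
  have hX1 : 1 ≤ X := by
    have : 0 ≤ 2 * Y / ε := by positivity
    linarith
  clear_value X Y
  refine ⟨X ^ 3, I, fun n β mA mB hn hK hA hB => ?_⟩
  have hlog := log_gt hn
  have hn' : (2 : ℝ) ≤ n := by exact_mod_cast hn
  have hℓ : 0 < Real.log n := by linarith
  generalize Real.log n = ℓ at hK hlog hℓ ⊢
  set y := (n : ℝ) * ℓ ^ (φ + 1) with hy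
  have hXK : X ≤ X ^ 3 := le_self_pow₀ hX1 (by norm_num)
  have hp : ℓ / 3 ≤ ℓ ^ (φ + 1) := by
    rw [Real.rpow_add hℓ, Real.rpow_one]
    have h1 : (1 / 3 : ℝ) ≤ ℓ ^ φ := by
      rcases le_or_gt 1 ℓ with h | h
      · have := Real.one_le_rpow h (by linarith : 0 ≤ φ)
        linarith
      · have := Real.rpow_le_rpow_of_exponent_ge hℓ h.le (by push_cast; linarith : φ ≤ ((2 : ℕ) : ℝ))
        rw [Real.rpow_natCast] at this
        nlinarith
    nlinarith
  have hlp : 0 < ℓ ^ (φ + 1) := Real.rpow_pos_of_pos hℓ _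
  have hnl : n * ℓ ≤ 3 * y := by
    rw [hy]; nlinarith
  have hn5 : (n : ℝ) ≤ 5 * y := by nlinarith
  have hy0 : 0 < y := by positivity
  have hyX : y * X ≤ β := by
    have : y * X ≤ X ^ 3 * y := by nlinarith
    linarith
  have hβy : y ≤ β := by nlinarith
  have hβ0 : (0 : ℝ) < β := by linarith
  have hthird : ℓ * (β : ℝ) ^ (φ - 1) ≤ β / X := by
    refine log_mul_rpow_le hℓ hX1 le_rfl (le_trans ?_ hK)
    refine mul_le_mul_of_nonneg_left ?_ (by positivity)
    rw [hy]
    nlinarith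
  have hbase : (8 * ℓ + 4 * β) ^ (φ - 1) ≤ 28 * (β : ℝ) ^ (φ - 1) := by
    have h1 : 8 * ℓ + 4 * β ≤ 28 * β := by
      have : ℓ ≤ n * ℓ := by nlinarith
      linarith
    refine (Real.rpow_le_rpow (by positivity) h1 (by linarith)).trans ?_
    rw [Real.mul_rpow (by norm_num) hβ0.le]
    refine mul_le_mul_of_nonneg_right ?_ (by positivity)
    have := Real.rpow_le_rpow_of_exponent_le (by norm_num : (1 : ℝ) ≤ 28)
      (by linarith : φ - 1 ≤ 1)
    rwa [Real.rpow_one] at this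
  clear_value y
  have hρI : 0 < rho ^ I := pow_pos rho_pos I
  have h1 : (mA : ℝ) * (16 * ℓ + 4 * 2 ^ I) ≤ a * (48 + 20 * 2 ^ I) * (β / X) := by
    have h2 : y ≤ β / X := by rwa [le_div_iff₀ (by linarith)]
    calc (mA : ℝ) * (16 * ℓ + 4 * 2 ^ I) ≤ a * n * (16 * ℓ + 4 * 2 ^ I) :=
          mul_le_mul_of_nonneg_right hA (by positivity)
      _ = a * (16 * (n * ℓ) + 4 * 2 ^ I * n) := by ring
      _ ≤ a * (16 * (3 * y) + 4 * 2 ^ I * (5 * y)) := by gcongr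
      _ = a * (48 + 20 * 2 ^ I) * y := by ring
      _ ≤ _ := by gcongr
  have h2 : 152 * mB * ℓ * (8 * ℓ + 4 * β) ^ (φ - 1) ≤ 4256 * b * (β / X) := by
    calc 152 * mB * ℓ * (8 * ℓ + 4 * β) ^ (φ - 1)
        ≤ 152 * b * ℓ * (28 * (β : ℝ) ^ (φ - 1)) := by gcongr
      _ = 4256 * b * (ℓ * (β : ℝ) ^ (φ - 1)) := by ring
      _ ≤ _ := by gcongr
  have h3 : c * (9 * (8 * β / rho ^ I)) ≤ ε / 2 * β := by
    rw [show c * (9 * (8 * β / rho ^ I)) = 72 * c * β / rho ^ I by ring, div_le_iff₀ hρI]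
    linarith [mul_lt_mul_of_pos_right hI hβ0]
  have h4 : Y * (β / X) ≤ ε / 2 * β := by
    rw [mul_div_assoc', div_le_iff₀ (by linarith)]
    have : ε * X = ε + 2 * Y := by rw [hX]; field_simp
    have h : ε / 2 * β * X = (ε / 2 + Y) * β := by linear_combination (β / 2 : ℝ) * this
    rw [h]
    exact mul_le_mul_of_nonneg_right (by linarith) hβ0.le
  have h5 : c * (9 * (a * (48 + 20 * 2 ^ I) * (β / X) + 8 * β / rho ^ I) +
      4256 * b * (β / X)) = Y * (β / X) + c * (9 * (8 * β / rho ^ I)) := by rw [hY]; ring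
  generalize (mA : ℝ) * (16 * ℓ + 4 * 2 ^ I) = u at h1 ⊢
  generalize 152 * (mB : ℝ) * ℓ * (8 * ℓ + 4 * β) ^ (φ - 1) = v at h2 ⊢
  refine (mul_le_mul_of_nonneg_left ?_ hc).trans (h5.le.trans (by linarith))
  linarith

/-! ### The executions in which a node takes part -/

section Counting

variable {V M : Type*} {G : SimpleGraph V} {d : V} {t n : ℕ} {m : M}

theorem fcpa_localPlan (hdeg : ∀ p, (G.neighborSet p).encard ≤ n) :
    LocalPlan G n (fcpaPlan G d t m) :=
  ⟨fun _ _ hp => hp.1.symm, hdeg⟩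

theorem cpa_localPlan {K : ℕ} (hdeg : ∀ p, (G.neighborSet p).encard ≤ n) :
    LocalPlan G n (cpaPlan G d t K m) :=
  ⟨fun _ _ hp => hp, hdeg⟩

theorem fcpa_executions (hdeg : ∀ p, (G.neighborSet p).encard ≤ n) (p : V) :
    ∃ A B : Finset V, (∀ e, p ∈ (fcpaPlan G d t m).receivers e → e ∈ A) ∧
      (∀ e, (fcpaPlan G d t m).sender e = p ↔ e ∈ B) ∧ A.card ≤ n ∧ B.card ≤ 1 := by
  have hfin : (G.neighborSet p).Finite := Set.finite_of_encard_le_coe (hdeg p)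
  refine ⟨hfin.toFinset, {p}, fun e he => ?_, fun e => by simp [fcpaPlan], ?_, by simp⟩
  · exact hfin.mem_toFinset.2 he.1
  · have h := hdeg p
    rw [hfin.encard_eq_coe_toFinset_card] at h
    exact_mod_cast h

theorem cpa_executions {K : ℕ} (hdeg : ∀ p, (G.neighborSet p).encard ≤ n) (p : V) :
    ∃ A B : Finset (Option (Fin K × V)), (∀ e, p ∈ (cpaPlan G d t K m).receivers e → e ∈ A) ∧
      (∀ e, (cpaPlan G d t K m).sender e = p ↔ e ∈ B) ∧ A.card ≤ K * n + 1 ∧ B.card ≤ K + 1 := by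
  classical
  have hfin : (G.neighborSet p).Finite := Set.finite_of_encard_le_coe (hdeg p)
  have hcard : hfin.toFinset.card ≤ n := by
    have h := hdeg p
    rw [hfin.encard_eq_coe_toFinset_card] at h
    exact_mod_cast h
  refine ⟨Finset.insertNone (Finset.univ ×ˢ hfin.toFinset),
    (Finset.insertNone (Finset.univ ×ˢ {p})).filter (fun e => (cpaPlan G d t K m).sender e = p),
    fun e he => ?_, fun e => ?_, ?_, ?_⟩
  · rcases e with _ | ⟨k, q⟩
    · simp
    · have h : G.Adj q p := he
      simp [h.symm]
  · rw [Finset.mem_filter]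
    refine ⟨fun h => ⟨?_, h⟩, fun h => h.2⟩
    rcases e with _ | ⟨k, q⟩
    · simp
    · have h : q = p := h
      simp [h]
  · rw [Finset.card_insertNone, Finset.card_product, Finset.card_univ, Fintype.card_fin]
    have := Nat.mul_le_mul_left K hcard
    omega
  · refine (Finset.card_filter_le _ _).trans ?_
    rw [Finset.card_insertNone, Finset.card_product, Finset.card_univ, Fintype.card_fin]
    simp

end Counting

/-! ### Degrees in the grid, and the number of grid executions that involve a given node. -/

section GridCounting

variable {r t : ℕ} {M : Type*} {m : M}

theorem gridGraph_adj {u v : ℤ × ℤ} : (gridGraph r).Adj u v ↔ u ≠ v ∧ u ∈ gridBall r v := by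
  unfold gridGraph
  rw [SimpleGraph.fromRel_adj]
  refine and_congr_right fun _ => ⟨fun h => h.elim id fun h => ?_, Or.inl⟩
  exact ⟨by rw [abs_sub_comm]; exact h.1, by rw [abs_sub_comm]; exact h.2⟩

theorem grid_localPlan : LocalPlan (gridGraph r) (gridDegree r) (gridPlan r t m) := by
  refine ⟨fun e v hv => ?_, fun p => ?_⟩
  · rw [SimpleGraph.mem_neighborSet, SimpleGraph.adj_comm, gridGraph_adj]
    cases e with
    | dealer => exact hv
    | commit κ s w h =>
      obtain ⟨s', w', rfl, h1, h2, h3, h4, h5⟩ := hv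
      rw [abs_le] at h5
      refine ⟨fun he => ?_, ?_⟩
      · have := (Corridor.node_inj he).1
        omega
      · change _ ∈ gridBall r (κ.node r s w)
        cases κ <;> simp only [Corridor.node, gridBall, Set.mem_ofPred_eq, abs_le] <;> omega
    | heard κ s w σ h =>
      obtain ⟨s', w', rfl, h1, h2, h3, h4, h5⟩ := hv
      have hw := h.2.1
      have hσ := h.2.2
      rw [abs_le] at h2
      rw [abs_lt] at hw
      refine ⟨fun he => ?_, ?_⟩
      · have := (Corridor.node_inj he).2
        omega
      · change _ ∈ gridBall r (κ.node r s w)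
        cases κ <;> simp only [Corridor.node, gridBall, Set.mem_ofPred_eq, abs_le] <;> omega
  · set B : Finset (ℤ × ℤ) := (Finset.Icc (p.1 - r) (p.1 + r) ×ˢ
      Finset.Icc (p.2 - r) (p.2 + r)).erase p with hB
    have hsub : (gridGraph r).neighborSet p ⊆ B := by
      intro v hv
      rw [SimpleGraph.mem_neighborSet, SimpleGraph.adj_comm, gridGraph_adj] at hv
      have h1 := abs_le.1 hv.2.1
      have h2 := abs_le.1 hv.2.2
      rw [Finset.mem_coe, hB, Finset.mem_erase, Finset.mem_product, Finset.mem_Icc, Finset.mem_Icc]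
      exact ⟨hv.1, ⟨by omega, by omega⟩, by omega, by omega⟩
    refine (Set.encard_le_encard hsub).trans ?_
    rw [Set.encard_coe_eq_coe_finsetCard, hB, Finset.card_erase_of_mem, Finset.card_product,
      Int.card_Icc, Int.card_Icc]
    · refine le_of_eq ?_
      congr 1
      unfold gridDegree
      rw [show (p.1 + r + 1 - (p.1 - r)).toNat = 2 * r + 1 by omega,
        show (p.2 + r + 1 - (p.2 - r)).toNat = 2 * r + 1 by omega, sq]
    · rw [Finset.mem_product, Finset.mem_Icc, Finset.mem_Icc]
      omega

/-- Corridor, row, column, and the direction of the sister node. -/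
def gridCode : GridExec r → Option (Corridor × ℕ × ℤ × ℤ)
  | .dealer => none
  | .commit κ s w _ => some (κ, s, w, 0)
  | .heard κ s w σ _ => some (κ, s, w, σ)

/-- The direction is 0 for commit messages and `±1` for heard messages, so the two kinds cannot
collide. -/
theorem gridCode_injective : Function.Injective (gridCode (r := r)) := by
  intro e e' h
  cases e with
  | dealer => cases e' <;> simp [gridCode] at h ⊢
  | commit κ s w hs =>
    cases e' with
    | dealer => simp [gridCode] at h
    | commit κ' s' w' hs' =>
      simp only [gridCode, Option.some.injEq, Prod.mk.injEq] at h
      obtain ⟨rfl, rfl, rfl, -⟩ := h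
      rfl
    | heard κ' s' w' σ' hs' =>
      simp only [gridCode, Option.some.injEq, Prod.mk.injEq] at h
      have := hs'.2.2
      omega
  | heard κ s w σ hs =>
    cases e' with
    | dealer => simp [gridCode] at h
    | commit κ' s' w' hs' =>
      simp only [gridCode, Option.some.injEq, Prod.mk.injEq] at h
      have := hs.2.2
      omega
    | heard κ' s' w' σ' hs' =>
      simp only [gridCode, Option.some.injEq, Prod.mk.injEq] at h
      obtain ⟨rfl, rfl, rfl, rfl⟩ := h
      rfl

open Classical in
/-- The corridors that contain `p`. -/
def corridorsAt (r : ℕ) (p : ℤ × ℤ) : Finset Corridor :=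
  {.up, .down, .right ((p.2 + r) / (2 * r + 1)), .left ((p.2 + r) / (2 * r + 1))}

open Classical in
theorem card_corridorsAt_le (p : ℤ × ℤ) : (corridorsAt r p).card ≤ 4 := by
  unfold corridorsAt
  exact Finset.card_le_four

/-- A node determines its corridor and its position there up to finitely many choices: the row is
the absolute value of a coordinate, and the column is either the abscissa or the remainder of the
ordinate modulo `2r + 1`, centred at 0. -/
theorem Corridor.mem_corridorsAt (κ : Corridor) {s : ℕ} {w : ℤ} (hw : |w| ≤ (r : ℤ)) :
    κ ∈ corridorsAt r (κ.node r s w) ∧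
      (s = (κ.node r s w).1.natAbs ∨ s = (κ.node r s w).2.natAbs) ∧
      (w = (κ.node r s w).1 ∨
        w = (κ.node r s w).2 - ((κ.node r s w).2 + r) / (2 * r + 1) * (2 * r + 1)) := by
  rw [abs_le] at hw
  have hdiv : ∀ k : ℤ, (k * (2 * r + 1) + w + r) / (2 * r + 1) = k := by
    intro k
    rw [add_assoc, add_comm, Int.add_mul_ediv_right _ _ (by omega),
      Int.ediv_eq_zero_of_lt (by omega) (by omega), zero_add]
  cases κ with
  | up => simp [corridorsAt, Corridor.node]
  | down => simp [corridorsAt, Corridor.node]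
  | right k => simp [corridorsAt, Corridor.node, hdiv]
  | left k => simp [corridorsAt, Corridor.node, hdiv]

open Classical in
/-- The codes of the executions that involve `p`, whose rows are in `rows` and whose columns are in
`cols`. -/
def codesAt (r : ℕ) (p : ℤ × ℤ) (rows : Finset ℕ) (cols : Finset ℤ) :
    Finset (Option (Corridor × ℕ × ℤ × ℤ)) :=
  Finset.insertNone (corridorsAt r p ×ˢ rows ×ˢ cols ×ˢ {0, 1, -1})

theorem card_codesAt_le (p : ℤ × ℤ) (rows : Finset ℕ) (cols : Finset ℤ) :
    (codesAt r p rows cols).card ≤ 4 * (rows.card * (cols.card * 3)) + 1 := by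
  unfold codesAt
  rw [Finset.card_insertNone, Finset.card_product, Finset.card_product, Finset.card_product]
  have h : ({0, 1, -1} : Finset ℤ).card = 3 := by decide
  rw [h]
  have := Nat.mul_le_mul_right (rows.card * (cols.card * 3)) (card_corridorsAt_le (r := r) p)
  omega

theorem some_mem_codesAt {p : ℤ × ℤ} {rows : Finset ℕ} {cols : Finset ℤ} {κ : Corridor} {s : ℕ}
    {w σ : ℤ} (h1 : κ ∈ corridorsAt r p) (h2 : s ∈ rows) (h3 : w ∈ cols)
    (h4 : σ = 0 ∨ σ = 1 ∨ σ = -1) : some (κ, s, w, σ) ∈ codesAt r p rows cols := by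
  unfold codesAt
  rw [Finset.some_mem_insertNone, Finset.mem_product, Finset.mem_product, Finset.mem_product]
  refine ⟨h1, h2, h3, ?_⟩
  simp only [Finset.mem_insert, Finset.mem_singleton]
  exact h4

theorem none_mem_codesAt {p : ℤ × ℤ} {rows : Finset ℕ} {cols : Finset ℤ} :
    none ∈ codesAt r p rows cols := by
  unfold codesAt
  exact Finset.none_mem_insertNone

theorem gridCode_mem_of_receiver {p : ℤ × ℤ} {e : GridExec r} (he : p ∈ gridReceivers r e) :
    gridCode e ∈ codesAt r p
      (Finset.Ico (p.1.natAbs - r) (p.1.natAbs + r) ∪ Finset.Ico (p.2.natAbs - r) (p.2.natAbs + r))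
      (Finset.Icc (-(r : ℤ)) r) := by
  cases e with
  | dealer => exact none_mem_codesAt
  | commit κ s w h =>
    obtain ⟨s', w', rfl, h1, h2, h3, h4, h5⟩ := he
    obtain ⟨hκ, hs, -⟩ := κ.mem_corridorsAt (s := s') h2
    refine some_mem_codesAt hκ ?_ (Finset.mem_Icc.2 (abs_le.1 h.2)) (Or.inl rfl)
    rw [Finset.mem_union, Finset.mem_Ico, Finset.mem_Ico]
    omega
  | heard κ s w σ h =>
    obtain ⟨s', w', rfl, h1, h2, h3, h4, h5⟩ := he
    obtain ⟨hκ, hs, -⟩ := κ.mem_corridorsAt (s := s') h2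
    refine some_mem_codesAt hκ ?_ (Finset.mem_Icc.2 (abs_le.1 h.2.1.le)) ?_
    · rw [Finset.mem_union, Finset.mem_Ico, Finset.mem_Ico]
      omega
    · have := h.2.2
      omega

theorem gridCode_mem_of_sender {p : ℤ × ℤ} {e : GridExec r} (he : gridSender r e = p) :
    gridCode e ∈ codesAt r p {p.1.natAbs, p.2.natAbs}
      {p.1, p.2 - (p.2 + r) / (2 * r + 1) * (2 * r + 1)} := by
  subst he
  cases e with
  | dealer => exact none_mem_codesAt
  | commit κ s w h =>
    obtain ⟨hκ, hs, hw⟩ := κ.mem_corridorsAt (s := s) h.2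
    refine some_mem_codesAt hκ ?_ ?_ (Or.inl rfl)
    · rw [Finset.mem_insert, Finset.mem_singleton]
      exact hs
    · rw [Finset.mem_insert, Finset.mem_singleton]
      exact hw
  | heard κ s w σ h =>
    obtain ⟨hκ, hs, hw⟩ := κ.mem_corridorsAt (s := s) h.2.1.le
    refine some_mem_codesAt hκ ?_ ?_ ?_
    · rw [Finset.mem_insert, Finset.mem_singleton]
      exact hs
    · rw [Finset.mem_insert, Finset.mem_singleton]
      exact hw
    · have := h.2.2
      omega

/-- Four corridors, at most `4r` rows, `2r + 1` columns and three directions, plus the dealer's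
execution, bound the receptions by `O(r²)`, like the degree. For sending, two rows and two columns
give `4 * 2 * 2 * 3 + 1 = 49`. -/
theorem grid_executions (hr : 1 ≤ r) (p : ℤ × ℤ) :
    ∃ A B : Finset (GridExec r), (∀ e, p ∈ (gridPlan r t m).receivers e → e ∈ A) ∧
      (∀ e, (gridPlan r t m).sender e = p ↔ e ∈ B) ∧ A.card ≤ 49 * gridDegree r ∧
      B.card ≤ 49 := by
  classical
  have hfinA : {e | p ∈ gridReceivers r e}.Finite :=
    (Finset.finite_toSet (codesAt r p (Finset.Ico (p.1.natAbs - r) (p.1.natAbs + r) ∪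
      Finset.Ico (p.2.natAbs - r) (p.2.natAbs + r)) (Finset.Icc (-(r : ℤ)) r))).preimage
      gridCode_injective.injOn |>.subset fun e he => gridCode_mem_of_receiver he
  have hfinB : {e | gridSender r e = p}.Finite :=
    (Finset.finite_toSet (codesAt r p {p.1.natAbs, p.2.natAbs}
      {p.1, p.2 - (p.2 + r) / (2 * r + 1) * (2 * r + 1)})).preimage
      gridCode_injective.injOn |>.subset fun e he => gridCode_mem_of_sender he
  refine ⟨hfinA.toFinset, hfinB.toFinset, fun e he => hfinA.mem_toFinset.2 he,
    fun e => hfinB.mem_toFinset.symm, ?_, ?_⟩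
  · refine (Finset.card_le_card_of_injOn gridCode (fun e he =>
      gridCode_mem_of_receiver (hfinA.mem_toFinset.1 he)) gridCode_injective.injOn).trans ?_
    refine (card_codesAt_le _ _ _).trans ?_
    have h1 : (Finset.Ico (p.1.natAbs - r) (p.1.natAbs + r) ∪
        Finset.Ico (p.2.natAbs - r) (p.2.natAbs + r)).card ≤ 4 * r := by
      refine (Finset.card_union_le _ _).trans ?_
      rw [Nat.card_Ico, Nat.card_Ico]
      omega
    have h2 : (Finset.Icc (-(r : ℤ)) r).card = 2 * r + 1 := by
      rw [Int.card_Icc]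
      omega
    rw [h2]
    have h3 := Nat.mul_le_mul_right ((2 * r + 1) * 3) h1
    have h4 : gridDegree r = 4 * (r * r) + 4 * r := by
      unfold gridDegree
      rw [Nat.sub_eq_iff_eq_add (Nat.one_le_pow _ _ (by omega))]
      ring
    have h5 : 4 * r * ((2 * r + 1) * 3) = 24 * (r * r) + 12 * r := by ring
    rw [h4]
    omega
  · refine (Finset.card_le_card_of_injOn gridCode (fun e he =>
      gridCode_mem_of_sender (hfinB.mem_toFinset.1 he)) gridCode_injective.injOn).trans ?_
    refine (card_codesAt_le _ _ _).trans ?_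
    have h1 := Finset.card_le_two (a := p.1.natAbs) (b := p.2.natAbs)
    have h2 := Finset.card_le_two (a := p.1)
      (b := p.2 - (p.2 + r) / (2 * r + 1) * (2 * r + 1))
    have h3 := Nat.mul_le_mul h1 (Nat.mul_le_mul_right 3 h2)
    omega

end GridCounting

end JamRB

end

/-! ### Assembly: reliability, counting of executions, and the choice of constants. -/

theorem theorem3 (S L : ℝ≥0) (ε : ℝ) (hε : 0 < ε) :
    (∃ K : ℝ,
      -- the grid
      (∀ (r t : ℕ), (t : ℝ) < (r : ℝ) / 2 * (2 * r + 1) →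
        ∀ (M : Type*) (m : M) (F : Set (ℤ × ℤ)),
          (0, 0) ∉ F → (∀ c, (F ∩ gridBall r c).encard ≤ t) →
        ∀ (B₀ β : ℕ), 1 ≤ B₀ → β ≤ B₀ →
        ∀ C : Carol (ℤ × ℤ) (GridExec r) M (gridPlan r t m).window (windowLen (gridDegree r) B₀),
          (∀ ω, ∀ p ∉ F, disruptedSlots (gridGraph r) F (gridDegree r)
            (windowLen (gridDegree r) B₀) (gridPlan r t m) C ω p ≤ β) →
          (∀ ω, ReliableBroadcast (gridGraph r) F (gridDegree r)
            (windowLen (gridDegree r) B₀) (gridPlan r t m) C m ω) ∧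
          (K * (gridDegree r * Real.log (gridDegree r) ^ (φ + 1)) ≤ β →
            ∀ p ∉ F, expectedCost (gridGraph r) F (gridDegree r)
              (windowLen (gridDegree r) B₀) (gridPlan r t m) C S L p ≤ ENNReal.ofReal (ε * β))) ∧
      -- FCPA on a graph with `2t < X(p)` for all nodes `p` that are not neighbours of the dealer
      (∀ (V : Type*) (G : SimpleGraph V) (d : V) (n t : ℕ), 2 ≤ n →
          (∀ p, (G.neighborSet p).encard ≤ n) →
          (∀ p, p ≠ d → ¬ G.Adj d p → (2 * t : ℕ∞) < (closerNeighbors G d p).encard) →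
        ∀ (M : Type*) (m : M) (F : Set V), d ∉ F → LocallyBounded G t F →
        ∀ (B₀ β : ℕ), 1 ≤ B₀ → β ≤ B₀ →
        ∀ C : Carol V V M (fcpaPlan G d t m).window (windowLen n B₀),
          (∀ ω, ∀ p ∉ F,
            disruptedSlots G F n (windowLen n B₀) (fcpaPlan G d t m) C ω p ≤ β) →
          (∀ ω, ReliableBroadcast G F n (windowLen n B₀) (fcpaPlan G d t m) C m ω) ∧
          (K * (n * Real.log n ^ (φ + 1)) ≤ β →
            ∀ p ∉ F, expectedCost G F n (windowLen n B₀) (fcpaPlan G d t m) C S L p ≤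
              ENNReal.ofReal (ε * β)))) ∧
    -- CPA on any graph on which it achieves reliable broadcast in the absence of jamming
    (∀ (n N : ℕ), 2 ≤ n → ∃ β₀ : ℕ,
      ∀ (V : Type*) (_ : Finite V), Nat.card V = N →
      ∀ (G : SimpleGraph V) (d : V) (t : ℕ), (∀ p, (G.neighborSet p).encard ≤ n) →
      ∀ (M : Type*), CPAAchievesRB G d t M →
      ∀ (m : M) (F : Set V), d ∉ F → LocallyBounded G t F →
      ∀ (B₀ β : ℕ), 1 ≤ B₀ → β ≤ B₀ →
      ∀ C : Carol V (Option (Fin N × V)) M (cpaPlan G d t N m).window (windowLen n B₀),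
        (∀ ω, ∀ p ∉ F,
          disruptedSlots G F n (windowLen n B₀) (cpaPlan G d t N m) C ω p ≤ β) →
        (∀ ω, ReliableBroadcast G F n (windowLen n B₀) (cpaPlan G d t N m) C m ω) ∧
        (β₀ ≤ β →
          ∀ p ∉ F, expectedCost G F n (windowLen n B₀) (cpaPlan G d t N m) C S L p ≤
            ENNReal.ofReal (ε * β))) := by
  obtain ⟨K, I, hK⟩ := exists_cost_constant (c := (S : ℝ) + L) (a := 49) (b := 49) (by positivity)
    hε (by norm_num) (by norm_num)
  refine ⟨⟨K, ?_, ?_⟩, ?_⟩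
  · intro r t ht M m F hd hF B₀ β _ hβ C hb
    have ht' : 2 * t < r * (2 * r + 1) := by
      have h : (2 : ℝ) * t < r * (2 * r + 1) := by linarith
      exact_mod_cast h
    have hr : 1 ≤ r := by
      rcases Nat.eq_zero_or_pos r with rfl | h
      · simp at ht'
      · exact h
    have hn : 2 ≤ gridDegree r := by
      have h : 3 ^ 2 ≤ (2 * r + 1) ^ 2 := Nat.pow_le_pow_left (by omega) 2
      unfold gridDegree
      omega
    refine ⟨fun ω => grid_reliable hn hd hF hβ hb ht', fun hKβ p hp => ?_⟩
    obtain ⟨A, B, hA, hB, hA', hB'⟩ := grid_executions (t := t) (m := m) hr p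
    exact (expectedCost_le grid_localPlan hn hb hp hA hB I).trans (ENNReal.ofReal_le_ofReal
      (hK _ β _ _ hn hKβ (by exact_mod_cast hA') (by exact_mod_cast hB')))
  · intro V G d n t hn hdeg hX M m F hd hF B₀ β _ hβ C hb
    refine ⟨fun ω => fcpa_reliable hn hX hd hF hβ hb, fun hKβ p hp => ?_⟩
    obtain ⟨A, B, hA, hB, hA', hB'⟩ := fcpa_executions (d := d) (t := t) (m := m) hdeg p
    refine (expectedCost_le (fcpa_localPlan hdeg) hn hb hp hA hB I).trans
      (ENNReal.ofReal_le_ofReal (hK _ β _ _ hn hKβ ?_ ?_))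
    · have h : A.card ≤ 49 * n := by omega
      exact_mod_cast h
    · have h : B.card ≤ 49 := by omega
      exact_mod_cast h
  · intro n N hn
    -- In CPA a node takes part in executions of all `N` rounds, so the constant depends on `N`: it
    -- receives in at most `N * n + 1 ≤ (N + 1) * n` executions and sends in at most `N + 1`.
    obtain ⟨K, I, hK⟩ := exists_cost_constant (c := (S : ℝ) + L) (a := N + 1) (b := N + 1)
      (by positivity) hε (by positivity) (by positivity)
    refine ⟨⌈K * (n * Real.log n ^ (φ + 1))⌉₊, ?_⟩
    intro V _ hV G d t hdeg M hG m F hd hF B₀ β _ hβ C hb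
    refine ⟨fun ω => cpa_reliable hV hn hG hd hF hβ hb, fun hKβ p hp => ?_⟩
    obtain ⟨A, B, hA, hB, hA', hB'⟩ := cpa_executions (d := d) (t := t) (m := m) (K := N) hdeg p
    refine (expectedCost_le (cpa_localPlan hdeg) hn hb hp hA hB I).trans
      (ENNReal.ofReal_le_ofReal (hK n β _ _ hn (Nat.ceil_le.1 hKβ) ?_ ?_))
    · have h : A.card ≤ (N + 1) * n := by
        rw [add_mul]
        omega
      exact_mod_cast h
    · exact_mod_cast hB'
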